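/- Let $d\ge 1$ be an integer, let $0<\alpha<\beta$ be real numbers, and let $r>\alpha$ be an integer. Write $\mathcal D'(\mathbf R^d)$ for the space of real Schwartz distributions on $\mathbf R^d$ (the dual of $C_c^\infty(\mathbf R^d)$, with the topology of uniform convergence on compact sets of test functions), $\varphi_x^\lambda(y)=\lambda^{-d}\varphi(\lambda^{-1}(y-x))$, and $\mathcal B_r$ for the set of smooth functions supported in the closed unit ball around the origin whose derivatives of order at most $r$ are bounded by $1$. Let $\mathcal C^{-\alpha}$ be the space of all $\eta\in\mathcal D'(\mathbf R^d)$ such that, for every compact $K\subset\mathbf R^d$, there is a constant $C$ with $|\eta(\varphi_x^\lambda)|\le C\lambda^{-\alpha}$ for all $\varphi\in\mathcal B_r$, $x\in K$, $\lambda\in(0,1]$; the best such constants are seminorms, which define its topology. Let $n$ be the largest integer with $n<\beta$, and let $\mathcal C^{\beta}$ be the space of all $f\in C^n(\mathbf R^d)$ whose $n$-th derivative is locally $(\beta-n)$-Hölder continuous, with the topology given by the seminorms, over compact sets $K$, defined as the smallest constant that bounds all derivatives of order at most $n$ on $K$ and the $(\beta-n)$-Hölder constant of the $n$-th derivative on $K$.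 Then there is a (jointly) continuous bilinear map $B:\mathcal C^{-\alpha}\times\mathcal C^{\beta}\to\mathcal D'(\mathbf R^d)$ such that every continuous function $f$ (viewed as a distribution) belongs to $\mathcal C^{-\alpha}$ and $B(f,g)=fg$ for every continuous $f$ and every $g\in\mathcal C^\beta$. Moreover, $B$ is given by reconstruction in the following sense. Let $\mathscr T$ be the regularity structure with homogeneities $A=\mathbf N\cup(\mathbf N-\alpha)$ whose model space $T$ has the basis vectors $X^k$, of homogeneity $|k|$, and $\Xi X^k$, of homogeneity $|k|-\alpha$, for multi-indices $k\in\mathbf N^d$, and whose structure group consists of the translations $\Gamma_h$, $h\in\mathbf R^d$, given by $\Gamma_hX^k=(X-h)^k$ and $\Gamma_h(\Xi X^k)=\Xi(X-h)^k$. For $\xi\in\mathcal C^{-\alpha}$ put $\Pi^\xi_xX^k=(\cdot-x)^k$, $\Pi^\xi_x(\Xi X^k)=(\cdot-x)^k\xi$ and $\Gamma_{xy}=\Gamma_{y-x}$. Then $(\Pi^\xi,\Gamma)$ is a model for $\mathscr T$ on $\mathbf R^d$ (with the analytic bounds tested against $\mathcal B_r$). For $f\in\mathcal C^\beta$ put $(\Xi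 F)(x)=\sum_{|k|<\beta}\frac{D^kf(x)}{k!}\,\Xi X^k$. Then $\Xi F\in\mathcal D^{\beta-\alpha}$, that is, it takes values in the span of the basis vectors of homogeneity less than $\beta-\alpha$ and, for every $a\in A$ with $a<\beta-\alpha$, the norm of the component of homogeneity $a$ of $(\Xi F)(x)-\Gamma_{xy}(\Xi F)(y)$ is at most a constant times $|x-y|^{\beta-\alpha-a}$, uniformly over $x,y$ in any compact set. Finally, $B(\xi,f)$ is the reconstruction of $\Xi F$ for this model: it is the unique $\eta\in\mathcal D'(\mathbf R^d)$ such that, for every compact $K$, there is a constant $C$ with $|(\eta-\Pi^\xi_x(\Xi F)(x))(\varphi_x^\lambda)|\le C\lambda^{\beta-\alpha}$ for all $\varphi\in\mathcal B_r$, $x\in K$, $\lambda\in(0,1]$. -/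

import Mathlib

open Set Filter Topology MeasureTheory TopologicalSpace
open scoped Distributions DirectSum ContDiff

noncomputable section

namespace RegStr

/-! ### Test functions and distributions on `ℝ^d` -/

/-- Euclidean space `ℝ^d`. -/
abbrev Sp (d : ℕ) : Type := EuclideanSpace ℝ (Fin d)

/-- Smooth compactly supported real test functions on `ℝ^d`. -/
abbrev TestFn (d : ℕ) : Type := TestFunction (⊤ : Opens (Sp d)) ℝ ⊤

/-- Schwartz distributions on `ℝ^d`: the dual of the space of smooth compactly supported functions,
with Mathlib's topology (uniform convergence on compact sets of test functions). -/
abbrev Dist (d : ℕ) : Type := Distribution (⊤ : Opens (Sp d)) ℝ ⊤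

/-- The rescaled and recentred test function `φ_x^l(y) = l^{-d} φ(l^{-1}(y - x))`. -/
def scaled {d : ℕ} (φ : TestFn d) (x : Sp d) (l : ℝ) (hl : 0 < l) : TestFn d where
  toFun y := (l ^ d)⁻¹ * φ (l⁻¹ • (y - x))
  contDiff' := by
    have h := φ.contDiff
    exact contDiff_const.mul (h.comp (by fun_prop : ContDiff ℝ ∞ fun y : Sp d => l⁻¹ • (y - x)))
  hasCompactSupport' := by
    have h : HasCompactSupport (fun y => φ (l⁻¹ • (y - x))) :=
      φ.hasCompactSupport.comp_homeomorph
        ((Homeomorph.subRight x).trans (Homeomorph.smulOfNeZero l⁻¹ (inv_ne_zero hl.ne')))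
    exact h.mul_left
  tsupport_subset' := fun _ _ => trivial

/-- The smooth elements of `𝓑_r`: test functions supported in the closed unit ball around the
origin, all of whose derivatives of order at most `r` are bounded by `1`. -/
def unitTests (d r : ℕ) : Set (TestFn d) :=
  {φ | tsupport φ ⊆ Metric.closedBall 0 1 ∧
    ∀ i ≤ r, ∀ y, ‖iteratedFDeriv ℝ i φ y‖ ≤ 1}

/-- The distribution `φ ↦ ∫ φ f` given by a continuous function `f`. -/
def ofContinuous {d : ℕ} (f : C(Sp d, ℝ)) : Dist d where
  toLinearMap := (TestFunction.integralAgainstBilinCLM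
    (ContinuousLinearMap.mul ℝ ℝ) volume f : TestFn d →L[ℝ] ℝ).toLinearMap
  cont := (TestFunction.integralAgainstBilinCLM
    (ContinuousLinearMap.mul ℝ ℝ) volume f : TestFn d →L[ℝ] ℝ).continuous

theorem ofContinuous_apply {d : ℕ} (f : C(Sp d, ℝ)) (φ : TestFn d) :
    ofContinuous f φ = ∫ y, φ y * f y :=
  TestFunction.integralAgainstBilinCLM_eq_integral
    (B := ContinuousLinearMap.mul ℝ ℝ) (f := φ)
    (f.continuous.locallyIntegrable.locallyIntegrableOn _)

/-- Multiplication of test functions by a smooth function `g`. -/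
def mulTest {d : ℕ} (g : Sp d → ℝ) (hg : ContDiff ℝ ∞ g) : TestFn d →L[ℝ] TestFn d :=
  TestFunction.limitCLM ℝ
    (fun φ =>
      { toFun := fun y => φ y * g y
        contDiff' := φ.contDiff.mul hg
        hasCompactSupport' := φ.hasCompactSupport.mul_right
        tsupport_subset' := fun _ _ => trivial })
    (fun _ hK => (TestFunction.ofSupportedInCLM ℝ hK).comp
      (ContDiffMapSupportedIn.bilinLeftCLM (ContinuousLinearMap.mul ℝ ℝ) hg))
    (fun _ _ _ => rfl)

/-- The product `g ξ` of a distribution `ξ` with a smooth function `g`. -/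
def smoothMul {d : ℕ} (g : Sp d → ℝ) (hg : ContDiff ℝ ∞ g) (ξ : Dist d) : Dist d where
  toFun φ := ξ (mulTest g hg φ)
  map_add' φ ψ := by rw [map_add, map_add]
  map_smul' c φ := by rw [map_smul, map_smul]; rfl
  cont := by
    have h : Continuous ξ := ξ.cont
    exact h.comp (mulTest g hg).continuous

/-! ### Seminorms given by best constants -/

/-- If `Bd C v` means that `v` obeys certain homogeneous and subadditive bounds with constant `C`,
then the best constant `v ↦ inf {C ≥ 0 | Bd C v}` is a seminorm. -/
def bestConst {V : Type*} [AddCommGroup V] [Module ℝ V] (Bd : ℝ → V → Prop)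
    (hadd : ∀ C D u v, Bd C u → Bd D v → Bd (C + D) (u + v))
    (hsmul : ∀ C (c : ℝ) v, Bd C v → Bd (|c| * C) (c • v))
    (hex : ∀ v, ∃ C, 0 ≤ C ∧ Bd C v) : Seminorm ℝ V :=
  Seminorm.ofSMulLE (fun v => sInf {C : ℝ | 0 ≤ C ∧ Bd C v})
    (by
      obtain ⟨C, -, hC⟩ := hex 0
      refine le_antisymm (csInf_le ⟨0, fun _ h => h.1⟩ ⟨le_rfl, ?_⟩)
        (Real.sInf_nonneg fun _ h => h.1)
      simpa using hsmul C 0 0 hC)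
    (by
      intro u v
      refine le_of_forall_pos_lt_add fun ε hε => ?_
      obtain ⟨C, hC, hCu⟩ := exists_lt_of_csInf_lt (hex u)
        (lt_add_of_pos_right (sInf {C : ℝ | 0 ≤ C ∧ Bd C u}) (half_pos hε))
      obtain ⟨D, hD, hDv⟩ := exists_lt_of_csInf_lt (hex v)
        (lt_add_of_pos_right (sInf {C : ℝ | 0 ≤ C ∧ Bd C v}) (half_pos hε))
      have h : sInf {C : ℝ | 0 ≤ C ∧ Bd C (u + v)} ≤ C + D :=
        csInf_le ⟨0, fun _ h => h.1⟩ ⟨add_nonneg hC.1 hD.1, hadd C D u v hC.2 hD.2⟩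
      linarith)
    (by
      intro c v
      rw [Real.norm_eq_abs]
      rcases eq_or_ne c 0 with rfl | hc
      · obtain ⟨C, -, hC⟩ := hex v
        simp only [abs_zero, zero_mul]
        exact csInf_le ⟨0, fun _ h => h.1⟩ ⟨le_rfl, by simpa using hsmul C 0 v hC⟩
      · have hc' : 0 < |c| := abs_pos.mpr hc
        rw [← div_le_iff₀' hc']
        refine le_csInf (hex v) fun C hC => ?_
        rw [div_le_iff₀' hc']
        exact csInf_le ⟨0, fun _ h => h.1⟩ ⟨mul_nonneg hc'.le hC.1, hsmul C c v hC.2⟩)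

/-! ### The space `𝒞^{-α}` for `α > 0` -/

/-- The bound `|η(φ_x^l)| ≤ C l^{-α}` uniformly over `φ ∈ 𝓑_r`, `x ∈ K` and `l ∈ (0,1]`. -/
def NegBound {d : ℕ} (α : ℝ) (r : ℕ) (K : Compacts (Sp d)) (C : ℝ) (η : Dist d) : Prop :=
  ∀ φ ∈ unitTests d r, ∀ x ∈ K, ∀ (l : ℝ) (hl : 0 < l), l ≤ 1 →
    |η (scaled φ x l hl)| ≤ C * l ^ (-α)

theorem NegBound.add {d : ℕ} {α : ℝ} {r : ℕ} {K : Compacts (Sp d)} {C D : ℝ} {η ζ : Dist d}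
    (hC : NegBound α r K C η) (hD : NegBound α r K D ζ) : NegBound α r K (C + D) (η + ζ) := by
  intro φ hφ x hx l hl hl1
  calc |(η + ζ) (scaled φ x l hl)|
      = |η (scaled φ x l hl) + ζ (scaled φ x l hl)| := rfl
    _ ≤ |η (scaled φ x l hl)| + |ζ (scaled φ x l hl)| := abs_add_le _ _
    _ ≤ C * l ^ (-α) + D * l ^ (-α) := add_le_add (hC φ hφ x hx l hl hl1) (hD φ hφ x hx l hl hl1)
    _ = (C + D) * l ^ (-α) := by ring

theorem NegBound.smul {d : ℕ} {α : ℝ} {r : ℕ} {K : Compacts (Sp d)} {C : ℝ} {η : Dist d}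
    (c : ℝ) (hC : NegBound α r K C η) : NegBound α r K (|c| * C) (c • η) := by
  intro φ hφ x hx l hl hl1
  calc |(c • η) (scaled φ x l hl)| = |c * η (scaled φ x l hl)| := rfl
    _ = |c| * |η (scaled φ x l hl)| := abs_mul _ _
    _ ≤ |c| * (C * l ^ (-α)) := mul_le_mul_of_nonneg_left (hC φ hφ x hx l hl hl1) (abs_nonneg c)
    _ = |c| * C * l ^ (-α) := by ring

/-- Distributions `η` with `|η(φ_x^l)| ≲ l^{-α}` uniformly over `φ ∈ 𝓑_r`, `l ∈ (0,1]` and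
locally uniformly in `x`. -/
def holderNegSubmodule (d : ℕ) (α : ℝ) (r : ℕ) : Submodule ℝ (Dist d) where
  carrier := {η | ∀ K : Compacts (Sp d), ∃ C : ℝ, 0 ≤ C ∧ NegBound α r K C η}
  zero_mem' := fun _ => ⟨0, le_rfl, fun _ _ _ _ _ _ _ => by simp⟩
  add_mem' := by
    intro η ζ hη hζ K
    obtain ⟨C, hC0, hC⟩ := hη K
    obtain ⟨D, hD0, hD⟩ := hζ K
    exact ⟨C + D, add_nonneg hC0 hD0, hC.add hD⟩
  smul_mem' := by
    intro c η hη K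
    obtain ⟨C, hC0, hC⟩ := hη K
    exact ⟨|c| * C, mul_nonneg (abs_nonneg c) hC0, hC.smul c⟩

/-- The space `𝒞^{-α}`, defined with test functions of class `𝒞^r`. It is a type of its own because
it carries its own topology, not the one induced by distributions. -/
def HolderNeg (d : ℕ) (α : ℝ) (r : ℕ) : Type := holderNegSubmodule d α r

instance (d : ℕ) (α : ℝ) (r : ℕ) : AddCommGroup (HolderNeg d α r) :=
  inferInstanceAs (AddCommGroup (holderNegSubmodule d α r))

instance (d : ℕ) (α : ℝ) (r : ℕ) : Module ℝ (HolderNeg d α r) :=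
  inferInstanceAs (Module ℝ (holderNegSubmodule d α r))

/-- The inclusion of `𝒞^{-α}` into distributions. -/
def HolderNeg.toDist {d : ℕ} {α : ℝ} {r : ℕ} : HolderNeg d α r →ₗ[ℝ] Dist d :=
  (holderNegSubmodule d α r).subtype

/-- The seminorm of `𝒞^{-α}` attached to a compact set `K`: the best constant in `NegBound`. -/
def holderNegSeminorm (d : ℕ) (α : ℝ) (r : ℕ) : SeminormFamily ℝ (HolderNeg d α r)
    (Compacts (Sp d)) := fun K =>
  bestConst (fun C η => NegBound α r K C η.toDist)
    (fun _ _ _ _ h₁ h₂ => h₁.add h₂) (fun _ c _ h => h.smul c) (fun η => η.2 K)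

instance (d : ℕ) (α : ℝ) (r : ℕ) : TopologicalSpace (HolderNeg d α r) :=
  (holderNegSeminorm d α r).moduleFilterBasis.topology

/-! ### The Hölder space `𝒞^β` for `β > 0` -/

/-- The largest integer strictly below `β > 0`. -/
def below (β : ℝ) : ℕ := ⌈β⌉₊ - 1

/-- With `n` the largest integer strictly below `β`: on `K`, the derivatives of `f` of order at most
`n` are bounded by `C`, and the `n`-th one is `(β - n)`-Hölder with constant `C`. -/
def PosBound {d : ℕ} (β : ℝ) (K : Compacts (Sp d)) (C : ℝ) (f : Sp d → ℝ) : Prop :=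
  (∀ i ≤ below β, ∀ x ∈ K, ‖iteratedFDeriv ℝ i f x‖ ≤ C) ∧
  ∀ x ∈ K, ∀ y ∈ K,
    ‖iteratedFDeriv ℝ (below β) f x - iteratedFDeriv ℝ (below β) f y‖ ≤
      C * ‖x - y‖ ^ (β - below β)

theorem PosBound.add {d : ℕ} {β : ℝ} {K : Compacts (Sp d)} {C D : ℝ} {f g : Sp d → ℝ}
    (hf : ContDiff ℝ (below β) f) (hg : ContDiff ℝ (below β) g)
    (hC : PosBound β K C f) (hD : PosBound β K D g) : PosBound β K (C + D) (f + g) := by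
  have key : ∀ i ≤ below β, ∀ x,
      iteratedFDeriv ℝ i (f + g) x = iteratedFDeriv ℝ i f x + iteratedFDeriv ℝ i g x := by
    intro i hi x
    exact iteratedFDeriv_add_apply (hf.contDiffAt.of_le (by exact_mod_cast hi))
      (hg.contDiffAt.of_le (by exact_mod_cast hi))
  refine ⟨fun i hi x hx => ?_, fun x hx y hy => ?_⟩
  · rw [key i hi]
    exact (norm_add_le _ _).trans (add_le_add (hC.1 i hi x hx) (hD.1 i hi x hx))
  · rw [key _ le_rfl, key _ le_rfl, add_sub_add_comm, add_mul]
    exact (norm_add_le _ _).trans (add_le_add (hC.2 x hx y hy) (hD.2 x hx y hy))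

theorem PosBound.smul {d : ℕ} {β : ℝ} {K : Compacts (Sp d)} {C : ℝ} {f : Sp d → ℝ} (c : ℝ)
    (hf : ContDiff ℝ (below β) f) (hC : PosBound β K C f) : PosBound β K (|c| * C) (c • f) := by
  have key : ∀ i ≤ below β, ∀ x, iteratedFDeriv ℝ i (c • f) x = c • iteratedFDeriv ℝ i f x := by
    intro i hi x
    exact iteratedFDeriv_const_smul_apply (hf.contDiffAt.of_le (by exact_mod_cast hi))
  refine ⟨fun i hi x hx => ?_, fun x hx y hy => ?_⟩
  · rw [key i hi, norm_smul, Real.norm_eq_abs]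
    exact mul_le_mul_of_nonneg_left (hC.1 i hi x hx) (abs_nonneg c)
  · rw [key _ le_rfl, key _ le_rfl, ← smul_sub, norm_smul, Real.norm_eq_abs, mul_assoc]
    exact mul_le_mul_of_nonneg_left (hC.2 x hx y hy) (abs_nonneg c)

/-- Functions of class `𝒞^n`, with `n` the largest integer strictly below `β`, whose `n`-th
derivative is locally `(β - n)`-Hölder. For integer `β` this asks for a locally Lipschitz
derivative of order `β - 1`. -/
def holderPosSubmodule (d : ℕ) (β : ℝ) : Submodule ℝ (Sp d → ℝ) where
  carrier := {f | ContDiff ℝ (below β) f ∧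
    ∀ K : Compacts (Sp d), ∃ C : ℝ, 0 ≤ C ∧ PosBound β K C f}
  zero_mem' := ⟨contDiff_const, fun _ => ⟨0, le_rfl, fun _ _ _ _ => by simp, fun _ _ _ _ => by simp⟩⟩
  add_mem' := by
    rintro f g ⟨hf, hf'⟩ ⟨hg, hg'⟩
    refine ⟨hf.add hg, fun K => ?_⟩
    obtain ⟨C, hC0, hC⟩ := hf' K
    obtain ⟨D, hD0, hD⟩ := hg' K
    exact ⟨C + D, add_nonneg hC0 hD0, hC.add hf hg hD⟩
  smul_mem' := by
    rintro c f ⟨hf, hf'⟩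
    refine ⟨contDiff_const.smul hf, fun K => ?_⟩
    obtain ⟨C, hC0, hC⟩ := hf' K
    exact ⟨|c| * C, mul_nonneg (abs_nonneg c) hC0, hC.smul c hf⟩

/-- The local Hölder space `𝒞^β`; like `HolderNeg` it carries its own topology. -/
def HolderPos (d : ℕ) (β : ℝ) : Type := holderPosSubmodule d β

instance (d : ℕ) (β : ℝ) : AddCommGroup (HolderPos d β) :=
  inferInstanceAs (AddCommGroup (holderPosSubmodule d β))

instance (d : ℕ) (β : ℝ) : Module ℝ (HolderPos d β) :=
  inferInstanceAs (Module ℝ (holderPosSubmodule d β))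

/-- The function underlying an element of `𝒞^β`. -/
def HolderPos.toFun {d : ℕ} {β : ℝ} : HolderPos d β →ₗ[ℝ] (Sp d → ℝ) :=
  (holderPosSubmodule d β).subtype

/-- An element of `𝒞^β` as a continuous function. -/
def HolderPos.toCont {d : ℕ} {β : ℝ} (f : HolderPos d β) : C(Sp d, ℝ) :=
  ⟨f.toFun, f.2.1.continuous⟩

/-- The seminorm of `𝒞^β` attached to a compact set `K`: the best constant in `PosBound`. -/
def holderPosSeminorm (d : ℕ) (β : ℝ) : SeminormFamily ℝ (HolderPos d β) (Compacts (Sp d)) :=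
  fun K => bestConst (fun C f => PosBound β K C f.toFun)
    (fun _ _ f g h₁ h₂ => h₁.add f.2.1 g.2.1 h₂) (fun _ c f h => h.smul c f.2.1)
    (fun f => f.2.2 K)

instance (d : ℕ) (β : ℝ) : TopologicalSpace (HolderPos d β) :=
  (holderPosSeminorm d β).moduleFilterBasis.topology

/-! ### Regularity structures and models -/

/-- A regularity structure `(A, T, G)`: an index set `A ⊂ ℝ`, bounded below and without
accumulation point, a model space `T = ⨁_{a ∈ A} T_a` with Banach spaces `T_a`, and a group `G`
of operators on `T` with `Γ τ - τ ∈ ⨁_{b < a} T_b` for `τ ∈ T_a`. -/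
structure RegularityStructure where
  A : Set ℝ
  bddBelow : BddBelow A
  no_accPt : ∀ x : ℝ, ¬ AccPt x (𝓟 A)
  V : A → Type
  [normed : ∀ a, NormedAddCommGroup (V a)]
  [space : ∀ a, NormedSpace ℝ (V a)]
  [complete : ∀ a, CompleteSpace (V a)]
  G : Subgroup ((⨁ a, V a) ≃ₗ[ℝ] (⨁ a, V a))
  /-- All the components `T_a → T_b` of an operator in `G` are continuous. -/
  continuous_G : ∀ Γ ∈ G, ∀ a b : A, Continuous fun τ : V a => Γ (DirectSum.lof ℝ A V a τ) b
  triangular : ∀ Γ ∈ G, ∀ (a : A) (τ : V a) (b : A), ¬ b < a →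
    (Γ (DirectSum.lof ℝ A V a τ) - DirectSum.lof ℝ A V a τ) b = 0

attribute [instance] RegularityStructure.normed RegularityStructure.space
  RegularityStructure.complete

/-- The model space `T = ⨁_{a ∈ A} T_a`. -/
abbrev RegularityStructure.T (S : RegularityStructure) : Type := ⨁ a, S.V a

/-- The inclusion of `T_a` into `T`. -/
abbrev RegularityStructure.incl (S : RegularityStructure) (a : S.A) : S.V a →ₗ[ℝ] S.T :=
  DirectSum.lof ℝ S.A S.V a

/-- `(Π, Γ)` is a model for the regularity structure `S` on `ℝ^d`, the analytic bounds being
tested against `𝓑_r`. -/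
structure IsModel {d : ℕ} (S : RegularityStructure) (r : ℕ)
    (P : Sp d → S.T →ₗ[ℝ] Dist d) (Γ : Sp d → Sp d → S.G) : Prop where
  order : |sInf S.A| < r
  continuous : ∀ x (a : S.A), Continuous fun τ : S.V a => P x (S.incl a τ)
  mul : ∀ x y z, Γ x y * Γ y z = Γ x z
  compat : ∀ x y τ, P x ((Γ x y : S.T ≃ₗ[ℝ] S.T) τ) = P y τ
  bound_P : ∀ (K : Compacts (Sp d)) (γ : ℝ), 0 < γ → ∃ C : ℝ, ∀ φ ∈ unitTests d r, ∀ x ∈ K,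
    ∀ (l : ℝ) (hl : 0 < l), l ≤ 1 → ∀ a : S.A, (a : ℝ) ≤ γ → ∀ τ : S.V a,
      |P x (S.incl a τ) (scaled φ x l hl)| ≤ C * l ^ (a : ℝ) * ‖τ‖
  bound_Γ : ∀ (K : Compacts (Sp d)) (γ : ℝ), 0 < γ → ∃ C : ℝ, ∀ x ∈ K, ∀ y ∈ K,
    ∀ a : S.A, (a : ℝ) ≤ γ → ∀ b : S.A, b < a → ∀ τ : S.V a,
      ‖(Γ x y : S.T ≃ₗ[ℝ] S.T) (S.incl a τ) b‖ ≤ C * ‖x - y‖ ^ ((a : ℝ) - b) * ‖τ‖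

/-- Membership in `𝒟^γ`: a function with values in `⨁_{a < γ} T_a` such that
`‖F(x) - Γ_{xy} F(y)‖_a ≲ |x - y|^{γ - a}` locally uniformly, for every `a < γ`. -/
def MemD {d : ℕ} (S : RegularityStructure) (Γ : Sp d → Sp d → S.G) (γ : ℝ)
    (F : Sp d → S.T) : Prop :=
  (∀ x (a : S.A), γ ≤ a → F x a = 0) ∧
  ∀ (K : Compacts (Sp d)) (a : S.A), (a : ℝ) < γ → ∃ C : ℝ, ∀ x ∈ K, ∀ y ∈ K,
    ‖(F x - (Γ x y : S.T ≃ₗ[ℝ] S.T) (F y)) a‖ ≤ C * ‖x - y‖ ^ (γ - a)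

/-- The bound that characterises the reconstruction `η` of a modelled distribution `F ∈ 𝒟^γ`:
`|(η - Π_x F(x))(φ_x^l)| ≲ l^γ` uniformly over `φ ∈ 𝓑_r`, `l ∈ (0,1]` and locally uniformly
in `x`. -/
def IsReconstruction {d : ℕ} (S : RegularityStructure) (r : ℕ)
    (P : Sp d → S.T →ₗ[ℝ] Dist d) (γ : ℝ) (F : Sp d → S.T) (η : Dist d) : Prop :=
  ∀ K : Compacts (Sp d), ∃ C : ℝ, ∀ φ ∈ unitTests d r, ∀ x ∈ K, ∀ (l : ℝ) (hl : 0 < l), l ≤ 1 →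
    |(η - P x (F x)) (scaled φ x l hl)| ≤ C * l ^ γ

/-! ### Two copies of the polynomial structure: `T = V ⊕ W` -/

/-- Polynomials in the commuting variables `X_1, …, X_d`. -/
abbrev Poly (d : ℕ) : Type := MvPolynomial (Fin d) ℝ

/-- Basis vectors of `T`: `Sum.inl k` stands for `X^k`, `Sum.inr k` for `Ξ X^k`. -/
abbrev Idx (d : ℕ) : Type := (Fin d →₀ ℕ) ⊕ (Fin d →₀ ℕ)

/-- The set of homogeneities `A = ℕ ∪ (ℕ - α)`. -/
def homs (α : ℝ) : Set ℝ := {a | ∃ n : ℕ, a = n ∨ a = n - α}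

/-- The homogeneity: `|k|` for `X^k` and `|k| - α` for `Ξ X^k`. -/
def hom {d : ℕ} (α : ℝ) : Idx d → homs α
  | Sum.inl k => ⟨(k.degree : ℝ), k.degree, Or.inl rfl⟩
  | Sum.inr k => ⟨(k.degree : ℝ) - α, k.degree, Or.inr rfl⟩

instance (d : ℕ) (α : ℝ) (a : homs α) : Finite {i : Idx d // hom α i = a} := by
  have hfin : ∀ c : ℝ, {k : Fin d →₀ ℕ | (k.degree : ℝ) = c}.Finite := by
    intro c
    refine (Finsupp.finite_of_degree_le (σ := Fin d) ⌊c⌋₊).subset fun k hk => ?_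
    exact Nat.le_floor (le_of_eq hk)
  refine Set.Finite.to_subtype (s := {i : Idx d | hom α i = a})
    ((((hfin a).image Sum.inl).union ((hfin (a + α)).image Sum.inr)).subset ?_)
  rintro (k | k) hk
  · exact Or.inl ⟨k, congrArg Subtype.val hk, rfl⟩
  · refine Or.inr ⟨k, ?_, rfl⟩
    have h : (k.degree : ℝ) - α = a := congrArg Subtype.val hk
    change (k.degree : ℝ) = a + α
    linarith

instance (d : ℕ) (α : ℝ) (a : homs α) : Fintype {i : Idx d // hom α i = a} := Fintype.ofFinite _

/-- The space `T_a`: coefficients on the basis vectors of homogeneity `a`. -/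
abbrev comp (d : ℕ) (α : ℝ) (a : homs α) : Type := {i : Idx d // hom α i = a} → ℝ

/-- The identification of `T = ⨁_a T_a` with `V ⊕ W`, where `V` and `W` are two copies of the
polynomials: `(P, Q)` stands for `P(X) + Ξ Q(X)`. -/
def toPoly (d : ℕ) (α : ℝ) : (⨁ a, comp d α a) ≃ₗ[ℝ] Poly d × Poly d :=
  ((DFinsupp.mapRange.linearEquiv fun a : homs α =>
      (Finsupp.linearEquivFunOnFinite ℝ ℝ {i : Idx d // hom α i = a}).symm).trans
    (sigmaFinsuppLequivDFinsupp ℝ).symm).trans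
  ((Finsupp.domLCongr (Equiv.sigmaFiberEquiv (hom (d := d) α))).trans
    ((MvPolynomial.basisMonomials (Fin d) ℝ).prod (MvPolynomial.basisMonomials (Fin d) ℝ)).repr.symm)

/-- The coefficient of a basis vector in `(P, Q)`. -/
def coeffAt {d : ℕ} (p : Poly d × Poly d) : Idx d → ℝ
  | Sum.inl k => p.1.coeff k
  | Sum.inr k => p.2.coeff k

theorem coeffAt_toPoly {d : ℕ} {α : ℝ} (τ : ⨁ a, comp d α a) (i : Idx d) :
    coeffAt (toPoly d α τ) i = τ (hom α i) ⟨i, rfl⟩ := by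
  have h : ∀ p : Poly d × Poly d, coeffAt p i = ((MvPolynomial.basisMonomials (Fin d) ℝ).prod
      (MvPolynomial.basisMonomials (Fin d) ℝ)).repr p i := by
    intro p
    rcases i with k | k <;> simp [coeffAt] <;> rfl
  rw [h]
  rw [toPoly, LinearEquiv.trans_apply, LinearEquiv.trans_apply, LinearEquiv.apply_symm_apply]
  rfl

/-- Translation of polynomials: `X^k ↦ (X - h)^k`. -/
def transl {d : ℕ} (h : Sp d) : Poly d →ₐ[ℝ] Poly d :=
  MvPolynomial.aeval fun i => MvPolynomial.X i - MvPolynomial.C (h i)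

theorem transl_transl {d : ℕ} (h h' : Sp d) (p : Poly d) :
    transl h (transl h' p) = transl (h + h') p := by
  have : (transl h).comp (transl h') = transl (h + h') := by
    refine MvPolynomial.algHom_ext fun i => ?_
    simp [transl, MvPolynomial.algebraMap_eq]
    ring
  exact DFunLike.congr_fun this p

theorem transl_zero {d : ℕ} (p : Poly d) : transl (0 : Sp d) p = p := by
  simp [transl]

theorem coeff_transl_monomial {d : ℕ} (h : Sp d) (n : ℕ) : ∀ k : Fin d →₀ ℕ, k.degree = n →
    ∀ m : Fin d →₀ ℕ, n ≤ m.degree →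
      (transl h (MvPolynomial.monomial k 1)).coeff m = (MvPolynomial.monomial k (1 : ℝ)).coeff m := by
  induction n with
  | zero =>
    intro k hk m _
    obtain rfl : k = 0 := (Finsupp.degree_eq_zero_iff k).mp hk
    have : (MvPolynomial.monomial (0 : Fin d →₀ ℕ) (1 : ℝ)) = 1 := rfl
    rw [this, map_one]
  | succ n ih =>
    intro k hk m hm
    obtain ⟨i, hi⟩ : ∃ i, k i ≠ 0 := by
      by_contra hcon
      push Not at hcon
      obtain rfl : k = 0 := Finsupp.ext hcon
      simp at hk
    obtain ⟨k', rfl⟩ : ∃ k', k = k' + Finsupp.single i 1 :=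
      ⟨k - Finsupp.single i 1, (tsub_add_cancel_of_le
        (Finsupp.single_le_iff.mpr (Nat.one_le_iff_ne_zero.mpr hi))).symm⟩
    have hk' : k'.degree = n := by
      rw [map_add, Finsupp.degree_single] at hk
      omega
    have hmon : (MvPolynomial.monomial (k' + Finsupp.single i 1) (1 : ℝ)) =
        MvPolynomial.monomial k' 1 * MvPolynomial.X i := by
      rw [MvPolynomial.X, MvPolynomial.monomial_mul, one_mul]
    have hX : transl h (MvPolynomial.X i) = MvPolynomial.X i - MvPolynomial.C (h i) := by
      simp [transl]
    have hne : k' ≠ m := by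
      rintro rfl
      omega
    rw [hmon, map_mul, hX, mul_sub, MvPolynomial.coeff_sub, mul_comm _ (MvPolynomial.C (h i)),
      MvPolynomial.coeff_C_mul,
      ih k' hk' m (by omega), MvPolynomial.coeff_monomial, if_neg hne, mul_zero, sub_zero,
      MvPolynomial.coeff_mul_X', MvPolynomial.coeff_mul_X']
    split_ifs with hmi
    · refine ih k' hk' _ ?_
      have h1 : m = (m - Finsupp.single i 1) + Finsupp.single i 1 :=
        (tsub_add_cancel_of_le (Finsupp.single_le_iff.mpr (Nat.one_le_iff_ne_zero.mpr
          (Finsupp.mem_support_iff.mp hmi)))).symm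
      have h2 := congrArg Finsupp.degree h1
      rw [map_add, Finsupp.degree_single] at h2
      omega
    · rfl

theorem coeff_transl {d : ℕ} (h : Sp d) (p : Poly d) (m : Fin d →₀ ℕ)
    (hp : ∀ k, p.coeff k ≠ 0 → k.degree ≤ m.degree) :
    (transl h p).coeff m = p.coeff m := by
  conv_lhs => rw [p.as_sum]
  conv_rhs => rw [p.as_sum]
  rw [map_sum, MvPolynomial.coeff_sum, MvPolynomial.coeff_sum]
  refine Finset.sum_congr rfl fun k hk => ?_
  have hmon : MvPolynomial.monomial k (p.coeff k) = p.coeff k • MvPolynomial.monomial k (1 : ℝ) := by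
    rw [MvPolynomial.smul_monomial, smul_eq_mul, mul_one]
  rw [hmon, map_smul, MvPolynomial.coeff_smul, MvPolynomial.coeff_smul,
    coeff_transl_monomial h _ k rfl m (hp k (MvPolynomial.mem_support_iff.mp hk))]

/-- Translation as a linear automorphism. -/
def translEquiv {d : ℕ} (h : Sp d) : Poly d ≃ₗ[ℝ] Poly d :=
  LinearEquiv.ofLinearMap (transl h).toLinearMap (transl (-h)).toLinearMap
    (LinearMap.ext fun p => by simp [transl_transl, transl_zero])
    (LinearMap.ext fun p => by simp [transl_transl, transl_zero])

/-- The operator `Γ_h`, acting by translation simultaneously on both copies of the polynomials. -/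
def shift (d : ℕ) (α : ℝ) (h : Sp d) : (⨁ a, comp d α a) ≃ₗ[ℝ] (⨁ a, comp d α a) :=
  ((toPoly d α).trans ((translEquiv h).prodCongr (translEquiv h))).trans (toPoly d α).symm

theorem toPoly_shift {d : ℕ} {α : ℝ} (h : Sp d) (τ : ⨁ a, comp d α a) :
    toPoly d α (shift d α h τ) = (transl h (toPoly d α τ).1, transl h (toPoly d α τ).2) := by
  simp [shift, translEquiv]

theorem shift_add {d : ℕ} {α : ℝ} (h h' : Sp d) :
    shift d α (h + h') = shift d α h * shift d α h' := by
  refine LinearEquiv.ext fun τ => (toPoly d α).injective ?_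
  rw [LinearEquiv.mul_apply, toPoly_shift, toPoly_shift, toPoly_shift, transl_transl, transl_transl]

theorem shift_zero {d : ℕ} {α : ℝ} : shift d α 0 = 1 := by
  refine LinearEquiv.ext fun τ => (toPoly d α).injective ?_
  rw [toPoly_shift, transl_zero, transl_zero]
  rfl

/-- The structure group: all the operators `Γ_h` with `h ∈ ℝ^d`. -/
def shiftGroup (d : ℕ) (α : ℝ) : Subgroup ((⨁ a, comp d α a) ≃ₗ[ℝ] (⨁ a, comp d α a)) where
  carrier := Set.range (shift d α)
  one_mem' := ⟨0, shift_zero⟩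
  mul_mem' := by
    rintro _ _ ⟨h, rfl⟩ ⟨h', rfl⟩
    exact ⟨h + h', shift_add h h'⟩
  inv_mem' := by
    rintro _ ⟨h, rfl⟩
    refine ⟨-h, eq_inv_of_mul_eq_one_left ?_⟩
    rw [← shift_add, neg_add_cancel, shift_zero]

/-- The regularity structure on `T = V ⊕ W` with homogeneities `|X^k| = |k|` and
`|Ξ X^k| = |k| - α`. -/
def xiStructure (d : ℕ) (α : ℝ) : RegularityStructure where
  A := homs α
  bddBelow := by
    refine ⟨min 0 (-α), ?_⟩
    rintro a ⟨n, rfl | rfl⟩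
    · exact (min_le_left _ _).trans (Nat.cast_nonneg n)
    · refine (min_le_right _ _).trans ?_
      have := Nat.cast_nonneg (α := ℝ) n
      linarith
  no_accPt := by
    intro x hx
    have hfin : (homs α ∩ Metric.ball x 1).Finite := by
      refine ((((Set.finite_Iic ⌈x + 1⌉₊).image fun n : ℕ => (n : ℝ))).union
        ((Set.finite_Iic ⌈x + 1 + α⌉₊).image fun n : ℕ => (n : ℝ) - α)).subset ?_
      rintro a ⟨⟨n, rfl | rfl⟩, ha⟩
      · refine Or.inl ⟨n, ?_, rfl⟩
        rw [Real.ball_eq_Ioo] at ha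
        exact Nat.cast_le.mp (ha.2.le.trans (Nat.le_ceil _))
      · refine Or.inr ⟨n, ?_, rfl⟩
        rw [Real.ball_eq_Ioo] at ha
        have h2 := ha.2
        exact Nat.cast_le.mp ((by linarith : (n : ℝ) ≤ x + 1 + α).trans (Nat.le_ceil _))
    have hacc := hx.nhds_inter (Metric.ball_mem_nhds x one_pos)
    rw [Set.inter_comm] at hacc
    exact Set.Infinite.of_accPt hacc hfin
  V := comp d α
  G := shiftGroup d α
  continuous_G := by
    intro Γ _ a b
    exact LinearMap.continuous_of_finiteDimensional
      ((DirectSum.component ℝ (homs α) (comp d α) b ∘ₗ Γ.toLinearMap) ∘ₗ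
        DirectSum.lof ℝ (homs α) (comp d α) a)
  triangular := by
    rintro _ ⟨h, rfl⟩ a τ b hb
    have hlof : ∀ i, coeffAt (toPoly d α (DirectSum.lof ℝ (homs α) (comp d α) a τ)) i ≠ 0 →
        hom α i = a := by
      intro i hi
      by_contra hne
      rw [coeffAt_toPoly, DirectSum.lof_eq_of, DirectSum.of_eq_of_ne _ _ _ hne] at hi
      exact hi rfl
    funext i
    obtain ⟨i, rfl⟩ := i
    rw [← coeffAt_toPoly, map_sub, toPoly_shift]
    rcases i with m | m
    · change (transl h _ - _ : Poly d).coeff m = 0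
      rw [MvPolynomial.coeff_sub, coeff_transl, sub_self]
      intro k hk
      rw [← hlof (Sum.inl k) hk] at hb
      have hb' : ¬ ((m.degree : ℝ) < k.degree) := hb
      exact_mod_cast not_lt.mp hb'
    · change (transl h _ - _ : Poly d).coeff m = 0
      rw [MvPolynomial.coeff_sub, coeff_transl, sub_self]
      intro k hk
      rw [← hlof (Sum.inr k) hk] at hb
      have hb' : ¬ ((m.degree : ℝ) - α < k.degree - α) := hb
      have hb'' : (k.degree : ℝ) ≤ m.degree := by linarith
      exact_mod_cast hb''

/-! ### The model built from `ξ`, and the lift of a Hölder function -/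

/-- The function `y ↦ p(y - x)`. -/
def evalAt {d : ℕ} (x : Sp d) (p : Poly d) (y : Sp d) : ℝ :=
  MvPolynomial.eval (fun i => y i - x i) p

theorem contDiff_evalAt {d : ℕ} (x : Sp d) (p : Poly d) : ContDiff ℝ ∞ (evalAt x p) := by
  induction p using MvPolynomial.induction_on with
  | C a =>
    have h : evalAt x (MvPolynomial.C a) = fun _ => a := funext fun y => by simp [evalAt]
    rw [h]
    exact contDiff_const
  | add p q hp hq =>
    have h : evalAt x (p + q) = evalAt x p + evalAt x q := funext fun y => by simp [evalAt]
    rw [h]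
    exact hp.add hq
  | mul_X p i hp =>
    have h : evalAt x (p * MvPolynomial.X i) = evalAt x p * fun y => y i - x i :=
      funext fun y => by simp [evalAt]
    rw [h]
    exact hp.mul (by fun_prop)

theorem ofContinuous_add {d : ℕ} (f g : C(Sp d, ℝ)) :
    ofContinuous (f + g) = ofContinuous f + ofContinuous g := by
  refine DFunLike.ext _ _ fun φ => ?_
  change _ = ofContinuous f φ + ofContinuous g φ
  have hint : ∀ f : C(Sp d, ℝ), Integrable fun y => φ y * f y := fun f =>
    (φ.continuous.mul f.continuous).integrable_of_hasCompactSupport φ.hasCompactSupport.mul_right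
  rw [ofContinuous_apply, ofContinuous_apply, ofContinuous_apply, ← integral_add (hint f) (hint g)]
  simp only [ContinuousMap.add_apply, mul_add]

theorem ofContinuous_smul {d : ℕ} (c : ℝ) (f : C(Sp d, ℝ)) :
    ofContinuous (c • f) = c • ofContinuous f := by
  refine DFunLike.ext _ _ fun φ => ?_
  change _ = c * ofContinuous f φ
  rw [ofContinuous_apply, ofContinuous_apply, ← integral_const_mul]
  refine integral_congr_ae (Eventually.of_forall fun y => ?_)
  simp only [ContinuousMap.smul_apply, smul_eq_mul]
  ring

/-- The distribution `P(· - x) + Q(· - x) ξ` attached to `(P, Q)`. -/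
def polyPi {d : ℕ} (ξ : Dist d) (x : Sp d) : Poly d × Poly d →ₗ[ℝ] Dist d where
  toFun τ :=
    ofContinuous ⟨evalAt x τ.1, (contDiff_evalAt x _).continuous⟩ +
      smoothMul (evalAt x τ.2) (contDiff_evalAt x _) ξ
  map_add' σ τ := by
    have h₁ : (⟨evalAt x (σ + τ).1, (contDiff_evalAt x _).continuous⟩ : C(Sp d, ℝ)) =
        ⟨evalAt x σ.1, (contDiff_evalAt x _).continuous⟩ +
          ⟨evalAt x τ.1, (contDiff_evalAt x _).continuous⟩ := by
      ext y
      simp [evalAt]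
    have h₂ : smoothMul (evalAt x (σ + τ).2) (contDiff_evalAt x _) ξ =
        smoothMul (evalAt x σ.2) (contDiff_evalAt x _) ξ +
          smoothMul (evalAt x τ.2) (contDiff_evalAt x _) ξ := by
      refine DFunLike.ext _ _ fun φ => ?_
      change ξ (mulTest _ _ φ) = ξ (mulTest _ _ φ) + ξ (mulTest _ _ φ)
      rw [← map_add]
      congr 1
      ext y
      change φ y * evalAt x _ y = φ y * evalAt x _ y + φ y * evalAt x _ y
      simp [evalAt, mul_add]
    rw [h₁, h₂, ofContinuous_add]
    abel
  map_smul' c τ := by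
    have h₁ : (⟨evalAt x (c • τ).1, (contDiff_evalAt x _).continuous⟩ : C(Sp d, ℝ)) =
        c • ⟨evalAt x τ.1, (contDiff_evalAt x _).continuous⟩ := by
      ext y
      simp [evalAt]
    have h₂ : smoothMul (evalAt x (c • τ).2) (contDiff_evalAt x _) ξ =
        c • smoothMul (evalAt x τ.2) (contDiff_evalAt x _) ξ := by
      refine DFunLike.ext _ _ fun φ => ?_
      change ξ (mulTest _ _ φ) = c • ξ (mulTest _ _ φ)
      rw [← map_smul]
      congr 1
      ext y
      change φ y * evalAt x _ y = c * (φ y * evalAt x _ y)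
      simp [evalAt]
      ring
    rw [h₁, h₂, ofContinuous_smul, smul_add]
    rfl

/-- The map `Π^ξ_x`, with `Π^ξ_x X^k = (· - x)^k` and `Π^ξ_x (Ξ X^k) = (· - x)^k ξ`. -/
def xiPi {d : ℕ} (α : ℝ) (ξ : Dist d) (x : Sp d) : (xiStructure d α).T →ₗ[ℝ] Dist d :=
  polyPi ξ x ∘ₗ (toPoly d α).toLinearMap

/-- The operators `Γ_{xy} = Γ_{y - x}` of the canonical polynomial model. -/
def xiGamma {d : ℕ} (α : ℝ) (x y : Sp d) : (xiStructure d α).G :=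
  ⟨shift d α (y - x), y - x, rfl⟩

/-- The Taylor polynomial of `f` of order `n` at `x`, as an abstract polynomial:
`∑_{j ≤ n} (1/j!) ∑_{i_1, …, i_j} ∂_{i_1} ⋯ ∂_{i_j} f(x) X_{i_1} ⋯ X_{i_j}`,
which is `∑_{|k| ≤ n} (1/k!) D^k f(x) X^k`. -/
def taylor {d : ℕ} (n : ℕ) (f : Sp d → ℝ) (x : Sp d) : Poly d :=
  ∑ j ∈ Finset.range (n + 1), ∑ i : Fin j → Fin d,
    MvPolynomial.C ((j.factorial : ℝ)⁻¹ *
      iteratedFDeriv ℝ j f x fun l => EuclideanSpace.single (i l) 1) *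
    ∏ l, MvPolynomial.X (i l)

/-- The modelled distribution `Ξ F`, where `F` is the Taylor expansion of `f ∈ 𝒞^β` of order
`β` at each point (all orders strictly below `β`). -/
def xiLift {d : ℕ} (α : ℝ) {β : ℝ} (f : HolderPos d β) (x : Sp d) : (xiStructure d α).T :=
  (toPoly d α).symm (0, taylor (below β) f.toFun x)

end RegStr

end

open Set Filter Topology MeasureTheory TopologicalSpace
open scoped Distributions DirectSum ContDiff

noncomputable section

namespace RegStr

open scoped BoundedContinuousFunction

/-! ### Derivative bounds at a given scale -/

/-! The product is the limit of ξ f_m, where f_m is a smooth approximation of f at scale 2⁻ᵐ. The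
function `approx` patches the Taylor polynomials of f at the points of a lattice of mesh comparable
to l, using a partition of unity. The basic estimate, `exists_scaleBdOn_approx_sub`, says that at
every x this function differs from the Taylor polynomial based at x by O(l^β), with an extra factor
l⁻ⁱ for the i-th derivative. `ScaleBdOn` records bounds of this type, and they are stable under sums
and products.

Consequently f_{m+1} - f_m has size l^β at scale l = 2^{-(m+1)}. The distribution ξ costs l^{-α} on
a test function localised at scale l, and a test function spread over a larger ball is cut into
cells of scale l by the same partition (`exists_abs_apply_le`). The increments of the pairings are
therefore O(l^{β-α}), and β > α makes them summable (`exists_approxPairing_tail_le`).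

For a test function rescaled to scale λ, the telescoping sum starts at a dyadic scale s comparable
to λ. The tail is O(λ^{β-α}), and f_s - T_x f is O(λ^β) on the ball of radius λ around x, where T_x
f is the Taylor polynomial at x. Adding the two gives the reconstruction bound
(`isReconstruction_product`). The bound has a unique solution, since a distribution that is O(λ^γ)
on rescaled tests with γ > 0 vanishes (`eq_zero_of_forall_scaled_le`). Bilinearity and agreement
with the pointwise product follow from uniqueness, by checking the reconstruction bound for the
candidate.

Joint continuity into distributions needs estimates uniform over compact sets of test functions.
Such a set has a common compact support and common derivative bounds
(`exists_tsupport_subset_of_isCompact`, `exists_scaleBdOn_of_isCompact`), so one estimate, linear in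
the constants of ξ and of f, controls the product on it. The model bounds and the bound on Ξ F rest
on a finite-dimensional fact: the coefficients of a polynomial of bounded degree are controlled by
its values on a ball, with the correct scaling (`exists_coeff_bound`). -/

/-- On `S`, the derivatives of order `i ≤ r` of `ψ` are bounded by `A / l ^ i`. -/
def ScaleBdOn {d : ℕ} (r : ℕ) (S : Set (Sp d)) (l A : ℝ) (ψ : Sp d → ℝ) : Prop :=
  ∀ i ≤ r, ∀ y ∈ S, ‖iteratedFDeriv ℝ i ψ y‖ ≤ A / l ^ i

section ScaleBdOn

variable {d r : ℕ} {S : Set (Sp d)} {l l' A B : ℝ} {f g : Sp d → ℝ}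

theorem ScaleBdOn.mono_set {S' : Set (Sp d)} (h : ScaleBdOn r S l A f) (hS : S' ⊆ S) :
    ScaleBdOn r S' l A f := fun i hi y hy => h i hi y (hS hy)

theorem ScaleBdOn.mono_const (h : ScaleBdOn r S l A f) (hl : 0 < l) (hAB : A ≤ B) :
    ScaleBdOn r S l B f := fun i hi y hy => (h i hi y hy).trans (by gcongr)

theorem ScaleBdOn.mono_scale (h : ScaleBdOn r S l A f) (hA : 0 ≤ A) (hl' : 0 < l') (hl : l' ≤ l) :
    ScaleBdOn r S l' A f := fun i hi y hy => (h i hi y hy).trans (by gcongr)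

/-- Enlarging the scale by a factor `c` costs a factor `c ^ r`. -/
theorem ScaleBdOn.enlarge {c : ℝ} (h : ScaleBdOn r S l A f) (hA : 0 ≤ A) (hl : 0 < l)
    (hc : 1 ≤ c) : ScaleBdOn r S (c * l) (c ^ r * A) f := by
  intro i hi y hy
  refine (h i hi y hy).trans ?_
  have hc0 : 0 < c := by linarith
  rw [mul_pow, div_le_div_iff₀ (by positivity) (by positivity)]
  have : c ^ i ≤ c ^ r := pow_le_pow_right₀ hc hi
  calc A * (c ^ i * l ^ i) = c ^ i * (A * l ^ i) := by ring
    _ ≤ c ^ r * (A * l ^ i) := by gcongr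
    _ = _ := by ring

theorem ScaleBdOn.add (hf : ContDiff ℝ ∞ f) (hg : ContDiff ℝ ∞ g) (h : ScaleBdOn r S l A f)
    (h' : ScaleBdOn r S l B g) : ScaleBdOn r S l (A + B) (f + g) := by
  intro i hi y hy
  rw [iteratedFDeriv_add_apply (hf.contDiffAt.of_le (by exact_mod_cast le_top))
    (hg.contDiffAt.of_le (by exact_mod_cast le_top)), add_div]
  exact (norm_add_le _ _).trans (add_le_add (h i hi y hy) (h' i hi y hy))

theorem ScaleBdOn.const_smul (c : ℝ) (hf : ContDiff ℝ ∞ f) (h : ScaleBdOn r S l A f) :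
    ScaleBdOn r S l (|c| * A) (c • f) := by
  intro i hi y hy
  rw [iteratedFDeriv_const_smul_apply (hf.contDiffAt.of_le (by exact_mod_cast le_top)),
    norm_smul, Real.norm_eq_abs, mul_div_assoc]
  exact mul_le_mul_of_nonneg_left (h i hi y hy) (abs_nonneg c)

theorem ScaleBdOn.sub (hf : ContDiff ℝ ∞ f) (hg : ContDiff ℝ ∞ g) (h : ScaleBdOn r S l A f)
    (h' : ScaleBdOn r S l B g) : ScaleBdOn r S l (A + B) (f - g) := by
  have h1 := h.add hf (hg.const_smul (-1 : ℝ)) (h'.const_smul (-1) hg)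
  have h2 : (f + fun y => (-1 : ℝ) • g y) = f - g := by
    funext y
    simp [sub_eq_add_neg]
  rwa [h2, abs_neg, abs_one, one_mul] at h1

theorem ScaleBdOn.sum {ι : Type*} {s : Finset ι} {F : ι → Sp d → ℝ} {C : ι → ℝ}
    (hF : ∀ k ∈ s, ContDiff ℝ ∞ (F k)) (h : ∀ k ∈ s, ScaleBdOn r S l (C k) (F k)) :
    ScaleBdOn r S l (∑ k ∈ s, C k) (∑ k ∈ s, F k) := by
  intro i hi y hy
  rw [iteratedFDeriv_sum_apply fun k hk =>
    (hF k hk).contDiffAt.of_le (by exact_mod_cast le_top), Finset.sum_div]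
  exact norm_sum_le_of_le _ fun k hk => h k hk i hi y hy

/-- Leibniz's rule: in each term the powers of l combine to l ^ i, and the binomial coefficients add
up to 2 ^ i ≤ 2 ^ r. -/
theorem ScaleBdOn.mul (hf : ContDiff ℝ ∞ f) (hg : ContDiff ℝ ∞ g) (hA : 0 ≤ A) (hB : 0 ≤ B)
    (hl : 0 < l) (h : ScaleBdOn r S l A f) (h' : ScaleBdOn r S l B g) :
    ScaleBdOn r S l (2 ^ r * (A * B)) (f * g) := by
  intro i hi y hy
  refine (norm_iteratedFDeriv_mul_le hf hg y (by exact_mod_cast le_top)).trans ?_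
  have : ∀ j ∈ Finset.range (i + 1), (i.choose j : ℝ) * ‖iteratedFDeriv ℝ j f y‖ *
      ‖iteratedFDeriv ℝ (i - j) g y‖ ≤ (i.choose j : ℝ) * (A * B / l ^ i) := by
    intro j hj
    have hj' : j ≤ i := Nat.lt_succ_iff.mp (Finset.mem_range.mp hj)
    have h1 := h j (hj'.trans hi) y hy
    have h2 := h' (i - j) ((Nat.sub_le _ _).trans hi) y hy
    have h3 : A * B / l ^ i = A / l ^ j * (B / l ^ (i - j)) := by
      rw [div_mul_div_comm, ← pow_add, Nat.add_sub_cancel' hj']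
    rw [h3, mul_assoc]
    gcongr
  refine (Finset.sum_le_sum this).trans ?_
  rw [← Finset.sum_mul]
  have h4 : (∑ j ∈ Finset.range (i + 1), (i.choose j : ℝ)) = 2 ^ i := by
    exact_mod_cast Nat.sum_range_choose i
  rw [h4, mul_div_assoc (2 ^ r)]
  exact mul_le_mul_of_nonneg_right (pow_le_pow_right₀ one_le_two hi) (by positivity)

theorem ScaleBdOn.univ_of_tsupport (h : ScaleBdOn r S l A f) (hA : 0 ≤ A) (hl : 0 < l)
    (hS : tsupport f ⊆ S) : ScaleBdOn r univ l A f := by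
  intro i hi y _
  by_cases hy : y ∈ S
  · exact h i hi y hy
  · have : iteratedFDeriv ℝ i f y = 0 := by
      have h1 : y ∉ tsupport (iteratedFDeriv ℝ i f) :=
        fun h1 => hy (hS (tsupport_iteratedFDeriv_subset i h1))
      exact image_eq_zero_of_notMem_tsupport h1
    rw [this, norm_zero]
    positivity

theorem norm_iteratedFDeriv_comp_affine (hf : ContDiff ℝ ∞ f) (c : ℝ) (b : Sp d) (i : ℕ)
    (y : Sp d) : ‖iteratedFDeriv ℝ i (fun y => f (c • y + b)) y‖ =
      |c| ^ i * ‖iteratedFDeriv ℝ i f (c • y + b)‖ := by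
  have h := iteratedFDeriv_comp_const_smul (i := i) (f := fun z => f (z + b)) c
    ((hf.comp (contDiff_id.add contDiff_const)).of_le (by exact_mod_cast le_top))
  rw [congrFun h y, norm_smul, iteratedFDeriv_comp_add_right, norm_pow, Real.norm_eq_abs]

end ScaleBdOn

/-! ### Testing against localised functions -/

/-- Testing against 0 shows that any uniform bound over unit tests is nonnegative. -/
theorem zero_mem_unitTests (d r : ℕ) : (0 : TestFn d) ∈ unitTests d r := by
  refine ⟨?_, fun i _ y => ?_⟩
  · simp [FunLike.coe_zero]
  · rw [FunLike.coe_zero]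
    simp

theorem scaled_apply {d : ℕ} (φ : TestFn d) (x : Sp d) (l : ℝ) (hl : 0 < l) (y : Sp d) :
    scaled φ x l hl y = (l ^ d)⁻¹ * φ (l⁻¹ • (y - x)) := rfl

theorem tsupport_scaled {d r : ℕ} {φ : TestFn d} (hφ : φ ∈ unitTests d r) (x : Sp d) {l : ℝ}
    (hl : 0 < l) : tsupport (scaled φ x l hl) ⊆ Metric.closedBall x l := by
  refine closure_minimal (fun y hy => ?_) Metric.isClosed_closedBall
  have h : φ (l⁻¹ • (y - x)) ≠ 0 := fun h => hy (by rw [scaled_apply, h, mul_zero])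
  have h' := hφ.1 (subset_tsupport _ h)
  rw [mem_closedBall_zero_iff, norm_smul, norm_inv, Real.norm_of_nonneg hl.le,
    inv_mul_le_iff₀ hl, mul_one] at h'
  rwa [Metric.mem_closedBall, dist_eq_norm]

theorem scaleBdOn_scaled {d r : ℕ} {φ : TestFn d} (hφ : φ ∈ unitTests d r) (x : Sp d) {l : ℝ}
    (hl : 0 < l) : ScaleBdOn r univ l (l ^ d)⁻¹ (scaled φ x l hl) := by
  intro i hi y _
  have hcd : ContDiff ℝ ∞ φ := φ.contDiff
  have h1 : ⇑(scaled φ x l hl) = (l ^ d)⁻¹ • fun y => φ (l⁻¹ • y + -(l⁻¹ • x)) := by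
    funext y
    rw [scaled_apply, smul_sub, sub_eq_add_neg]
    rfl
  rw [h1, iteratedFDeriv_const_smul_apply, norm_smul, norm_iteratedFDeriv_comp_affine hcd]
  · rw [Real.norm_of_nonneg (by positivity), abs_of_pos (inv_pos.mpr hl), inv_pow, div_eq_mul_inv]
    have := hφ.2 i hi (l⁻¹ • y + -(l⁻¹ • x))
    have h0 : 0 ≤ (l ^ i)⁻¹ := by positivity
    have h0' : 0 ≤ (l ^ d)⁻¹ := by positivity
    exact mul_le_mul_of_nonneg_left (mul_le_of_le_one_right h0 this) h0'
  · exact ((hcd.comp (by fun_prop : ContDiff ℝ ∞ fun y : Sp d => l⁻¹ • y + -(l⁻¹ • x))).contDiffAt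
      ).of_le (by exact_mod_cast le_top)

/-- A bound on rescaled unit tests gives a bound on every function localised at that scale. -/
theorem abs_apply_le_of_localised {d r : ℕ} {η : Dist d} {z : Sp d} {l M A : ℝ} (hl : 0 < l)
    (hM : ∀ φ ∈ unitTests d r, |η (scaled φ z l hl)| ≤ M) {ψ : TestFn d} (hA : 0 ≤ A)
    (hsupp : tsupport ψ ⊆ Metric.closedBall z l) (hψ : ScaleBdOn r univ l A ψ) :
    |η ψ| ≤ A * l ^ d * M := by
  have hcd : ContDiff ℝ ∞ ψ := ψ.contDiff
  have hM0 : 0 ≤ M := (abs_nonneg _).trans (hM 0 (zero_mem_unitTests d r))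
  -- The normalisation below divides by A, so A = 0, which forces ψ = 0, is treated first.
  rcases hA.eq_or_lt with rfl | hA
  · have : ψ = 0 := by
      ext y
      have := hψ 0 (Nat.zero_le _) y (mem_univ _)
      simpa using this
    simp [this]
  have hl' : l⁻¹ ≠ 0 := inv_ne_zero hl.ne'
  -- Undo the scaling: recentring at -l⁻¹z with scale l⁻¹ gives l ^ d ψ(l y + z), and the prefactor
  -- leaves A⁻¹ ψ(l y + z).
  let φ : TestFn d := (A⁻¹ * (l ^ d)⁻¹) • scaled ψ (-(l⁻¹ • z)) l⁻¹ (inv_pos.mpr hl)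
  have hφ : ∀ y, φ y = A⁻¹ * ψ (l • y + z) := by
    intro y
    change A⁻¹ * (l ^ d)⁻¹ * ((l⁻¹ ^ d)⁻¹ * ψ (l⁻¹⁻¹ • (y - -(l⁻¹ • z)))) = _
    rw [inv_pow, inv_inv, inv_inv, sub_neg_eq_add, smul_add, smul_smul, mul_inv_cancel₀ hl.ne',
      one_smul]
    field_simp
  have hmem : φ ∈ unitTests d r := by
    refine ⟨closure_minimal (fun y hy => ?_) Metric.isClosed_closedBall, fun i hi y => ?_⟩
    · have h : ψ (l • y + z) ≠ 0 := fun h => hy (by rw [hφ, h, mul_zero])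
      have h' := hsupp (subset_tsupport _ h)
      rw [Metric.mem_closedBall, dist_eq_norm, add_sub_cancel_right, norm_smul,
        Real.norm_of_nonneg hl.le] at h'
      rw [mem_closedBall_zero_iff]
      exact le_of_mul_le_mul_left (by simpa using h') hl
    · have h1 : ⇑φ = A⁻¹ • fun y => ψ (l • y + z) := funext hφ
      rw [h1, iteratedFDeriv_const_smul_apply, norm_smul, norm_iteratedFDeriv_comp_affine hcd]
      · rw [Real.norm_of_nonneg (by positivity), abs_of_pos hl]
        have h2 := hψ i hi (l • y + z) (mem_univ _)
        rw [le_div_iff₀ (by positivity)] at h2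
        rw [inv_mul_le_iff₀ hA]
        linarith
      · exact ((hcd.comp (by fun_prop : ContDiff ℝ ∞ fun y : Sp d => l • y + z)).contDiffAt
          ).of_le (by exact_mod_cast le_top)
  have hψφ : ψ = (A * l ^ d) • scaled φ z l hl := by
    ext y
    change ψ y = A * l ^ d * ((l ^ d)⁻¹ * φ (l⁻¹ • (y - z)))
    rw [hφ, smul_smul, mul_inv_cancel₀ hl.ne', one_smul, sub_add_cancel]
    field_simp
  rw [hψφ, map_smul, smul_eq_mul, abs_mul, abs_of_pos (by positivity)]
  exact mul_le_mul_of_nonneg_left (hM φ hmem) (by positivity)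

/-! ### A partition of unity on a lattice -/

/-- A smooth function supported in `[-1, 1]` whose integer translates sum to `1`. -/
def tooth (t : ℝ) : ℝ := Real.smoothTransition (t + 1) - Real.smoothTransition t

theorem contDiff_tooth : ContDiff ℝ ∞ tooth :=
  (Real.smoothTransition.contDiff.comp (contDiff_id.add contDiff_const)).sub
    Real.smoothTransition.contDiff

theorem abs_le_of_tooth_ne_zero {t : ℝ} (h : tooth t ≠ 0) : |t| ≤ 1 := by
  by_contra hc
  rcases lt_abs.mp (not_le.mp hc) with h1 | h1
  · exact h (by rw [tooth, Real.smoothTransition.one_of_one_le (by linarith),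
      Real.smoothTransition.one_of_one_le (by linarith), sub_self])
  · exact h (by rw [tooth, Real.smoothTransition.zero_of_nonpos (by linarith),
      Real.smoothTransition.zero_of_nonpos (by linarith), sub_self])

/-- The sum telescopes to a difference of two values of the smooth transition, one at an argument at
least 1 and one at an argument at most 0. -/
theorem sum_tooth {a b : ℤ} {t : ℝ} (ha : a ≤ t) (hb : t ≤ b) :
    ∑ j ∈ Finset.Icc a b, tooth (t - j) = 1 := by
  have key : ∀ n : ℕ, ∑ j ∈ Finset.Icc a (a + n), tooth (t - j) =
      Real.smoothTransition (t - a + 1) - Real.smoothTransition (t - (a + n : ℤ)) := by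
    intro n
    induction n with
    | zero => simp [tooth]
    | succ n ih =>
      have h1 : Finset.Icc a (a + (n + 1 : ℕ)) =
          insert (a + (n + 1 : ℕ)) (Finset.Icc a (a + n)) := by
        ext j
        simp only [Finset.mem_Icc, Finset.mem_insert]
        push_cast
        omega
      rw [h1, Finset.sum_insert (by simp), ih, tooth]
      have : t - ((a + (n + 1 : ℕ) : ℤ) : ℝ) + 1 = t - ((a + n : ℤ) : ℝ) := by
        push_cast
        ring
      rw [this]
      ring
  have hab : a ≤ b := by exact_mod_cast ha.trans hb
  obtain ⟨n, rfl⟩ := Int.le.dest hab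
  rw [key, Real.smoothTransition.one_of_one_le (by linarith),
    Real.smoothTransition.zero_of_nonpos (by linarith), sub_zero]

/-- The product bump on `ℝ^d`. -/
def bump {d : ℕ} (y : Sp d) : ℝ := ∏ i, tooth (y i)

theorem contDiff_bump {d : ℕ} : ContDiff ℝ ∞ (bump (d := d)) :=
  contDiff_prod fun i _ => contDiff_tooth.comp (by fun_prop : ContDiff ℝ ∞ fun y : Sp d => y i)

theorem abs_le_of_bump_ne_zero {d : ℕ} {y : Sp d} (h : bump y ≠ 0) (i : Fin d) : |y i| ≤ 1 :=
  abs_le_of_tooth_ne_zero (Finset.prod_ne_zero_iff.mp h i (Finset.mem_univ i))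

theorem norm_le_sum_abs {d : ℕ} (y : Sp d) : ‖y‖ ≤ ∑ i, |y i| := by
  rw [EuclideanSpace.norm_eq]
  refine Real.sqrt_le_iff.mpr ⟨Finset.sum_nonneg fun i _ => abs_nonneg _, ?_⟩
  simp only [Real.norm_eq_abs]
  exact Finset.sum_sq_le_sq_sum_of_nonneg fun i _ => abs_nonneg _

theorem norm_le_of_abs_le {d : ℕ} {y : Sp d} {c : ℝ} (h : ∀ i, |y i| ≤ c) : ‖y‖ ≤ d * c := by
  refine (norm_le_sum_abs y).trans ((Finset.sum_le_sum fun i _ => h i).trans ?_)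
  simp

theorem hasCompactSupport_bump {d : ℕ} : HasCompactSupport (bump (d := d)) := by
  refine HasCompactSupport.of_support_subset_isCompact
    (isCompact_closedBall (0 : Sp d) d) fun y hy => ?_
  rw [mem_closedBall_zero_iff]
  simpa using norm_le_of_abs_le (abs_le_of_bump_ne_zero hy)

theorem exists_bump_bound (d r : ℕ) :
    ∃ C : ℝ, 0 ≤ C ∧ ∀ i ≤ r, ∀ y : Sp d, ‖iteratedFDeriv ℝ i bump y‖ ≤ C := by
  have h : ∀ i : ℕ, ∃ C : ℝ, ∀ y : Sp d, ‖iteratedFDeriv ℝ i bump y‖ ≤ C := fun i =>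
    (contDiff_bump.continuous_iteratedFDeriv (m := i)
      (by exact_mod_cast le_top)).bounded_above_of_compact_support
      (hasCompactSupport_bump.iteratedFDeriv i)
  choose C hC using h
  refine ⟨∑ i ∈ Finset.range (r + 1), |C i|, Finset.sum_nonneg fun i _ => abs_nonneg _,
    fun i hi y => (hC i y).trans ((le_abs_self _).trans ?_)⟩
  exact Finset.single_le_sum (f := fun i => |C i|) (fun i _ => abs_nonneg _)
    (Finset.mem_range.mpr (Nat.lt_succ_of_le hi))

/-- The lattice point of index `k` in the lattice of mesh `l / d`. -/
def node {d : ℕ} (l : ℝ) (k : Fin d → ℤ) : Sp d := WithLp.toLp 2 fun i => l / d * k i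

/-- The member of the partition of unity at scale `l` attached to the lattice point `node l k`. -/
def cell {d : ℕ} (l : ℝ) (k : Fin d → ℤ) (y : Sp d) : ℝ :=
  bump ((d / l : ℝ) • y + WithLp.toLp 2 fun i => -(k i : ℝ))

theorem cell_apply {d : ℕ} (l : ℝ) (k : Fin d → ℤ) (y : Sp d) :
    cell l k y = ∏ i, tooth (d / l * y i - k i) := by
  simp [cell, bump, sub_eq_add_neg]

theorem contDiff_cell {d : ℕ} (l : ℝ) (k : Fin d → ℤ) : ContDiff ℝ ∞ (cell l k) :=
  contDiff_bump.comp (by fun_prop : ContDiff ℝ ∞ fun y : Sp d =>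
    (d / l : ℝ) • y + WithLp.toLp 2 fun i => -(k i : ℝ))

theorem abs_le_of_cell_ne_zero {d : ℕ} {l : ℝ} {k : Fin d → ℤ} {y : Sp d} (h : cell l k y ≠ 0)
    (i : Fin d) : |d / l * y i - k i| ≤ 1 := by
  rw [cell_apply] at h
  exact abs_le_of_tooth_ne_zero (Finset.prod_ne_zero_iff.mp h i (Finset.mem_univ i))

/-- This is why the mesh is l / d: each of the d coordinates is off by at most l / d, and the
Euclidean norm is at most the sum of their absolute values. -/
theorem dist_node_le_of_cell_ne_zero {d : ℕ} (hd : 1 ≤ d) {l : ℝ} (hl : 0 < l) {k : Fin d → ℤ}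
    {y : Sp d} (h : cell l k y ≠ 0) : dist y (node l k) ≤ l := by
  have hd' : (0 : ℝ) < d := by exact_mod_cast hd
  have h1 : ∀ i, |(y - node l k) i| ≤ l / d := by
    intro i
    have h2 := abs_le_of_cell_ne_zero h i
    have h3 : (y - node l k) i = l / d * (d / l * y i - k i) := by
      simp only [PiLp.sub_apply, node]
      field_simp
    rw [h3, abs_mul, abs_of_pos (by positivity)]
    exact mul_le_of_le_one_right (by positivity) h2
  rw [dist_eq_norm]
  refine (norm_le_of_abs_le h1).trans (le_of_eq ?_)
  field_simp

theorem tsupport_cell_subset {d : ℕ} (hd : 1 ≤ d) {l : ℝ} (hl : 0 < l) (k : Fin d → ℤ) :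
    tsupport (cell l k) ⊆ Metric.closedBall (node l k) l :=
  closure_minimal (fun _ hy => dist_node_le_of_cell_ne_zero hd hl hy) Metric.isClosed_closedBall

/-- The chain rule produces (d / l) ^ i, and d ^ i ≤ d ^ r because d ≥ 1. The constant does not
depend on the lattice point. -/
theorem exists_scaleBdOn_cell (d r : ℕ) (hd : 1 ≤ d) : ∃ C : ℝ, 0 ≤ C ∧
    ∀ l : ℝ, 0 < l → ∀ k : Fin d → ℤ, ScaleBdOn r univ l C (cell l k) := by
  obtain ⟨C, hC0, hC⟩ := exists_bump_bound d r
  have hd' : (1 : ℝ) ≤ d := by exact_mod_cast hd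
  refine ⟨d ^ r * C, by positivity, fun l hl k i hi y _ => ?_⟩
  have h1 := norm_iteratedFDeriv_comp_affine (contDiff_bump (d := d)) (d / l)
    (WithLp.toLp 2 fun i => -(k i : ℝ)) i y
  refine h1.le.trans ?_
  rw [abs_of_pos (by positivity), div_pow, div_mul_eq_mul_div]
  gcongr
  exact hC i hi _

/-- The lattice indices in the cube of radius `ρ` around `t`. -/
def box {d : ℕ} (t : Fin d → ℝ) (ρ : ℝ) : Finset (Fin d → ℤ) :=
  Fintype.piFinset fun i => Finset.Icc ⌈t i - ρ⌉ ⌊t i + ρ⌋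

theorem mem_box {d : ℕ} {t : Fin d → ℝ} {ρ : ℝ} {k : Fin d → ℤ} :
    k ∈ box t ρ ↔ ∀ i, |(k i : ℝ) - t i| ≤ ρ := by
  simp only [box, Fintype.mem_piFinset, Finset.mem_Icc, Int.ceil_le, Int.le_floor, abs_le]
  refine forall_congr' fun i => ?_
  constructor <;> rintro ⟨h1, h2⟩ <;> constructor <;> linarith

theorem card_box_le {d : ℕ} (t : Fin d → ℝ) {ρ : ℝ} (hρ : 0 ≤ ρ) :
    ((box t ρ).card : ℝ) ≤ (2 * ρ + 1) ^ d := by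
  rw [box, Fintype.card_piFinset]
  push_cast
  refine (Finset.prod_le_prod (fun i _ => Nat.cast_nonneg _) (fun i _ => ?_)).trans
    (le_of_eq (by rw [Finset.prod_const, Finset.card_univ, Fintype.card_fin]))
  rw [Int.card_Icc]
  have h1 : (⌊t i + ρ⌋ : ℝ) ≤ t i + ρ := Int.floor_le _
  have h2 : t i - ρ ≤ (⌈t i - ρ⌉ : ℝ) := Int.le_ceil _
  rcases le_total 0 (⌊t i + ρ⌋ + 1 - ⌈t i - ρ⌉) with h | h
  · have : (((⌊t i + ρ⌋ + 1 - ⌈t i - ρ⌉).toNat : ℤ) : ℝ) = ⌊t i + ρ⌋ + 1 - ⌈t i - ρ⌉ := by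
      rw [Int.toNat_of_nonneg h]
      push_cast
      ring
    rw [Int.cast_natCast] at this
    rw [this]
    linarith
  · rw [Int.toNat_of_nonpos h]
    push_cast
    linarith

/-- Distributing the product turns the sum over the box into a product of one-dimensional sums. The
margin 1 in ρ absorbs the rounding of the interval ends to integers. -/
theorem sum_cell {d : ℕ} {l ρ : ℝ} {t : Fin d → ℝ} {y : Sp d}
    (h : ∀ i, |d / l * y i - t i| ≤ ρ - 1) : ∑ k ∈ box t ρ, cell l k y = 1 := by
  simp only [cell_apply]
  rw [box, ← Finset.prod_univ_sum (fun i => Finset.Icc ⌈t i - ρ⌉ ⌊t i + ρ⌋)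
    (fun i (j : ℤ) => tooth (d / l * y i - j))]
  refine Finset.prod_eq_one fun i _ => ?_
  have h1 := abs_le.mp (h i)
  have h2 := Int.ceil_lt_add_one (t i - ρ)
  have h3 := Int.sub_one_lt_floor (t i + ρ)
  exact sum_tooth (by linarith) (by linarith)

theorem cell_eq_zero_of_notMem_box {d : ℕ} {l ρ : ℝ} {t : Fin d → ℝ} {y : Sp d}
    (h : ∀ i, |d / l * y i - t i| ≤ ρ - 1) {k : Fin d → ℤ} (hk : k ∉ box t ρ) :
    cell l k y = 0 := by
  by_contra hne
  refine hk (mem_box.mpr fun i => ?_)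
  have h1 := abs_le_of_cell_ne_zero hne i
  calc |(k i : ℝ) - t i| = |(d / l * y i - t i) - (d / l * y i - k i)| := by congr 1; ring
    _ ≤ |d / l * y i - t i| + |d / l * y i - k i| := abs_sub _ _
    _ ≤ ρ := by linarith [h i]

theorem abs_coord_le {d : ℕ} (y : Sp d) (i : Fin d) : |y i| ≤ ‖y‖ := by
  simpa using PiLp.norm_apply_le y i

theorem mulTest_apply {d : ℕ} (g : Sp d → ℝ) (hg : ContDiff ℝ ∞ g) (φ : TestFn d) (y : Sp d) :
    mulTest g hg φ y = φ y * g y := rfl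

theorem tsupport_mulTest_subset {d : ℕ} (g : Sp d → ℝ) (hg : ContDiff ℝ ∞ g) (φ : TestFn d) :
    tsupport (mulTest g hg φ) ⊆ tsupport φ ∩ tsupport g := by
  refine subset_inter (closure_mono fun y hy h => hy ?_) (closure_mono fun y hy h => hy ?_)
  · rw [mulTest_apply, h, zero_mul]
  · rw [mulTest_apply, h, mul_zero]

/-- If `η` is bounded by `M` on all the unit tests rescaled to scale `l`, and `ψ` varies at scale
`l` and lives in a ball of radius `R ≥ l`, then `η ψ` is of order `R ^ d * M`. -/
theorem exists_abs_apply_le (d r : ℕ) (hd : 1 ≤ d) : ∃ C : ℝ, 0 ≤ C ∧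
    ∀ (η : Dist d) (x : Sp d) (l R M A : ℝ) (hl : 0 < l), l ≤ R → 0 ≤ A →
      (∀ φ ∈ unitTests d r, ∀ z ∈ Metric.closedBall x (R + l), |η (scaled φ z l hl)| ≤ M) →
      ∀ ψ : TestFn d, tsupport ψ ⊆ Metric.closedBall x R → ScaleBdOn r univ l A ψ →
        |η ψ| ≤ C * A * R ^ d * M := by
  obtain ⟨C, hC0, hC⟩ := exists_scaleBdOn_cell d r hd
  refine ⟨(2 * d + 3) ^ d * (2 ^ r * C), by positivity, ?_⟩
  intro η x l R M A hl hlR hA hM ψ hsupp hψ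
  have hR : 0 < R := hl.trans_le hlR
  have hM0 : 0 ≤ M := (abs_nonneg _).trans (hM 0 (zero_mem_unitTests d r) x
    (Metric.mem_closedBall_self (by positivity)))
  have hcd : ContDiff ℝ ∞ ψ := ψ.contDiff
  have hd' : (0 : ℝ) < d := by exact_mod_cast hd
  set t : Fin d → ℝ := fun i => d / l * x i
  -- R measured in units of the mesh, plus the margin that `sum_cell` asks for.
  set ρ : ℝ := d / l * R + 1
  have hsum : ψ = ∑ k ∈ box t ρ, mulTest (cell l k) (contDiff_cell l k) ψ := by
    ext y
    have h1 : (∑ k ∈ box t ρ, mulTest (cell l k) (contDiff_cell l k) ψ : TestFn d) y =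
        ψ y * ∑ k ∈ box t ρ, cell l k y := by
      rw [FunLike.coe_sum, Finset.sum_apply, Finset.mul_sum]
      rfl
    rw [h1]
    by_cases hy : ψ y = 0
    · rw [hy, zero_mul]
    · rw [sum_cell, mul_one]
      intro i
      have h2 := hsupp (subset_tsupport _ hy)
      rw [Metric.mem_closedBall, dist_eq_norm] at h2
      have h3 := (abs_coord_le (y - x) i).trans h2
      have h4 : d / l * y i - t i = d / l * (y - x) i := by
        simp only [t, PiLp.sub_apply]
        ring
      rw [h4, abs_mul, abs_of_pos (by positivity)]
      simp only [ρ, add_sub_cancel_right]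
      gcongr
  have hterm : ∀ k, |η (mulTest (cell l k) (contDiff_cell l k) ψ)| ≤
      2 ^ r * (A * C) * l ^ d * M := by
    intro k
    have hs := tsupport_mulTest_subset (cell l k) (contDiff_cell l k) ψ
    -- The bound `hM` covers only centres within R + l of x; a cell centred further away misses the
    -- support of ψ.
    by_cases hk : node l k ∈ Metric.closedBall x (R + l)
    · refine abs_apply_le_of_localised hl (fun φ hφ => hM φ hφ _ hk) (by positivity) ?_ ?_
      · exact (hs.trans inter_subset_right).trans (tsupport_cell_subset hd hl k)
      · exact ScaleBdOn.mul hcd (contDiff_cell l k) hA hC0 hl hψ (hC l hl k)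
    · have : mulTest (cell l k) (contDiff_cell l k) ψ = 0 := by
        ext y
        rw [mulTest_apply]
        by_contra hne
        have h1 := hsupp (subset_tsupport _ (left_ne_zero_of_mul hne))
        have h2 := dist_node_le_of_cell_ne_zero hd hl (right_ne_zero_of_mul hne)
        refine hk ?_
        rw [Metric.mem_closedBall] at h1 ⊢
        linarith [dist_triangle_left (node l k) x y]
      rw [this, map_zero, abs_zero]
      positivity
  -- The number of cells times their volume is comparable to the volume of the large ball; l ≤ R
  -- absorbs the boundary layer.
  have hcard : ((box t ρ).card : ℝ) * l ^ d ≤ (2 * d + 3) ^ d * R ^ d := by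
    rw [← mul_pow]
    refine (mul_le_mul_of_nonneg_right (card_box_le t (ρ := ρ) (by positivity))
      (by positivity)).trans ?_
    rw [← mul_pow]
    refine pow_le_pow_left₀ (by positivity) ?_ d
    have : (2 * ρ + 1) * l = 2 * d * R + 3 * l := by
      simp only [ρ]
      field_simp
      ring
    rw [this]
    linarith
  calc |η ψ| = |∑ k ∈ box t ρ, η (mulTest (cell l k) (contDiff_cell l k) ψ)| := by
        rw [← map_sum, ← hsum]
    _ ≤ ∑ k ∈ box t ρ, 2 ^ r * (A * C) * l ^ d * M :=
        (Finset.abs_sum_le_sum_abs _ _).trans (Finset.sum_le_sum fun k _ => hterm k)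
    _ = ((box t ρ).card : ℝ) * l ^ d * (2 ^ r * (A * C) * M) := by
        rw [Finset.sum_const, nsmul_eq_mul]
        ring
    _ ≤ (2 * d + 3) ^ d * R ^ d * (2 ^ r * (A * C) * M) := by gcongr
    _ = _ := by ring

/-! ### Polynomials -/

/-- Both sides come from algebra homomorphisms that agree on the variables. This is the algebra
behind Π_x Γ_{xy} = Π_y. -/
theorem evalAt_transl {d : ℕ} (x y : Sp d) (p : Poly d) :
    evalAt x (transl (y - x) p) = evalAt y p := by
  funext w
  have h : (MvPolynomial.aeval (fun i => w i - x i) : Poly d →ₐ[ℝ] ℝ).comp (transl (y - x)) =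
      MvPolynomial.aeval fun i => w i - y i := by
    refine MvPolynomial.algHom_ext fun i => ?_
    simp [transl]
  have h' := DFunLike.congr_fun h p
  simpa [evalAt, MvPolynomial.aeval_eq_eval] using h'

theorem evalAt_sub {d : ℕ} (x : Sp d) (p q : Poly d) :
    evalAt x (p - q) = evalAt x p - evalAt x q := funext fun y => by simp [evalAt]

theorem evalAt_zero {d : ℕ} (x : Sp d) : evalAt x (0 : Poly d) = 0 := funext fun y => by
  simp [evalAt]

/-- The multi-indices of degree at most `n`. -/
def indices (d n : ℕ) : Finset (Fin d →₀ ℕ) :=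
  (Finsupp.finite_of_degree_le (σ := Fin d) n).toFinset

theorem mem_indices {d n : ℕ} {k : Fin d →₀ ℕ} : k ∈ indices d n ↔ k.degree ≤ n := by
  simp [indices]

theorem sum_indices_eq_eval {d n : ℕ} {p : Poly d} (hp : ∀ k, n < k.degree → p.coeff k = 0)
    (u : Fin d → ℝ) :
    MvPolynomial.eval u p = ∑ k ∈ indices d n, p.coeff k * ∏ i, u i ^ k i := by
  rw [MvPolynomial.eval_eq']
  refine Finset.sum_subset (fun k hk => ?_) fun k _ hk => ?_
  · rw [mem_indices]
    by_contra hc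
    exact MvPolynomial.mem_support_iff.mp hk (hp k (not_le.mp hc))
  · rw [MvPolynomial.notMem_support_iff.mp hk, zero_mul]

theorem evalAt_eq_sum {d n : ℕ} {p : Poly d} (hp : ∀ k, n < k.degree → p.coeff k = 0) (x : Sp d) :
    evalAt x p = ∑ k ∈ indices d n, p.coeff k • fun y : Sp d => ∏ i, (y i - x i) ^ k i := by
  funext y
  rw [evalAt, sum_indices_eq_eval hp, Finset.sum_apply]
  rfl

/-- Evaluation of the polynomial with coefficients `c` as a continuous function on the unit ball. -/
def polyOnBall (d n : ℕ) : (indices d n → ℝ) →ₗ[ℝ] C(Metric.closedBall (0 : Sp d) 1, ℝ) where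
  toFun c := ⟨fun u => ∑ k, c k * ∏ i, u.1 i ^ k.1 i, by fun_prop⟩
  map_add' c c' := by
    ext u
    simp [add_mul, Finset.sum_add_distrib]
  map_smul' a c := by
    ext u
    simp [Finset.mul_sum, mul_assoc]

/-- The unit ball contains the cube [0, 1/d]^d, and a polynomial that vanishes on a product of
infinite sets is zero. -/
theorem ker_polyOnBall (d n : ℕ) : LinearMap.ker (polyOnBall d n) = ⊥ := by
  rw [LinearMap.ker_eq_bot']
  intro c hc
  let p : Poly d := ∑ k : indices d n, MvPolynomial.monomial k.1 (c k)
  have hcoeff : ∀ k : indices d n, p.coeff k.1 = c k := by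
    intro k
    simp only [p, MvPolynomial.coeff_sum, MvPolynomial.coeff_monomial]
    rw [Finset.sum_eq_single k (fun m _ hm => if_neg fun h => hm (Subtype.ext h))
      fun h => absurd (Finset.mem_univ k) h, if_pos rfl]
  have hp : p = 0 := by
    refine MvPolynomial.funext_set (fun _ => Icc (0 : ℝ) (1 / d)) (fun i => ?_) fun u hu => ?_
    · have : (0 : ℝ) < d := by exact_mod_cast i.pos
      exact Icc_infinite (by positivity)
    · have hu' : WithLp.toLp 2 u ∈ Metric.closedBall (0 : Sp d) 1 := by
        rw [mem_closedBall_zero_iff]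
        refine (norm_le_of_abs_le (c := 1 / d) fun i => ?_).trans ?_
        · have := hu i (mem_univ i)
          rw [abs_of_nonneg this.1]
          exact this.2
        · rw [mul_one_div]
          exact div_self_le_one _
      have h1 := DFunLike.congr_fun hc ⟨_, hu'⟩
      change ∑ k, c k * ∏ i, u i ^ k.1 i = 0 at h1
      simp only [p, map_sum, MvPolynomial.eval_monomial, map_zero]
      rw [← h1]
      refine Finset.sum_congr rfl fun k _ => ?_
      rw [Finsupp.prod_fintype _ _ fun i => pow_zero _]
  funext k
  rw [← hcoeff k, hp]
  simp

/-- The coefficients of a polynomial are controlled by its values on a ball. -/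
theorem exists_coeff_bound (d n : ℕ) : ∃ C : ℝ, 0 ≤ C ∧ ∀ p : Poly d,
    (∀ k, n < k.degree → p.coeff k = 0) → ∀ ρ M : ℝ, 0 < ρ →
    (∀ u : Sp d, ‖u‖ ≤ ρ → |MvPolynomial.eval (fun i => u i) p| ≤ M) →
    ∀ k, |p.coeff k| * ρ ^ k.degree ≤ C * M := by
  -- An injective linear map on a finite-dimensional space is bounded below; this supplies C.
  obtain ⟨C, -, hC⟩ := (polyOnBall d n).exists_antilipschitzWith (ker_polyOnBall d n)
  refine ⟨C, C.2, fun p hp ρ M hρ hM k => ?_⟩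
  have hM0 : 0 ≤ M := (abs_nonneg _).trans (hM 0 (by simpa using hρ.le))
  by_cases hk : k.degree ≤ n
  · let c : indices d n → ℝ := fun k => p.coeff k.1 * ρ ^ k.1.degree
    have h1 : ‖c‖ ≤ C * ‖polyOnBall d n c‖ := by
      have := hC.le_mul_dist c 0
      simpa using this
    have h2 : ‖polyOnBall d n c‖ ≤ M := by
      refine (ContinuousMap.norm_le _ hM0).mpr fun u => ?_
      have hu : ‖ρ • u.1‖ ≤ ρ := by
        rw [norm_smul, Real.norm_of_nonneg hρ.le]
        exact mul_le_of_le_one_right hρ.le (mem_closedBall_zero_iff.mp u.2)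
      convert hM _ hu using 1
      rw [sum_indices_eq_eval hp, Real.norm_eq_abs, ← Finset.sum_coe_sort]
      congr 1
      refine Finset.sum_congr rfl fun k _ => ?_
      simp only [c, PiLp.smul_apply, smul_eq_mul, mul_pow, Finset.prod_mul_distrib,
        Finset.prod_pow_eq_pow_sum, Finsupp.degree_eq_sum]
      ring
    have h3 := norm_le_pi_norm c ⟨k, mem_indices.mpr hk⟩
    simp only [c, norm_mul, norm_pow, Real.norm_eq_abs, abs_of_pos hρ] at h3
    exact h3.trans (h1.trans (mul_le_mul_of_nonneg_left h2 C.2))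
  · rw [hp k (not_le.mp hk), abs_zero, zero_mul]
    exact mul_nonneg C.2 hM0

theorem scaleBdOn_const {d r : ℕ} {S : Set (Sp d)} {L : ℝ} (c : ℝ) (hL : 0 < L) :
    ScaleBdOn r S L |c| fun _ => c := by
  intro i _ y _
  rcases Nat.eq_zero_or_pos i with rfl | hi
  · simp
  · rw [iteratedFDeriv_const_of_ne hi.ne']
    simp only [Pi.zero_apply, norm_zero]
    positivity

/-- The value is at most L on the ball, the derivative has norm at most 1 = L / L, and all higher
derivatives vanish. -/
theorem scaleBdOn_coord {d r : ℕ} (x : Sp d) (j : Fin d) {L : ℝ} (hL : 0 < L) :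
    ScaleBdOn r (Metric.closedBall x L) L L fun y => y j - x j := by
  intro i _ y hy
  rw [Metric.mem_closedBall, dist_eq_norm] at hy
  have hfd : fderiv ℝ (fun y : Sp d => y j - x j) = fun _ => EuclideanSpace.proj j := by
    funext y
    exact (((EuclideanSpace.proj j : Sp d →L[ℝ] ℝ).hasFDerivAt).sub_const (x j)).fderiv
  rcases i with _ | _ | i
  · rw [norm_iteratedFDeriv_zero, pow_zero, div_one, Real.norm_eq_abs]
    exact (abs_coord_le (y - x) j).trans hy
  · rw [← norm_iteratedFDeriv_fderiv, hfd, norm_iteratedFDeriv_zero, zero_add, pow_one,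
      div_self hL.ne']
    refine ContinuousLinearMap.opNorm_le_bound _ zero_le_one fun v => ?_
    rw [one_mul]
    exact abs_coord_le v j
  · rw [← norm_iteratedFDeriv_fderiv, hfd, iteratedFDeriv_const_of_ne (Nat.succ_ne_zero i)]
    simp only [Pi.zero_apply, norm_zero]
    positivity

theorem contDiff_monomial {d : ℕ} (x : Sp d) (k : Fin d →₀ ℕ) :
    ContDiff ℝ ∞ fun y : Sp d => ∏ i, (y i - x i) ^ k i :=
  contDiff_prod fun i _ => by fun_prop

/-- Induction on the degree, peeling off one variable at a time; each use of the product rule costs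
a factor 2 ^ r. -/
theorem scaleBdOn_monomial {d r : ℕ} (x : Sp d) {L : ℝ} (hL : 0 < L) (n : ℕ) :
    ∀ k : Fin d →₀ ℕ, k.degree = n →
      ScaleBdOn r (Metric.closedBall x L) L ((2 ^ r) ^ n * L ^ n)
        fun y => ∏ i, (y i - x i) ^ k i := by
  induction n with
  | zero =>
    intro k hk
    obtain rfl : k = 0 := (Finsupp.degree_eq_zero_iff k).mp hk
    simpa using scaleBdOn_const (d := d) (r := r) (S := Metric.closedBall x L) 1 hL
  | succ n ih =>
    intro k hk
    obtain ⟨j, hj⟩ : ∃ j, k j ≠ 0 := by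
      by_contra hcon
      push Not at hcon
      obtain rfl : k = 0 := Finsupp.ext hcon
      simp at hk
    obtain ⟨k', rfl⟩ : ∃ k', k = k' + Finsupp.single j 1 :=
      ⟨k - Finsupp.single j 1, (tsub_add_cancel_of_le
        (Finsupp.single_le_iff.mpr (Nat.one_le_iff_ne_zero.mpr hj))).symm⟩
    have hk' : k'.degree = n := by
      rw [map_add, Finsupp.degree_single] at hk
      omega
    have h1 := (ih k' hk').mul (contDiff_monomial x k') (by fun_prop) (by positivity) hL.le hL
      (scaleBdOn_coord x j hL)
    have h2 : (fun y : Sp d => ∏ i, (y i - x i) ^ (k' + Finsupp.single j 1 : Fin d →₀ ℕ) i) =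
        (fun y => ∏ i, (y i - x i) ^ k' i) * fun y => y j - x j := by
      funext y
      simp only [Finsupp.add_apply, pow_add, Finset.prod_mul_distrib, Pi.mul_apply]
      congr 1
      rw [Finset.prod_eq_single j]
      · simp
      · intro i _ hij
        rw [Finsupp.single_eq_of_ne hij, pow_zero]
      · simp
    rw [h2]
    convert h1 using 1
    ring

/-- A polynomial of degree at most `n` whose coefficients are controlled at scale `L`. -/
theorem exists_scaleBdOn_evalAt (d n r : ℕ) : ∃ C : ℝ, 0 ≤ C ∧ ∀ (p : Poly d) (x : Sp d) (L M : ℝ),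
    0 < L → (∀ k, n < k.degree → p.coeff k = 0) → (∀ k, |p.coeff k| * L ^ k.degree ≤ M) →
    ScaleBdOn r (Metric.closedBall x L) L (C * M) (evalAt x p) := by
  refine ⟨∑ k ∈ indices d n, (2 ^ r) ^ k.degree, by positivity, fun p x L M hL hp hM => ?_⟩
  rw [evalAt_eq_sum hp, Finset.sum_mul]
  refine ScaleBdOn.sum (fun k _ => contDiff_const.smul (contDiff_monomial x k)) fun k _ => ?_
  refine (((scaleBdOn_monomial x hL _ k rfl).const_smul _ (contDiff_monomial x k))).mono_const hL ?_
  calc |p.coeff k| * ((2 ^ r) ^ k.degree * L ^ k.degree)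
      = (2 ^ r) ^ k.degree * (|p.coeff k| * L ^ k.degree) := by ring
    _ ≤ _ := by gcongr; exact hM k

/-! ### Taylor expansions -/

theorem below_lt {β : ℝ} (hβ : 0 < β) : (below β : ℝ) < β := by
  have h1 : 0 < ⌈β⌉₊ := Nat.ceil_pos.mpr hβ
  have h2 : below β < ⌈β⌉₊ := Nat.sub_lt h1 one_pos
  exact Nat.lt_ceil.mp h2

theorem coeff_taylor_eq_zero {d n : ℕ} (f : Sp d → ℝ) (x : Sp d) (k : Fin d →₀ ℕ)
    (hk : n < k.degree) : (taylor n f x).coeff k = 0 := by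
  refine MvPolynomial.coeff_eq_zero_of_totalDegree_lt (lt_of_le_of_lt ?_ hk)
  refine MvPolynomial.totalDegree_finsetSum_le fun j hj => ?_
  refine MvPolynomial.totalDegree_finsetSum_le fun i _ => ?_
  refine (MvPolynomial.totalDegree_mul _ _).trans ?_
  rw [MvPolynomial.totalDegree_C, zero_add]
  refine (MvPolynomial.totalDegree_finsetProd _ _).trans ?_
  simp only [MvPolynomial.totalDegree_X, Finset.sum_const, Finset.card_univ, Fintype.card_fin,
    smul_eq_mul, mul_one]
  exact Nat.lt_succ_iff.mp (Finset.mem_range.mp hj)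

theorem coeff_transl_eq_zero {d n : ℕ} (h : Sp d) {p : Poly d}
    (hp : ∀ k, n < k.degree → p.coeff k = 0) (k : Fin d →₀ ℕ) (hk : n < k.degree) :
    (transl h p).coeff k = 0 := by
  rw [coeff_transl h p k fun m hm => ?_, hp k hk]
  by_contra hc
  exact hm (hp m (by omega))

/-- Expanding u in the standard basis and using multilinearity recovers the usual Taylor sum from
its coordinate form. -/
theorem eval_taylor {d n : ℕ} (f : Sp d → ℝ) (x u : Sp d) :
    MvPolynomial.eval (fun i => u i) (taylor n f x) =
      ∑ j ∈ Finset.range (n + 1), (j.factorial : ℝ)⁻¹ • iteratedFDeriv ℝ j f x fun _ => u := by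
  simp only [taylor, map_sum, map_mul, MvPolynomial.eval_C, map_prod, MvPolynomial.eval_X]
  refine Finset.sum_congr rfl fun j _ => ?_
  have hu : u = ∑ i, u i • (EuclideanSpace.single i 1 : Sp d) := by
    ext i
    simp [Finset.sum_apply, Pi.single_apply]
  have h1 : (fun _ : Fin j => u) =
      fun _ : Fin j => ∑ i, u i • (EuclideanSpace.single i 1 : Sp d) := by rw [← hu]
  rw [h1, ContinuousMultilinearMap.map_sum, smul_eq_mul, Finset.mul_sum]
  refine Finset.sum_congr rfl fun i _ => ?_
  rw [ContinuousMultilinearMap.map_smul_univ, smul_eq_mul]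
  ring

/-- Taylor's formula for a function with Hölder continuous last derivative. -/
theorem abs_sub_taylor_le {d n : ℕ} {θ Q : ℝ} (hθ : 0 ≤ θ) (hQ : 0 ≤ Q) {f : Sp d → ℝ}
    (hf : ContDiff ℝ n f) (x u : Sp d)
    (h : ∀ t ∈ Icc (0 : ℝ) 1,
      ‖iteratedFDeriv ℝ n f (x + t • u) - iteratedFDeriv ℝ n f x‖ ≤ Q * ‖t • u‖ ^ θ) :
    |f (x + u) - MvPolynomial.eval (fun i => u i) (taylor n f x)| ≤ Q * ‖u‖ ^ θ * ‖u‖ ^ n := by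
  have h' : ∀ t ∈ Icc (0 : ℝ) 1, |iteratedFDeriv ℝ n f (x + t • u) (fun _ => u) -
      iteratedFDeriv ℝ n f x fun _ => u| ≤ Q * ‖u‖ ^ θ * ‖u‖ ^ n := by
    intro t ht
    have h1 := (iteratedFDeriv ℝ n f (x + t • u) - iteratedFDeriv ℝ n f x).le_opNorm fun _ => u
    rw [Finset.prod_const, Finset.card_univ, Fintype.card_fin] at h1
    refine h1.trans ?_
    gcongr
    refine (h t ht).trans ?_
    gcongr
    rw [norm_smul, Real.norm_of_nonneg ht.1]
    exact mul_le_of_le_one_left (norm_nonneg _) ht.2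
  rw [eval_taylor, Finset.sum_range_succ]
  -- The integral remainder is available from order n + 1 on; at order 0 the claim is the Hölder
  -- bound itself, at t = 1.
  rcases n with _ | n
  · have := h' 1 ⟨zero_le_one, le_rfl⟩
    simpa using this
  · rw [map_add_eq_sum_add_integral_iteratedFDeriv (n := n) (f := f) (x := x) (y := u)
      fun t _ => by exact_mod_cast hf.contDiffAt, add_sub_add_left_eq_sub]
    have hc : Continuous fun t : ℝ => iteratedFDeriv ℝ (n + 1) f (x + t • u) fun _ => u := by
      have h1 : Continuous fun t : ℝ => iteratedFDeriv ℝ (n + 1) f (x + t • u) :=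
        (hf.continuous_iteratedFDeriv le_rfl).comp (by fun_prop)
      exact (ContinuousMultilinearMap.apply ℝ (fun _ : Fin (n + 1) => Sp d) ℝ
        fun _ => u).continuous.comp h1
    have hint : ((n + 1).factorial : ℝ)⁻¹ = (n.factorial : ℝ)⁻¹ * ∫ t in (0 : ℝ)..1, (1 - t) ^ n := by
      have : ∫ t in (0 : ℝ)..1, (1 - t) ^ n = ((n : ℝ) + 1)⁻¹ := by
        rw [intervalIntegral.integral_comp_sub_left (fun t => t ^ n) 1]
        simp
      rw [this, Nat.factorial_succ]
      push_cast
      rw [mul_inv, mul_comm]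
    -- The top Taylor term is written as the same weighted integral of a constant, so the remainder
    -- contains only the variation of the top derivative, which the Hölder bound controls.
    have hkey : (n.factorial : ℝ)⁻¹ • ∫ t in (0 : ℝ)..1,
          (1 - t) ^ n • (iteratedFDeriv ℝ (n + 1) f (x + t • u) fun _ => u) =
        ((n + 1).factorial : ℝ)⁻¹ • (iteratedFDeriv ℝ (n + 1) f x fun _ => u) +
        (n.factorial : ℝ)⁻¹ • ∫ t in (0 : ℝ)..1, (1 - t) ^ n •
          ((iteratedFDeriv ℝ (n + 1) f (x + t • u) fun _ => u) -
            iteratedFDeriv ℝ (n + 1) f x fun _ => u) := by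
      simp only [smul_sub]
      rw [intervalIntegral.integral_sub, hint, intervalIntegral.integral_smul_const]
      · simp only [smul_eq_mul]
        ring
      · exact Continuous.intervalIntegrable (by fun_prop) _ _
      · exact Continuous.intervalIntegrable (by fun_prop) _ _
    rw [hkey, add_sub_cancel_left, smul_eq_mul, abs_mul]
    have hfac : |(n.factorial : ℝ)⁻¹| ≤ 1 := by
      rw [abs_of_nonneg (by positivity)]
      exact inv_le_one_of_one_le₀ (by exact_mod_cast Nat.one_le_iff_ne_zero.mpr n.factorial_ne_zero)
    have hI := intervalIntegral.norm_integral_le_of_norm_le_const (a := (0 : ℝ)) (b := 1)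
      (C := Q * ‖u‖ ^ θ * ‖u‖ ^ (n + 1)) (f := fun t => (1 - t) ^ n •
          ((iteratedFDeriv ℝ (n + 1) f (x + t • u) fun _ => u) -
            iteratedFDeriv ℝ (n + 1) f x fun _ => u)) fun t ht => by
      rw [uIoc_of_le zero_le_one] at ht
      rw [norm_smul, norm_pow, Real.norm_of_nonneg (by linarith [ht.2])]
      have h1 : (1 - t) ^ n ≤ 1 := pow_le_one₀ (by linarith [ht.2]) (by linarith [ht.1])
      exact (mul_le_of_le_one_left (norm_nonneg _) h1).trans (h' t ⟨ht.1.le, ht.2⟩)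
    rw [sub_zero, abs_one, mul_one] at hI
    exact (mul_le_of_le_one_left (abs_nonneg _) hfac).trans hI

/-- The closed ball around the origin, as a compact set. -/
def ballK (d : ℕ) (R : ℝ) : Compacts (Sp d) :=
  ⟨Metric.closedBall 0 R, isCompact_closedBall 0 R⟩

theorem mem_ballK {d : ℕ} {R : ℝ} {x : Sp d} : x ∈ ballK d R ↔ ‖x‖ ≤ R :=
  mem_closedBall_zero_iff

theorem exists_subset_ballK {d : ℕ} (K : Compacts (Sp d)) :
    ∃ R : ℝ, 0 ≤ R ∧ ∀ x ∈ K, x ∈ ballK d R := by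
  obtain ⟨R, hR⟩ := K.isCompact.isBounded.exists_norm_le
  exact ⟨max R 0, le_max_right _ _, fun x hx => mem_ballK.mpr ((hR x hx).trans (le_max_left _ _))⟩

/-- The ball is convex, so the Hölder bound applies along the segment from x to y, and the exponents
β - n and n add up to β. -/
theorem PosBound.abs_sub_taylor_le {d : ℕ} {β Q R : ℝ} (hβ : 0 < β) (hQ : 0 ≤ Q) {f : Sp d → ℝ}
    (hf : ContDiff ℝ (below β) f) (h : PosBound β (ballK d R) Q f) {x y : Sp d} (hx : ‖x‖ ≤ R)
    (hy : ‖y‖ ≤ R) : |f y - evalAt x (taylor (below β) f x) y| ≤ Q * ‖y - x‖ ^ β := by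
  have hb := below_lt hβ
  have h1 := RegStr.abs_sub_taylor_le (θ := β - below β) (by linarith) hQ hf x (y - x) fun t ht => by
    have hmem : x + t • (y - x) ∈ ballK d R :=
      (convex_closedBall (0 : Sp d) R).add_smul_sub_mem (mem_ballK.mpr hx) (mem_ballK.mpr hy) ht
    have := h.2 _ hmem x (mem_ballK.mpr hx)
    rwa [add_sub_cancel_left] at this
  rw [add_sub_cancel] at h1
  refine h1.trans (le_of_eq ?_)
  rw [mul_assoc, ← Real.rpow_natCast, ← Real.rpow_add_of_nonneg (norm_nonneg _) (by linarith)
    (Nat.cast_nonneg _), sub_add_cancel]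

/-- Taylor polynomials at two points differ little, coefficient by coefficient. -/
theorem exists_coeff_taylor_sub_bound (d : ℕ) {β : ℝ} (hβ : 0 < β) : ∃ C : ℝ, 0 ≤ C ∧
    ∀ (f : Sp d → ℝ) (Q R : ℝ), 0 ≤ Q → ContDiff ℝ (below β) f →
    PosBound β (ballK d (3 * R)) Q f → ∀ x ∈ ballK d R, ∀ y ∈ ballK d R, ∀ k : Fin d →₀ ℕ,
    |(taylor (below β) f x - transl (y - x) (taylor (below β) f y)).coeff k| *
      ‖x - y‖ ^ k.degree ≤ C * Q * ‖x - y‖ ^ β := by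
  obtain ⟨C, hC0, hC⟩ := exists_coeff_bound d (below β)
  refine ⟨C * (1 + 2 ^ β), by positivity, fun f Q R hQ hf hfQ x hx y hy k => ?_⟩
  rw [mem_ballK] at hx hy
  rcases (norm_nonneg (x - y)).eq_or_lt with h0 | hρ
  · have : x = y := sub_eq_zero.mp (norm_eq_zero.mp h0.symm)
    subst this
    rw [sub_self x, transl_zero, sub_self, MvPolynomial.coeff_zero, abs_zero, zero_mul]
    positivity
  have hdeg : ∀ k : Fin d →₀ ℕ, below β < k.degree →
      (taylor (below β) f x - transl (y - x) (taylor (below β) f y)).coeff k = 0 := by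
    intro k hk
    rw [MvPolynomial.coeff_sub, coeff_taylor_eq_zero f x k hk,
      coeff_transl_eq_zero _ (coeff_taylor_eq_zero f y) k hk, sub_zero]
  -- Compare values at x + u with ‖u‖ ≤ ‖x - y‖: both Taylor polynomials are close to f there. Such
  -- a point is within 2‖x - y‖ of y and has norm at most 3R, whence the factor 2 ^ β and the larger
  -- ball.
  refine (hC _ hdeg _ (Q * ‖x - y‖ ^ β + Q * (2 * ‖x - y‖) ^ β) hρ (fun u hu => ?_) k).trans
    (le_of_eq ?_)
  · have hxy : ‖x - y‖ ≤ 2 * R := (norm_sub_le x y).trans (by linarith)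
    have hxu : ‖x + u‖ ≤ 3 * R := (norm_add_le x u).trans (by linarith)
    have h1 : MvPolynomial.eval (fun i => u i)
        (taylor (below β) f x - transl (y - x) (taylor (below β) f y)) =
        evalAt x (taylor (below β) f x) (x + u) - evalAt y (taylor (below β) f y) (x + u) := by
      rw [← evalAt_transl x y, map_sub]
      simp [evalAt]
    have hR0 : 0 ≤ R := (norm_nonneg x).trans hx
    have h2 := hfQ.abs_sub_taylor_le hβ hQ hf (by linarith : ‖x‖ ≤ 3 * R) hxu
    have h3 := hfQ.abs_sub_taylor_le hβ hQ hf (by linarith : ‖y‖ ≤ 3 * R) hxu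
    have h4 : ‖x + u - x‖ ≤ ‖x - y‖ := by rwa [add_sub_cancel_left]
    have h5 : ‖x + u - y‖ ≤ 2 * ‖x - y‖ := by
      have : x + u - y = (x - y) + u := by abel
      rw [this]
      exact (norm_add_le _ _).trans (by linarith)
    have h6 : ‖x + u - x‖ ^ β ≤ ‖x - y‖ ^ β := by gcongr
    have h7 : ‖x + u - y‖ ^ β ≤ (2 * ‖x - y‖) ^ β := by gcongr
    rw [h1]
    calc _ = |(f (x + u) - evalAt y (taylor (below β) f y) (x + u)) -
          (f (x + u) - evalAt x (taylor (below β) f x) (x + u))| := by congr 1; ring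
      _ ≤ _ := abs_sub _ _
      _ ≤ Q * (2 * ‖x - y‖) ^ β + Q * ‖x - y‖ ^ β := by
        exact add_le_add (h3.trans (mul_le_mul_of_nonneg_left h7 hQ))
          (h2.trans (mul_le_mul_of_nonneg_left h6 hQ))
      _ = _ := add_comm _ _
  · rw [Real.mul_rpow (by norm_num) (norm_nonneg _)]
    ring

/-- The Taylor polynomial of `f` at `x`, as a function on `ℝ^d`. -/
def taylorFn {d : ℕ} (n : ℕ) (f : Sp d → ℝ) (x : Sp d) : Sp d → ℝ := evalAt x (taylor n f x)

theorem contDiff_taylorFn {d : ℕ} (n : ℕ) (f : Sp d → ℝ) (x : Sp d) :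
    ContDiff ℝ ∞ (taylorFn n f x) := contDiff_evalAt x _

/-- The coefficient of degree j is of order ‖x - y‖ ^ (β - j). Only j < β occurs, so the exponent is
positive and ‖x - y‖ may be replaced by L. -/
theorem exists_scaleBdOn_taylorFn_sub (d r : ℕ) {β : ℝ} (hβ : 0 < β) : ∃ C : ℝ, 0 ≤ C ∧
    ∀ (f : Sp d → ℝ) (Q R : ℝ), 0 ≤ Q → ContDiff ℝ (below β) f →
    PosBound β (ballK d (3 * R)) Q f → ∀ x ∈ ballK d R, ∀ y ∈ ballK d R, ∀ L : ℝ, 0 < L →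
    ‖x - y‖ ≤ L → ScaleBdOn r (Metric.closedBall x L) L (C * Q * L ^ β)
      (taylorFn (below β) f x - taylorFn (below β) f y) := by
  obtain ⟨C, hC0, hC⟩ := exists_coeff_taylor_sub_bound d hβ
  obtain ⟨C', hC'0, hC'⟩ := exists_scaleBdOn_evalAt d (below β) r
  refine ⟨C' * C, by positivity, fun f Q R hQ hf hfQ x hx y hy L hL hxy => ?_⟩
  have hdeg : ∀ k : Fin d →₀ ℕ, below β < k.degree →
      (taylor (below β) f x - transl (y - x) (taylor (below β) f y)).coeff k = 0 := by
    intro k hk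
    rw [MvPolynomial.coeff_sub, coeff_taylor_eq_zero f x k hk,
      coeff_transl_eq_zero _ (coeff_taylor_eq_zero f y) k hk, sub_zero]
  have h := hC' (taylor (below β) f x - transl (y - x) (taylor (below β) f y)) x L
    (C * Q * L ^ β) hL hdeg fun k => ?_
  · rw [evalAt_sub, evalAt_transl] at h
    refine h.mono_const hL (le_of_eq (by ring))
  · by_cases hk : k.degree ≤ below β
    · have h1 := hC f Q R hQ hf hfQ x hx y hy k
      have hkβ : (k.degree : ℝ) < β :=
        lt_of_le_of_lt (by exact_mod_cast hk) (below_lt hβ)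
      rcases (norm_nonneg (x - y)).eq_or_lt with h0 | hρ
      · have : x = y := sub_eq_zero.mp (norm_eq_zero.mp h0.symm)
        subst this
        rw [sub_self x, transl_zero, sub_self, MvPolynomial.coeff_zero, abs_zero, zero_mul]
        positivity
      · have key : ∀ s : ℝ, 0 < s → s ^ β = s ^ (β - k.degree) * s ^ k.degree := by
          intro s hs
          rw [← Real.rpow_natCast, ← Real.rpow_add hs, sub_add_cancel]
        rw [key _ hρ, ← mul_assoc] at h1
        have h2 := le_of_mul_le_mul_right h1 (by positivity)
        rw [key _ hL, ← mul_assoc]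
        gcongr
        refine h2.trans ?_
        gcongr
    · rw [hdeg k (not_le.mp hk), abs_zero, zero_mul]
      positivity

/-! ### Smooth approximation by patched Taylor polynomials -/

/-- The Taylor polynomials of `f` at the lattice points of scale `l`, patched together by the
partition of unity. -/
def approx {d : ℕ} (n : ℕ) (f : Sp d → ℝ) (l : ℝ) (y : Sp d) : ℝ :=
  ∑ᶠ k : Fin d → ℤ, cell l k y * taylorFn n f (node l k) y

theorem eventually_coord_le {d : ℕ} (hd : 1 ≤ d) {l : ℝ} (hl : 0 < l) (x : Sp d) :
    ∀ᶠ y in 𝓝 x, ∀ i, |d / l * y i - d / l * x i| ≤ 1 := by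
  have hd' : (0 : ℝ) < d := by exact_mod_cast hd
  filter_upwards [Metric.closedBall_mem_nhds x (by positivity : 0 < l / d)] with y hy i
  rw [Metric.mem_closedBall, dist_eq_norm] at hy
  have h1 := (abs_coord_le (y - x) i).trans hy
  rw [← mul_sub, abs_mul, abs_of_pos (by positivity), div_mul_eq_mul_div, div_le_one hl]
  rw [PiLp.sub_apply, le_div_iff₀ hd'] at h1
  linarith

/-- Near x the infinite sum is one fixed finite sum, which can be differentiated termwise. The
radius 2 is one unit for moving away from x and one for the support of a tooth. -/
theorem approx_eventuallyEq {d : ℕ} (hd : 1 ≤ d) (n : ℕ) (f : Sp d → ℝ) {l : ℝ} (hl : 0 < l)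
    (x : Sp d) : approx n f l =ᶠ[𝓝 x]
      ∑ k ∈ box (fun i => d / l * x i) 2, cell l k * taylorFn n f (node l k) := by
  filter_upwards [eventually_coord_le hd hl x] with y hy
  rw [approx, Finset.sum_apply]
  refine finsum_eq_sum_of_support_subset _ fun k hk => ?_
  by_contra hkb
  exact hk (by
    change cell l k y * _ = 0
    rw [cell_eq_zero_of_notMem_box (ρ := 2) (fun i => (hy i).trans (by norm_num)) hkb, zero_mul])

/-- Since the cells sum to 1, subtracting g from the patched function subtracts it from every local
piece. -/
theorem approx_sub_eventuallyEq {d : ℕ} (hd : 1 ≤ d) (n : ℕ) (f : Sp d → ℝ) {l : ℝ} (hl : 0 < l)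
    (x : Sp d) (g : Sp d → ℝ) : approx n f l - g =ᶠ[𝓝 x]
      ∑ k ∈ box (fun i => d / l * x i) 2, cell l k * (taylorFn n f (node l k) - g) := by
  filter_upwards [eventually_coord_le hd hl x, approx_eventuallyEq hd n f hl x] with y hy hy'
  have h1 := sum_cell (l := l) (ρ := 2) (t := fun i => d / l * x i) (y := y)
    fun i => (hy i).trans (by norm_num)
  rw [Pi.sub_apply, hy']
  simp only [mul_sub, Finset.sum_sub_distrib, Pi.sub_apply]
  congr 1
  rw [← Finset.sum_mul, Pi.mul_apply, Finset.sum_apply, h1, one_mul]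

theorem contDiff_approx {d : ℕ} (hd : 1 ≤ d) (n : ℕ) (f : Sp d → ℝ) {l : ℝ} (hl : 0 < l) :
    ContDiff ℝ ∞ (approx n f l) := by
  refine contDiff_iff_contDiffAt.mpr fun x => ?_
  refine ContDiffAt.congr_of_eventuallyEq ?_ (approx_eventuallyEq hd n f hl x)
  exact (ContDiff.sum (f := fun k => cell l k * taylorFn n f (node l k)) fun k _ =>
    (contDiff_cell l k).mul (contDiff_taylorFn n f _)).contDiffAt.congr_of_eventuallyEq
    (Eventually.of_forall fun y => Finset.sum_apply _ _ _)

theorem norm_node_sub_le {d : ℕ} (hd : 1 ≤ d) {l : ℝ} (hl : 0 < l) {x : Sp d} {k : Fin d → ℤ}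
    (hk : k ∈ box (fun i => d / l * x i) 2) : ‖node l k - x‖ ≤ 2 * l := by
  have hd' : (0 : ℝ) < d := by exact_mod_cast hd
  refine (norm_le_of_abs_le (c := l / d * 2) fun i => ?_).trans (le_of_eq (by field_simp))
  have h1 := mem_box.mp hk i
  have h3 : (node l k - x) i = l / d * (k i - d / l * x i) := by
    simp only [PiLp.sub_apply, node]
    field_simp
  rw [h3, abs_mul, abs_of_pos (by positivity)]
  gcongr

/-- At each point, the approximation at scale `l` agrees with the Taylor polynomial there up to an
error of order `l ^ β`. -/
theorem exists_scaleBdOn_approx_sub (d r : ℕ) (hd : 1 ≤ d) {β : ℝ} (hβ : 0 < β) :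
    ∃ C : ℝ, 0 ≤ C ∧ ∀ (f : Sp d → ℝ) (Q R : ℝ), 0 ≤ Q → ContDiff ℝ (below β) f →
    PosBound β (ballK d (3 * (R + 2))) Q f → ∀ x ∈ ballK d R, ∀ l : ℝ, 0 < l → l ≤ 1 →
    ScaleBdOn r {x} l (C * Q * l ^ β) (approx (below β) f l - taylorFn (below β) f x) := by
  obtain ⟨C, hC0, hC⟩ := exists_scaleBdOn_cell d r hd
  obtain ⟨C', hC'0, hC'⟩ := exists_scaleBdOn_taylorFn_sub d r hβ
  refine ⟨5 ^ d * (2 ^ r * (C * (C' * 2 ^ β))), by positivity,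
    fun f Q R hQ hf hfQ x hx l hl hl1 => ?_⟩
  have hsum : ScaleBdOn r {x} l (∑ k ∈ box (fun i => d / l * x i) 2,
      2 ^ r * (C * (C' * Q * (2 * l) ^ β)))
      (∑ k ∈ box (fun i => d / l * x i) 2,
        cell l k * (taylorFn (below β) f (node l k) - taylorFn (below β) f x)) := by
    refine ScaleBdOn.sum (fun k _ => (contDiff_cell l k).mul
      ((contDiff_taylorFn _ f _).sub (contDiff_taylorFn _ f _))) fun k hk => ?_
    refine ScaleBdOn.mul (contDiff_cell l k)
      ((contDiff_taylorFn _ f _).sub (contDiff_taylorFn _ f _)) hC0 (by positivity) hl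
      ((hC l hl k).mono_set (subset_univ _)) ?_
    have hn := norm_node_sub_le hd hl hk
    rw [mem_ballK] at hx
    have hnode : node l k ∈ ballK d (R + 2) := by
      rw [mem_ballK]
      calc ‖node l k‖ = ‖x + (node l k - x)‖ := by rw [add_sub_cancel]
        _ ≤ ‖x‖ + ‖node l k - x‖ := norm_add_le _ _
        _ ≤ R + 2 := by linarith
    -- The node is within 2l of x, so the two Taylor polynomials are compared at scale 2l on a ball
    -- around the node that contains x; the bound is then read at scale l.
    refine ((hC' f Q (R + 2) hQ hf hfQ _ hnode x (mem_ballK.mpr (by linarith)) (2 * l)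
      (by positivity) hn).mono_scale (by positivity) hl (by linarith)).mono_set ?_
    rw [singleton_subset_iff, Metric.mem_closedBall, dist_comm, dist_eq_norm]
    exact hn
  intro i hi y hy
  obtain rfl : y = x := hy
  rw [((approx_sub_eventuallyEq hd (below β) f hl y _).iteratedFDeriv ℝ i).eq_of_nhds]
  refine (hsum i hi y rfl).trans ?_
  gcongr
  -- At most 5 ^ d cells meet a neighbourhood of x, whatever l is.
  rw [Finset.sum_const, nsmul_eq_mul, Real.mul_rpow (by norm_num) hl.le]
  have := card_box_le (fun i => d / l * y i) (ρ := 2) (by norm_num)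
  calc _ ≤ (2 * 2 + 1 : ℝ) ^ d * (2 ^ r * (C * (C' * Q * (2 ^ β * l ^ β)))) := by gcongr
    _ = _ := by ring

/-- At each x both approximations are compared with the Taylor polynomial based at that x, which
cancels in the difference. -/
theorem exists_scaleBdOn_approx_sub_half (d r : ℕ) (hd : 1 ≤ d) {β : ℝ} (hβ : 0 < β) :
    ∃ C : ℝ, 0 ≤ C ∧ ∀ (f : Sp d → ℝ) (Q R : ℝ), 0 ≤ Q → ContDiff ℝ (below β) f →
    PosBound β (ballK d (3 * (R + 2))) Q f → ∀ l : ℝ, 0 < l → 2 * l ≤ 1 →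
    ScaleBdOn r (ballK d R) l (C * Q * l ^ β)
      (approx (below β) f l - approx (below β) f (2 * l)) := by
  obtain ⟨C, hC0, hC⟩ := exists_scaleBdOn_approx_sub d r hd hβ
  refine ⟨C + C * 2 ^ β, by positivity, fun f Q R hQ hf hfQ l hl hl1 i hi x hx => ?_⟩
  have hT := contDiff_taylorFn (below β) f x
  have h1 := hC f Q R hQ hf hfQ x hx l hl (by linarith)
  have h2 := (hC f Q R hQ hf hfQ x hx (2 * l) (by positivity) hl1).mono_scale (by positivity) hl
    (by linarith)
  have hA : ∀ l, 0 < l → ContDiff ℝ ∞ (approx (below β) f l - taylorFn (below β) f x) :=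
    fun l hl => (contDiff_approx hd _ f hl).sub hT
  have h3 := h1.sub (hA l hl) (hA (2 * l) (by positivity)) h2
  rw [sub_sub_sub_cancel_right] at h3
  refine (h3.mono_const hl (le_of_eq ?_)) i hi x rfl
  rw [Real.mul_rpow (by norm_num) hl.le]
  ring

/-- At a point y of the ball, compare first with the Taylor polynomial at y, then move its base
point to x. Unlike the basic estimate, this holds on a whole ball with x fixed, as the
reconstruction bound requires. -/
theorem exists_scaleBdOn_approx_sub_taylorFn (d r : ℕ) (hd : 1 ≤ d) {β : ℝ} (hβ : 0 < β) :
    ∃ C : ℝ, 0 ≤ C ∧ ∀ (f : Sp d → ℝ) (Q R : ℝ), 0 ≤ Q → ContDiff ℝ (below β) f →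
    PosBound β (ballK d (3 * (R + 3))) Q f → ∀ x ∈ ballK d R, ∀ l L : ℝ, 0 < l → l ≤ L →
    L ≤ 2 * l → L ≤ 1 → ScaleBdOn r (Metric.closedBall x L) L (C * Q * L ^ β)
      (approx (below β) f l - taylorFn (below β) f x) := by
  obtain ⟨C, hC0, hC⟩ := exists_scaleBdOn_approx_sub d r hd hβ
  obtain ⟨C', hC'0, hC'⟩ := exists_scaleBdOn_taylorFn_sub d r hβ
  refine ⟨2 ^ r * C + C', by positivity,
    fun f Q R hQ hf hfQ x hx l L hl hlL hLl hL1 i hi y hy => ?_⟩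
  have hL : 0 < L := hl.trans_le hlL
  rw [Metric.mem_closedBall, dist_eq_norm] at hy
  rw [mem_ballK] at hx
  have hyR : ‖y‖ ≤ R + 1 := by
    calc ‖y‖ = ‖x + (y - x)‖ := by rw [add_sub_cancel]
      _ ≤ ‖x‖ + ‖y - x‖ := norm_add_le _ _
      _ ≤ R + 1 := by linarith
  have hfQ' : PosBound β (ballK d (3 * (R + 1 + 2))) Q f := by
    have : R + 1 + 2 = R + 3 := by ring
    rwa [this]
  -- L lies between l and 2l: pass up to scale 2l at the cost 2 ^ r, then down to L.
  have h1 := ((hC f Q (R + 1) hQ hf hfQ' y (mem_ballK.mpr hyR) l hl (by linarith)).enlarge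
    (by positivity) hl one_le_two).mono_scale (by positivity) hL hLl
  have h2 := (hC' f Q (R + 3) hQ hf hfQ y (mem_ballK.mpr (by linarith)) x
    (mem_ballK.mpr (by linarith)) L hL hy).mono_set (S' := {y})
    (singleton_subset_iff.mpr (Metric.mem_closedBall_self hL.le))
  have hTx := contDiff_taylorFn (below β) f x
  have hTy := contDiff_taylorFn (below β) f y
  have hA : ContDiff ℝ ∞ (approx (below β) f l - taylorFn (below β) f y) :=
    (contDiff_approx hd _ f hl).sub hTy
  have hB : ContDiff ℝ ∞ (taylorFn (below β) f y - taylorFn (below β) f x) := hTy.sub hTx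
  have h3 := h1.add hA hB h2
  rw [sub_add_sub_cancel] at h3
  refine (h3.mono_const hL ?_) i hi y rfl
  have : l ^ β ≤ L ^ β := by gcongr
  calc 2 ^ r * (C * Q * l ^ β) + C' * Q * L ^ β ≤ 2 ^ r * (C * Q * L ^ β) + C' * Q * L ^ β := by
        gcongr
    _ = _ := by ring

/-- On the unit ball the Taylor polynomial is a sum of n + 1 terms of size at most Q; this controls
its coefficients. -/
theorem exists_scaleBdOn_taylorFn (d r n : ℕ) : ∃ C : ℝ, 0 ≤ C ∧
    ∀ (f : Sp d → ℝ) (Q : ℝ) (x : Sp d), 0 ≤ Q → (∀ i ≤ n, ‖iteratedFDeriv ℝ i f x‖ ≤ Q) →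
    ScaleBdOn r (Metric.closedBall x 1) 1 (C * Q) (taylorFn n f x) := by
  obtain ⟨C, hC0, hC⟩ := exists_coeff_bound d n
  obtain ⟨C', hC'0, hC'⟩ := exists_scaleBdOn_evalAt d n r
  refine ⟨C' * (C * (n + 1)), by positivity, fun f Q x hQ hf => ?_⟩
  have h := hC' (taylor n f x) x 1 (C * ((n + 1) * Q)) one_pos (coeff_taylor_eq_zero f x)
    (hC _ (coeff_taylor_eq_zero f x) 1 _ one_pos fun u hu => ?_)
  · exact h.mono_const one_pos (le_of_eq (by ring))
  · rw [eval_taylor]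
    refine (Finset.abs_sum_le_sum_abs _ _).trans ((Finset.sum_le_card_nsmul _ _ Q ?_).trans ?_)
    · intro j hj
      have h1 := (iteratedFDeriv ℝ j f x).le_opNorm fun _ => u
      rw [Finset.prod_const, Finset.card_univ, Fintype.card_fin] at h1
      have h2 : ‖u‖ ^ j ≤ 1 := pow_le_one₀ (norm_nonneg _) hu
      have h3 : |(j.factorial : ℝ)⁻¹| ≤ 1 := by
        rw [abs_of_nonneg (by positivity)]
        exact inv_le_one_of_one_le₀
          (by exact_mod_cast Nat.one_le_iff_ne_zero.mpr j.factorial_ne_zero)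
      rw [smul_eq_mul, abs_mul]
      refine (mul_le_of_le_one_left (abs_nonneg _) h3).trans (h1.trans ?_)
      exact (mul_le_of_le_one_right (norm_nonneg _) h2).trans
        (hf j (Nat.lt_succ_iff.mp (Finset.mem_range.mp hj)))
    · rw [Finset.card_range, nsmul_eq_mul]
      push_cast
      exact le_rfl

theorem exists_scaleBdOn_approx_one (d r : ℕ) (hd : 1 ≤ d) {β : ℝ} (hβ : 0 < β) :
    ∃ C : ℝ, 0 ≤ C ∧ ∀ (f : Sp d → ℝ) (Q R : ℝ), 0 ≤ Q → 0 ≤ R → ContDiff ℝ (below β) f →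
    PosBound β (ballK d (3 * (R + 2))) Q f →
    ScaleBdOn r (ballK d R) 1 (C * Q) (approx (below β) f 1) := by
  obtain ⟨C, hC0, hC⟩ := exists_scaleBdOn_approx_sub d r hd hβ
  obtain ⟨C', hC'0, hC'⟩ := exists_scaleBdOn_taylorFn d r (below β)
  refine ⟨C + C', by positivity, fun f Q R hQ hR hf hfQ i hi x hx => ?_⟩
  have h1 := hC f Q R hQ hf hfQ x hx 1 one_pos le_rfl
  have hx3 : x ∈ ballK d (3 * (R + 2)) := by
    have := mem_ballK.mp hx
    exact mem_ballK.mpr (by linarith)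
  have h2 := (hC' f Q x hQ fun i hi => hfQ.1 i hi x hx3).mono_set (S' := {x})
    (singleton_subset_iff.mpr (Metric.mem_closedBall_self zero_le_one))
  have hT := contDiff_taylorFn (below β) f x
  have hA : ContDiff ℝ ∞ (approx (below β) f 1 - taylorFn (below β) f x) :=
    (contDiff_approx hd _ f one_pos).sub hT
  have h3 := h1.add hA hT h2
  rw [sub_add_cancel, Real.one_rpow, mul_one, ← add_mul] at h3
  exact h3 i hi x rfl

/-! ### The product as a limit -/

theorem scaleBdOn_mulTest {d r : ℕ} {g : Sp d → ℝ} (hg : ContDiff ℝ ∞ g) {ψ : TestFn d}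
    {S : Set (Sp d)} {l A G : ℝ} (hl : 0 < l) (hA : 0 ≤ A) (hG : 0 ≤ G) (hψS : tsupport ψ ⊆ S)
    (hψ : ScaleBdOn r univ l A ψ) (hgS : ScaleBdOn r S l G g) :
    ScaleBdOn r univ l (2 ^ r * (A * G)) (mulTest g hg ψ) := by
  have h1 : ContDiff ℝ ∞ ψ := ψ.contDiff
  have h2 : ScaleBdOn r S l (2 ^ r * (A * G)) (mulTest g hg ψ) :=
    ScaleBdOn.mul h1 hg hA hG hl (hψ.mono_set (subset_univ _)) hgS
  exact h2.univ_of_tsupport (by positivity) hl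
    ((tsupport_mulTest_subset g hg ψ).trans (inter_subset_left.trans hψS))

/-- Testing `g ξ`, with `g` smooth and of size `G` at scale `l`. -/
theorem exists_abs_mulTest_le (d r : ℕ) (hd : 1 ≤ d) : ∃ C : ℝ, 0 ≤ C ∧
    ∀ (α : ℝ) (ξ : Dist d) (P R : ℝ), NegBound α r (ballK d (R + 1)) P ξ →
    ∀ (g : Sp d → ℝ) (hg : ContDiff ℝ ∞ g) (x : Sp d) (l lam A G : ℝ), 0 < l → l ≤ 1 → l ≤ lam →
    ‖x‖ + lam ≤ R → 0 ≤ A → 0 ≤ G → ScaleBdOn r (Metric.closedBall x lam) l G g →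
    ∀ ψ : TestFn d, tsupport ψ ⊆ Metric.closedBall x lam → ScaleBdOn r univ l A ψ →
      |ξ (mulTest g hg ψ)| ≤ C * (A * G) * lam ^ d * (P * l ^ (-α)) := by
  obtain ⟨C, hC0, hC⟩ := exists_abs_apply_le d r hd
  refine ⟨C * 2 ^ r, by positivity, ?_⟩
  intro α ξ P R hξ g hg x l lam A G hl hl1 hlam hR hA hG hgS ψ hψS hψ
  refine (hC ξ x l lam (P * l ^ (-α)) (2 ^ r * (A * G)) hl hlam (by positivity) ?_ _ ?_
    (scaleBdOn_mulTest hg hl hA hG hψS hψ hgS)).trans (le_of_eq (by ring))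
  · intro φ hφ z hz
    refine hξ φ hφ z (mem_ballK.mpr ?_) l hl hl1
    rw [Metric.mem_closedBall, dist_eq_norm] at hz
    calc ‖z‖ = ‖x + (z - x)‖ := by rw [add_sub_cancel]
      _ ≤ ‖x‖ + ‖z - x‖ := norm_add_le _ _
      _ ≤ R + 1 := by linarith
  · exact (tsupport_mulTest_subset g hg ψ).trans (inter_subset_left.trans hψS)

/-- The product of `ξ` with the approximation of `f` at scale `2⁻ᵐ`, tested against `ψ`. -/
def approxPairing {d : ℕ} (hd : 1 ≤ d) (n : ℕ) (ξ : Dist d) (f : Sp d → ℝ) (ψ : TestFn d)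
    (m : ℕ) : ℝ :=
  ξ (mulTest (approx n f ((1 / 2) ^ m)) (contDiff_approx hd n f (by positivity)) ψ)

theorem mulTest_sub {d : ℕ} {g h : Sp d → ℝ} (hg : ContDiff ℝ ∞ g) (hh : ContDiff ℝ ∞ h)
    (hgh : ContDiff ℝ ∞ (g - h)) (ψ : TestFn d) :
    mulTest (g - h) hgh ψ = mulTest g hg ψ - mulTest h hh ψ := by
  ext y
  change ψ y * (g y - h y) = ψ y * g y - ψ y * h y
  ring

theorem mem_ballK_of_mem_closedBall {d : ℕ} {x y : Sp d} {lam R : ℝ} (hR : ‖x‖ + lam ≤ R)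
    (hy : y ∈ Metric.closedBall x lam) : y ∈ ballK d R := by
  rw [Metric.mem_closedBall, dist_eq_norm] at hy
  rw [mem_ballK]
  calc ‖y‖ = ‖x + (y - x)‖ := by rw [add_sub_cancel]
    _ ≤ ‖x‖ + ‖y - x‖ := norm_add_le _ _
    _ ≤ R := by linarith

/-- With l = 2^{-(m+1)}, the smooth factor changes by O(l ^ β) at scale l and ξ costs l ^ (-α);
cutting ψ into cells contributes the volume of its ball. -/
theorem exists_approxPairing_sub_le (d r : ℕ) (hd : 1 ≤ d) (α : ℝ) {β : ℝ} (hβ : 0 < β) :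
    ∃ C : ℝ, 0 ≤ C ∧ ∀ (ξ : Dist d) (f : Sp d → ℝ) (P Q R : ℝ), 0 ≤ Q →
    ContDiff ℝ (below β) f → NegBound α r (ballK d (R + 1)) P ξ →
    PosBound β (ballK d (3 * (R + 2))) Q f → ∀ (x : Sp d) (lam A : ℝ) (m : ℕ),
    (1 / 2) ^ (m + 1) ≤ lam → ‖x‖ + lam ≤ R → 0 ≤ A → ∀ ψ : TestFn d,
    tsupport ψ ⊆ Metric.closedBall x lam → ScaleBdOn r univ ((1 / 2) ^ (m + 1)) A ψ →
    |approxPairing hd (below β) ξ f ψ (m + 1) - approxPairing hd (below β) ξ f ψ m| ≤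
      C * (A * Q * P) * lam ^ d * ((1 / 2) ^ (m + 1)) ^ (β - α) := by
  obtain ⟨C, hC0, hC⟩ := exists_abs_mulTest_le d r hd
  obtain ⟨C', hC'0, hC'⟩ := exists_scaleBdOn_approx_sub_half d r hd hβ
  refine ⟨C * C', by positivity, ?_⟩
  intro ξ f P Q R hQ hf hξ hfQ x lam A m hlam hR hA ψ hψS hψ
  set l : ℝ := (1 / 2) ^ (m + 1) with hl_def
  have hl : 0 < l := by positivity
  have h2l : 2 * l = (1 / 2) ^ m := by
    rw [hl_def, pow_succ]
    ring
  have h2l1 : 2 * l ≤ 1 := by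
    rw [h2l]
    exact pow_le_one₀ (by norm_num) (by norm_num)
  have hg := (hC' f Q R hQ hf hfQ l hl h2l1).mono_set fun y hy => mem_ballK_of_mem_closedBall hR hy
  have hcd : ContDiff ℝ ∞ (approx (below β) f l - approx (below β) f (2 * l)) :=
    (contDiff_approx hd _ f hl).sub (contDiff_approx hd _ f (by positivity))
  have h := hC α ξ P R hξ _ hcd x l lam A _ hl (by linarith) hlam hR hA (by positivity) hg ψ hψS hψ
  rw [mulTest_sub (contDiff_approx hd _ f hl) (contDiff_approx hd _ f (by positivity)),
    map_sub] at h
  have h3 : approxPairing hd (below β) ξ f ψ m =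
      ξ (mulTest (approx (below β) f (2 * l)) (contDiff_approx hd _ f (by positivity)) ψ) := by
    simp only [h2l]
    rfl
  rw [h3]
  refine h.trans (le_of_eq ?_)
  rw [sub_eq_add_neg, Real.rpow_add hl]
  ring

theorem exists_abs_approxPairing_zero_le (d r : ℕ) (hd : 1 ≤ d) (α : ℝ) {β : ℝ} (hβ : 0 < β) :
    ∃ C : ℝ, 0 ≤ C ∧ ∀ (ξ : Dist d) (f : Sp d → ℝ) (P Q R : ℝ), 0 ≤ Q → 1 ≤ R →
    ContDiff ℝ (below β) f → NegBound α r (ballK d (R + 1)) P ξ →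
    PosBound β (ballK d (3 * (R + 2))) Q f → ∀ A : ℝ, 0 ≤ A → ∀ ψ : TestFn d,
    tsupport ψ ⊆ Metric.closedBall 0 R → ScaleBdOn r univ 1 A ψ →
    |approxPairing hd (below β) ξ f ψ 0| ≤ C * (A * Q * P) * R ^ d := by
  obtain ⟨C, hC0, hC⟩ := exists_abs_mulTest_le d r hd
  obtain ⟨C', hC'0, hC'⟩ := exists_scaleBdOn_approx_one d r hd hβ
  refine ⟨C * C', by positivity, ?_⟩
  intro ξ f P Q R hQ hR hf hξ hfQ A hA ψ hψS hψ
  have h := hC α ξ P R hξ _ (contDiff_approx hd (below β) f one_pos) 0 1 R A _ one_pos le_rfl hR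
    (by simp) hA (by positivity) (hC' f Q R hQ (by linarith) hf hfQ) ψ hψS hψ
  have h3 : approxPairing hd (below β) ξ f ψ 0 =
      ξ (mulTest (approx (below β) f 1) (contDiff_approx hd _ f one_pos) ψ) := by
    simp only [approxPairing, pow_zero]
  rw [h3]
  refine h.trans (le_of_eq ?_)
  rw [Real.one_rpow]
  ring

theorem half_rpow_lt_one {γ : ℝ} (hγ : 0 < γ) : (1 / 2 : ℝ) ^ γ < 1 :=
  Real.rpow_lt_one (by norm_num) (by norm_num) hγ

theorem half_pow_rpow (m : ℕ) (γ : ℝ) : ((1 / 2 : ℝ) ^ m) ^ γ = ((1 / 2 : ℝ) ^ γ) ^ m :=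
  (Real.rpow_pow_comm (by norm_num) γ m).symm

/-- The pairings converge geometrically, from any scale below which `ψ` is smooth. -/
theorem exists_approxPairing_tail_le (d r : ℕ) (hd : 1 ≤ d) {α β : ℝ} (hβ : 0 < β) (hαβ : α < β) :
    ∃ C : ℝ, 0 ≤ C ∧ ∀ (ξ : Dist d) (f : Sp d → ℝ) (P Q R : ℝ), 0 ≤ Q → 0 ≤ P →
    ContDiff ℝ (below β) f → NegBound α r (ballK d (R + 1)) P ξ →
    PosBound β (ballK d (3 * (R + 2))) Q f → ∀ (x : Sp d) (lam A : ℝ) (n : ℕ),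
    (1 / 2) ^ n ≤ lam → ‖x‖ + lam ≤ R → 0 ≤ A → ∀ ψ : TestFn d,
    tsupport ψ ⊆ Metric.closedBall x lam → ScaleBdOn r univ ((1 / 2) ^ n) A ψ →
    CauchySeq (approxPairing hd (below β) ξ f ψ) ∧
    ∀ v, Tendsto (approxPairing hd (below β) ξ f ψ) atTop (𝓝 v) →
      |approxPairing hd (below β) ξ f ψ n - v| ≤
        C * (A * Q * P) * lam ^ d * ((1 / 2) ^ n) ^ (β - α) := by
  obtain ⟨C, hC0, hC⟩ := exists_approxPairing_sub_le d r hd α hβ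
  have hγ : 0 < β - α := by linarith
  set q : ℝ := (1 / 2 : ℝ) ^ (β - α) with hq_def
  have hq0 : 0 < q := by positivity
  -- The only use of α < β in the convergence: the increments decay geometrically.
  have hq : q < 1 := half_rpow_lt_one hγ
  have hq1 : 0 < 1 - q := by linarith
  refine ⟨C * (1 - q)⁻¹, by positivity, ?_⟩
  intro ξ f P Q R hQ hP hf hξ hfQ x lam A n hlam hR hA ψ hψS hψ
  have hlam0 : 0 ≤ lam := le_trans (by positivity) hlam
  set a := approxPairing hd (below β) ξ f ψ
  -- The sequence is started at n because ψ is assumed regular only at scale 2⁻ⁿ, hence also at all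
  -- finer scales.
  have hdist : ∀ m, dist (a (m + n)) (a (m + 1 + n)) ≤ C * (A * Q * P) * lam ^ d * q ^ n * q ^ m := by
    intro m
    have hle : (1 / 2 : ℝ) ^ (m + n + 1) ≤ (1 / 2) ^ n :=
      pow_le_pow_of_le_one (by norm_num) (by norm_num) (by omega)
    have h := hC ξ f P Q R hQ hf hξ hfQ x lam A (m + n) (hle.trans hlam) hR hA ψ hψS
      (hψ.mono_scale hA (by positivity) hle)
    rw [half_pow_rpow] at h
    rw [dist_comm, Real.dist_eq, show m + 1 + n = m + n + 1 by ring]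
    refine h.trans ?_
    have hqq : q ^ (m + n + 1) ≤ q ^ n * q ^ m := by
      rw [← pow_add]
      exact pow_le_pow_of_le_one hq0.le hq.le (by omega)
    calc _ ≤ C * (A * Q * P) * lam ^ d * (q ^ n * q ^ m) := by gcongr
      _ = _ := by ring
  refine ⟨(cauchySeq_shift n).mp (cauchySeq_of_le_geometric q _ hq hdist), fun v hv => ?_⟩
  have h := dist_le_of_le_geometric_of_tendsto₀ q _ hq hdist ((tendsto_add_atTop_iff_nat n).mpr hv)
  rw [Real.dist_eq, zero_add] at h
  rw [half_pow_rpow]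
  refine h.trans (le_of_eq ?_)
  rw [div_eq_mul_inv]
  ring

theorem exists_scaleBdOn_testFn {d : ℕ} (r : ℕ) (ψ : TestFn d) :
    ∃ A : ℝ, 0 ≤ A ∧ ScaleBdOn r univ 1 A ψ := by
  have hcd : ContDiff ℝ ∞ ψ := ψ.contDiff
  have h : ∀ i : ℕ, ∃ C : ℝ, ∀ y : Sp d, ‖iteratedFDeriv ℝ i ψ y‖ ≤ C := fun i =>
    (hcd.continuous_iteratedFDeriv (m := i)
      (by exact_mod_cast le_top)).bounded_above_of_compact_support
      (ψ.hasCompactSupport.iteratedFDeriv i)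
  choose C hC using h
  refine ⟨∑ i ∈ Finset.range (r + 1), |C i|, Finset.sum_nonneg fun i _ => abs_nonneg _,
    fun i hi y _ => (hC i y).trans ((le_abs_self _).trans ?_)⟩
  rw [one_pow, div_one]
  exact Finset.single_le_sum (f := fun i => |C i|) (fun i _ => abs_nonneg _)
    (Finset.mem_range.mpr (Nat.lt_succ_of_le hi))

theorem exists_tsupport_subset_closedBall {d : ℕ} (ψ : TestFn d) :
    ∃ R : ℝ, 1 ≤ R ∧ tsupport ψ ⊆ Metric.closedBall 0 R := by
  obtain ⟨R, hR⟩ := (IsCompact.isBounded ψ.hasCompactSupport).exists_norm_le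
  exact ⟨max R 1, le_max_right _ _, fun x hx =>
    mem_closedBall_zero_iff.mpr ((hR x hx).trans (le_max_left _ _))⟩

/-! ### Existence of the limit, and its continuity on test functions -/

section Limit

variable {d r : ℕ} {α β : ℝ}

theorem cauchySeq_approxPairing (hd : 1 ≤ d) (hβ : 0 < β) (hαβ : α < β) (ξ : HolderNeg d α r)
    (f : HolderPos d β) (ψ : TestFn d) :
    CauchySeq (approxPairing hd (below β) ξ.toDist f.toFun ψ) := by
  obtain ⟨C, -, hC⟩ := exists_approxPairing_tail_le d r hd hβ hαβ
  obtain ⟨R, hR, hψS⟩ := exists_tsupport_subset_closedBall ψ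
  obtain ⟨A, hA, hψ⟩ := exists_scaleBdOn_testFn r ψ
  obtain ⟨P, hP, hξ⟩ := ξ.2 (ballK d (R + 1))
  obtain ⟨Q, hQ, hf⟩ := f.2.2 (ballK d (3 * (R + 2)))
  exact (hC ξ.toDist f.toFun P Q R hQ hP f.2.1 hξ hf 0 R A 0 (by simpa using hR) (by simp) hA ψ hψS
    (by simpa using hψ)).1

/-- The limit of the products of `ξ` with the smooth approximations of `f`. -/
def limitPairing (hd : 1 ≤ d) (ξ : HolderNeg d α r) (f : HolderPos d β) (ψ : TestFn d) : ℝ :=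
  limUnder atTop (approxPairing hd (below β) ξ.toDist f.toFun ψ)

theorem tendsto_limitPairing (hd : 1 ≤ d) (hβ : 0 < β) (hαβ : α < β) (ξ : HolderNeg d α r)
    (f : HolderPos d β) (ψ : TestFn d) :
    Tendsto (approxPairing hd (below β) ξ.toDist f.toFun ψ) atTop (𝓝 (limitPairing hd ξ f ψ)) :=
  tendsto_nhds_limUnder (cauchySeq_tendsto_of_complete (cauchySeq_approxPairing hd hβ hαβ ξ f ψ))

/-- The pairing at scale 1 plus the tail from n = 0. Linearity in each of A, P and Q is what later
gives joint continuity. -/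
theorem exists_abs_limitPairing_le (d r : ℕ) (hd : 1 ≤ d) {α β : ℝ} (hβ : 0 < β) (hαβ : α < β) :
    ∃ C : ℝ, 0 ≤ C ∧ ∀ (ξ : HolderNeg d α r) (f : HolderPos d β) (P Q R : ℝ), 0 ≤ Q → 0 ≤ P →
    1 ≤ R → NegBound α r (ballK d (R + 1)) P ξ.toDist →
    PosBound β (ballK d (3 * (R + 2))) Q f.toFun → ∀ A : ℝ, 0 ≤ A → ∀ ψ : TestFn d,
    tsupport ψ ⊆ Metric.closedBall 0 R → ScaleBdOn r univ 1 A ψ →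
    |limitPairing hd ξ f ψ| ≤ C * (A * Q * P) * R ^ d := by
  obtain ⟨C, hC0, hC⟩ := exists_approxPairing_tail_le d r hd hβ hαβ
  obtain ⟨C', hC'0, hC'⟩ := exists_abs_approxPairing_zero_le d r hd α hβ
  refine ⟨C + C', by positivity, fun ξ f P Q R hQ hP hR hξ hf A hA ψ hψS hψ => ?_⟩
  have h1 := (hC ξ.toDist f.toFun P Q R hQ hP f.2.1 hξ hf 0 R A 0 (by simpa using hR) (by simp) hA
    ψ hψS (by simpa using hψ)).2 _ (tendsto_limitPairing hd hβ hαβ ξ f ψ)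
  have h2 := hC' ξ.toDist f.toFun P Q R hQ hR f.2.1 hξ hf A hA ψ hψS hψ
  rw [pow_zero, Real.one_rpow, mul_one] at h1
  rw [abs_sub_comm] at h1
  calc _ = |(limitPairing hd ξ f ψ - approxPairing hd (below β) ξ.toDist f.toFun ψ 0) +
        approxPairing hd (below β) ξ.toDist f.toFun ψ 0| := by rw [sub_add_cancel]
    _ ≤ _ := abs_add_le _ _
    _ ≤ _ := add_le_add h1 h2
    _ = _ := by ring

theorem norm_iteratedFDeriv_le_sup {K : Compacts (Sp d)} (φ : 𝓓^{⊤}_{K}(Sp d, ℝ)) {i : ℕ}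
    (hi : i ≤ r) (y : Sp d) : ‖iteratedFDeriv ℝ i φ y‖ ≤
      ((Finset.range (r + 1)).sup fun i => ContDiffMapSupportedIn.seminorm ℝ (Sp d) ℝ ⊤ K i) φ :=
  (ContDiffMapSupportedIn.norm_iteratedFDeriv_apply_le_seminorm_top ℝ).trans
    (Seminorm.le_finset_sup_apply (Finset.mem_range.mpr (Nat.lt_succ_of_le hi)))

/-- A linear map bounded by finitely many derivatives, on each ball, is continuous. -/
theorem continuous_of_forall_ball_bound {V : Type*} [NormedAddCommGroup V] [NormedSpace ℝ V]
    (r : ℕ) (T : TestFn d →ₗ[ℝ] V)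
    (hT : ∀ R : ℝ, 1 ≤ R → ∃ C : ℝ, 0 ≤ C ∧ ∀ A : ℝ, 0 ≤ A → ∀ ψ : TestFn d,
      tsupport ψ ⊆ Metric.closedBall 0 R → ScaleBdOn r univ 1 A ψ → ‖T ψ‖ ≤ C * A) :
    Continuous T := by
  refine (TestFunction.continuous_iff_continuous_comp T).mpr fun K hK => ?_
  obtain ⟨R, -, hKR⟩ := exists_subset_ballK K
  obtain ⟨C, hC0, hC⟩ := hT (max R 1) (le_max_right _ _)
  refine (ContDiffMapSupportedIn.mkCLMtoNormedSpace (𝕜 := ℝ)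
    (fun φ => T (TestFunction.ofSupportedIn hK φ)) (fun φ ψ => T.map_add
      (TestFunction.ofSupportedIn hK φ) (TestFunction.ofSupportedIn hK ψ))
    (fun c φ => T.map_smul c (TestFunction.ofSupportedIn hK φ)) ⟨Finset.range (r + 1), C, hC0, fun φ => ?_⟩).continuous
  refine hC _ (apply_nonneg _ _) _ ?_ fun i hi y _ => ?_
  · refine φ.tsupport_subset.trans fun x hx => ?_
    exact mem_closedBall_zero_iff.mpr ((mem_ballK.mp (hKR x hx)).trans (le_max_left _ _))
  · rw [one_pow, div_one]
    exact norm_iteratedFDeriv_le_sup φ hi y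

/-- The limit pairing as a linear map. -/
def limitPairingLM (hd : 1 ≤ d) (hβ : 0 < β) (hαβ : α < β) (ξ : HolderNeg d α r)
    (f : HolderPos d β) : TestFn d →ₗ[ℝ] ℝ where
  toFun := limitPairing hd ξ f
  map_add' φ ψ := by
    refine Tendsto.limUnder_eq (((tendsto_limitPairing hd hβ hαβ ξ f φ).add
      (tendsto_limitPairing hd hβ hαβ ξ f ψ)).congr fun m => ?_)
    simp only [approxPairing, map_add]
  map_smul' c φ := by
    refine Tendsto.limUnder_eq
      (((tendsto_limitPairing hd hβ hαβ ξ f φ).const_mul c).congr fun m => ?_)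
    simp only [approxPairing, map_smul, smul_eq_mul]

/-- The product of `ξ ∈ 𝒞^{-α}` and `f ∈ 𝒞^β`. -/
def product (hd : 1 ≤ d) (hβ : 0 < β) (hαβ : α < β) (ξ : HolderNeg d α r) (f : HolderPos d β) :
    Dist d where
  toLinearMap := limitPairingLM hd hβ hαβ ξ f
  cont := by
    refine continuous_of_forall_ball_bound r _ fun R hR => ?_
    obtain ⟨C, hC0, hC⟩ := exists_abs_limitPairing_le d r hd hβ hαβ
    obtain ⟨P, hP, hξ⟩ := ξ.2 (ballK d (R + 1))
    obtain ⟨Q, hQ, hf⟩ := f.2.2 (ballK d (3 * (R + 2)))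
    refine ⟨C * (Q * P) * R ^ d, by positivity, fun A hA ψ hψS hψ => ?_⟩
    exact (hC ξ f P Q R hQ hP hR hξ hf A hA ψ hψS hψ).trans (le_of_eq (by ring))

/-! ### Reconstruction -/

theorem smoothMul_apply {g : Sp d → ℝ} (hg : ContDiff ℝ ∞ g) (ξ : Dist d) (ψ : TestFn d) :
    smoothMul g hg ξ ψ = ξ (mulTest g hg ψ) := rfl

theorem xiPi_xiLift_apply (α : ℝ) (ξ : Dist d) (f : HolderPos d β) (x : Sp d) (ψ : TestFn d) :
    xiPi α ξ x (xiLift α f x) ψ =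
      ξ (mulTest (taylorFn (below β) f.toFun x) (contDiff_taylorFn _ _ x) ψ) := by
  have h1 : toPoly d α (xiLift α f x) = (0, taylor (below β) f.toFun x) := by
    simp [xiLift]
  change polyPi ξ x (toPoly d α (xiLift α f x)) ψ = _
  rw [h1]
  change ofContinuous _ ψ + ξ (mulTest _ _ ψ) = _
  rw [ofContinuous_apply]
  simp only [evalAt_zero]
  simp
  rfl

/-- The error splits as (ξ f - ξ f_s) + ξ (f_s - T_x f), with s a dyadic scale comparable to l: a
geometric tail, and a smooth factor of size l ^ β near x. -/
theorem isReconstruction_product (hd : 1 ≤ d) (hβ : 0 < β) (hαβ : α < β) (ξ : HolderNeg d α r)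
    (f : HolderPos d β) :
    IsReconstruction (xiStructure d α) r (xiPi α ξ.toDist) (β - α) (xiLift α f)
      (product hd hβ hαβ ξ f) := by
  intro K
  obtain ⟨R, hR0, hKR⟩ := exists_subset_ballK K
  obtain ⟨C, hC0, hC⟩ := exists_approxPairing_tail_le d r hd hβ hαβ
  obtain ⟨C₁, hC₁0, hC₁⟩ := exists_abs_mulTest_le d r hd
  obtain ⟨C₂, hC₂0, hC₂⟩ := exists_scaleBdOn_approx_sub_taylorFn d r hd hβ
  obtain ⟨P, hP, hξ⟩ := ξ.2 (ballK d (R + 1 + 1))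
  obtain ⟨Q, hQ, hf⟩ := f.2.2 (ballK d (3 * (R + 1 + 2)))
  have hf' : PosBound β (ballK d (3 * (R + 3))) Q f.toFun := by
    have : R + 1 + 2 = R + 3 := by ring
    rwa [← this]
  refine ⟨C * (Q * P) + C₁ * (C₂ * Q) * P, fun φ hφ x hx l hl hl1 => ?_⟩
  have hxR := mem_ballK.mp (hKR x hx)
  -- The dyadic scale s with s < l ≤ 2s.
  obtain ⟨n, hn1, hn2⟩ := exists_nat_pow_near_of_lt_one hl hl1 (by norm_num : (0 : ℝ) < 1 / 2)
    (by norm_num)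
  set s : ℝ := (1 / 2) ^ (n + 1) with hs
  have hs0 : 0 < s := by positivity
  have hl2 : l ≤ 2 * s := by
    rw [hs, pow_succ]
    linarith
  set ψ := scaled φ x l hl
  have hψS : tsupport ψ ⊆ Metric.closedBall x l := tsupport_scaled hφ x hl
  have hψ : ScaleBdOn r univ l (l ^ d)⁻¹ ψ := scaleBdOn_scaled hφ x hl
  -- The height of the rescaled test function cancels the volume of its support.
  have hld : (l ^ d)⁻¹ * l ^ d = 1 := inv_mul_cancel₀ (by positivity)
  have h1 := (hC ξ.toDist f.toFun P Q (R + 1) hQ hP f.2.1 hξ hf x l (l ^ d)⁻¹ (n + 1) hn1.le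
    (by linarith) (by positivity) ψ hψS (hψ.mono_scale (by positivity) hs0 hn1.le)).2 _
    (tendsto_limitPairing hd hβ hαβ ξ f ψ)
  have hg := hC₂ f.toFun Q R hQ f.2.1 hf' x (hKR x hx) s l hs0 hn1.le hl2 hl1
  have hcd : ContDiff ℝ ∞ (approx (below β) f.toFun s - taylorFn (below β) f.toFun x) :=
    (contDiff_approx hd _ _ hs0).sub (contDiff_taylorFn _ _ _)
  have h2 := hC₁ α ξ.toDist P (R + 1) hξ _ hcd x l l (l ^ d)⁻¹ _ hl hl1 le_rfl (by linarith)
    (by positivity) (by positivity) hg ψ hψS hψ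
  rw [mulTest_sub (contDiff_approx hd _ _ hs0) (contDiff_taylorFn _ _ _), map_sub] at h2
  have h3 : (product hd hβ hαβ ξ f - xiPi α ξ.toDist x (xiLift α f x)) ψ =
      limitPairing hd ξ f ψ -
        ξ.toDist (mulTest (taylorFn (below β) f.toFun x) (contDiff_taylorFn _ _ x) ψ) := by
    rw [← xiPi_xiLift_apply]
    rfl
  rw [h3]
  have h4 : s ^ (β - α) ≤ l ^ (β - α) := by
    have : 0 < β - α := by linarith
    gcongr
  have h1' : |limitPairing hd ξ f ψ - approxPairing hd (below β) ξ.toDist f.toFun ψ (n + 1)| ≤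
      C * (Q * P) * l ^ (β - α) := by
    rw [abs_sub_comm]
    refine h1.trans ?_
    calc _ = C * (Q * P) * ((l ^ d)⁻¹ * l ^ d) * s ^ (β - α) := by ring
      _ ≤ C * (Q * P) * l ^ (β - α) := by
        rw [hld, mul_one]
        gcongr
  have h2' : |approxPairing hd (below β) ξ.toDist f.toFun ψ (n + 1) -
      ξ.toDist (mulTest (taylorFn (below β) f.toFun x) (contDiff_taylorFn _ _ x) ψ)| ≤
      C₁ * (C₂ * Q) * P * l ^ (β - α) := by
    refine h2.trans (le_of_eq ?_)
    rw [sub_eq_add_neg β α, Real.rpow_add hl]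
    calc _ = C₁ * (C₂ * Q) * P * (l ^ β * l ^ (-α)) * ((l ^ d)⁻¹ * l ^ d) := by ring
      _ = _ := by rw [hld, mul_one]
  calc _ ≤ _ := abs_sub_le _ (approxPairing hd (below β) ξ.toDist f.toFun ψ (n + 1)) _
    _ ≤ _ := add_le_add h1' h2'
    _ = _ := by ring

/-- A distribution which is of positive order on rescaled tests, locally uniformly, vanishes. -/
theorem eq_zero_of_forall_scaled_le (hd : 1 ≤ d) {γ : ℝ} (hγ : 0 < γ) {η : Dist d}
    (h : ∀ K : Compacts (Sp d), ∃ C : ℝ, ∀ φ ∈ unitTests d r, ∀ x ∈ K, ∀ (l : ℝ) (hl : 0 < l),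
      l ≤ 1 → |η (scaled φ x l hl)| ≤ C * l ^ γ) : η = 0 := by
  refine DFunLike.ext _ _ fun ψ => ?_
  obtain ⟨C₀, hC₀0, hC₀⟩ := exists_abs_apply_le d r hd
  obtain ⟨R, hR, hψS⟩ := exists_tsupport_subset_closedBall ψ
  obtain ⟨A, hA, hψ⟩ := exists_scaleBdOn_testFn r ψ
  obtain ⟨C, hC⟩ := h (ballK d (R + 1))
  -- ψ stays fixed while it is cut into cells of scale 2⁻ᵐ: total volume stays of order R ^ d, so
  -- only the factor 2^{-mγ} depends on m.
  have hbd : ∀ m : ℕ, |η ψ| ≤ C₀ * A * R ^ d * C * ((1 / 2 : ℝ) ^ γ) ^ m := by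
    intro m
    have hm0 : (0 : ℝ) < (1 / 2) ^ m := by positivity
    have hm : (1 / 2 : ℝ) ^ m ≤ 1 := pow_le_one₀ (by norm_num) (by norm_num)
    refine (hC₀ η 0 ((1 / 2) ^ m) R (C * ((1 / 2) ^ m) ^ γ) A hm0 (hm.trans hR) hA
      (fun φ hφ z hz => hC φ hφ z ?_ _ hm0 hm) ψ hψS (hψ.mono_scale hA hm0 hm)).trans (le_of_eq ?_)
    · rw [mem_closedBall_zero_iff] at hz
      exact mem_ballK.mpr (by linarith)
    · rw [half_pow_rpow]
      ring
  have hlim : Tendsto (fun m : ℕ => C₀ * A * R ^ d * C * ((1 / 2 : ℝ) ^ γ) ^ m) atTop (𝓝 0) := by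
    simpa using (tendsto_pow_atTop_nhds_zero_of_lt_one (by positivity)
      (half_rpow_lt_one hγ)).const_mul (C₀ * A * R ^ d * C)
  exact abs_nonpos_iff.mp (ge_of_tendsto' hlim hbd)

/-- The local expansion cancels in the difference, which is then O(l ^ γ) with γ > 0. -/
theorem IsReconstruction.unique (hd : 1 ≤ d) {S : RegularityStructure} {γ : ℝ} (hγ : 0 < γ)
    {P : Sp d → S.T →ₗ[ℝ] Dist d} {F : Sp d → S.T} {η ζ : Dist d}
    (hη : IsReconstruction S r P γ F η) (hζ : IsReconstruction S r P γ F ζ) : η = ζ := by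
  refine sub_eq_zero.mp (eq_zero_of_forall_scaled_le (r := r) hd hγ fun K => ?_)
  obtain ⟨C, hC⟩ := hη K
  obtain ⟨D, hD⟩ := hζ K
  refine ⟨C + D, fun φ hφ x hx l hl hl1 => ?_⟩
  have h1 : (η - ζ) (scaled φ x l hl) =
      (η - P x (F x)) (scaled φ x l hl) - (ζ - P x (F x)) (scaled φ x l hl) := by
    change η _ - ζ _ = (η _ - P x (F x) _) - (ζ _ - P x (F x) _)
    ring
  rw [h1, add_mul]
  exact (abs_sub _ _).trans (add_le_add (hC φ hφ x hx l hl hl1) (hD φ hφ x hx l hl hl1))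

theorem isReconstruction_iff (hd : 1 ≤ d) (hβ : 0 < β) (hαβ : α < β) (ξ : HolderNeg d α r)
    (f : HolderPos d β) (η : Dist d) :
    IsReconstruction (xiStructure d α) r (xiPi α ξ.toDist) (β - α) (xiLift α f) η ↔
      η = product hd hβ hαβ ξ f := by
  constructor
  · exact fun h => h.unique hd (by linarith) (isReconstruction_product hd hβ hαβ ξ f)
  · rintro rfl
    exact isReconstruction_product hd hβ hαβ ξ f

end Limit

/-! ### Compact sets of test functions -/

section Compact

variable {d : ℕ}

/-- A family of functionals bounded by finitely many derivatives, uniformly on each ball, is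
uniformly bounded on compact sets of test functions. -/
theorem exists_bound_of_isCompact {ι : Type*} (r : ℕ) (T : ι → TestFn d →ₗ[ℝ] ℝ)
    (hT : ∀ R : ℝ, 1 ≤ R → ∃ C : ℝ, 0 ≤ C ∧ ∀ A : ℝ, 0 ≤ A → ∀ ψ : TestFn d,
      tsupport ψ ⊆ Metric.closedBall 0 R → ScaleBdOn r univ 1 A ψ → ∀ m, |T m ψ| ≤ C * A)
    {S : Set (TestFn d)} (hS : IsCompact S) : ∃ B : ℝ, ∀ ψ ∈ S, ∀ m, |T m ψ| ≤ B := by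
  -- With the discrete topology every bounded family is a bounded continuous function, so the
  -- functionals assemble into one map into a normed space. That map is continuous, hence bounded on
  -- S.
  let _ : TopologicalSpace ι := ⊥
  have _ : DiscreteTopology ι := ⟨rfl⟩
  have hbd : ∀ ψ : TestFn d, ∃ B : ℝ, ∀ m, ‖T m ψ‖ ≤ B := by
    intro ψ
    obtain ⟨R, hR, hψS⟩ := exists_tsupport_subset_closedBall ψ
    obtain ⟨A, hA, hψ⟩ := exists_scaleBdOn_testFn r ψ
    obtain ⟨C, -, hC⟩ := hT R hR
    exact ⟨C * A, hC A hA ψ hψS hψ⟩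
  choose B hB using hbd
  let F : TestFn d →ₗ[ℝ] ι →ᵇ ℝ :=
    { toFun := fun ψ =>
        BoundedContinuousFunction.ofNormedAddCommGroupDiscrete (fun m => T m ψ) (B ψ) (hB ψ)
      map_add' := fun φ ψ => BoundedContinuousFunction.ext fun m => (T m).map_add φ ψ
      map_smul' := fun a φ => BoundedContinuousFunction.ext fun m => (T m).map_smul a φ }
  have hF : Continuous F := by
    refine continuous_of_forall_ball_bound r F fun R hR => ?_
    obtain ⟨C, hC0, hC⟩ := hT R hR
    refine ⟨C, hC0, fun A hA ψ hψS hψ => ?_⟩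
    exact (BoundedContinuousFunction.norm_le (by positivity)).mpr fun m => hC A hA ψ hψS hψ m
  obtain ⟨D, hD⟩ := (hS.image hF).isBounded.exists_norm_le
  exact ⟨D, fun ψ hψ m => (BoundedContinuousFunction.norm_coe_le_norm (F ψ) m).trans
    (hD _ (mem_image_of_mem _ hψ))⟩

/-- The value of the `i`-th derivative at a point, normalised, as a functional. -/
def derivAt (i : ℕ) (p : Sp d × (Fin i → Sp d)) : TestFn d →ₗ[ℝ] ℝ where
  toFun ψ := (∏ j, ‖p.2 j‖)⁻¹ * iteratedFDeriv ℝ i ψ p.1 p.2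
  map_add' φ ψ := by
    have h1 : ContDiff ℝ ∞ φ := φ.contDiff
    have h2 : ContDiff ℝ ∞ ψ := ψ.contDiff
    rw [FunLike.coe_add, iteratedFDeriv_add_apply (h1.contDiffAt.of_le (by exact_mod_cast le_top))
      (h2.contDiffAt.of_le (by exact_mod_cast le_top)), add_apply, mul_add]
  map_smul' c φ := by
    have h1 : ContDiff ℝ ∞ φ := φ.contDiff
    rw [FunLike.coe_smul, iteratedFDeriv_const_smul_apply
      (h1.contDiffAt.of_le (by exact_mod_cast le_top)), smul_apply,
      smul_eq_mul, smul_eq_mul, RingHom.id_apply]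
    ring

/-- The derivatives of order i at all points and in all directions form one family of functionals,
uniformly bounded on S; the operator norm is recovered from the directions. -/
theorem exists_scaleBdOn_of_isCompact (r : ℕ) {S : Set (TestFn d)} (hS : IsCompact S) :
    ∃ A : ℝ, 0 ≤ A ∧ ∀ ψ ∈ S, ScaleBdOn r univ 1 A ψ := by
  have h : ∀ i : ℕ, ∃ C : ℝ, ∀ ψ ∈ S, ∀ p, |derivAt i p ψ| ≤ C := by
    intro i
    refine exists_bound_of_isCompact i (derivAt i) (fun R _ => ⟨1, zero_le_one, ?_⟩) hS
    intro A hA ψ _ hψ p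
    have h1 := hψ i le_rfl p.1 (mem_univ _)
    rw [one_pow, div_one] at h1
    change |(∏ j, ‖p.2 j‖)⁻¹ * iteratedFDeriv ℝ i ψ p.1 p.2| ≤ _
    have h0 : 0 ≤ ∏ j, ‖p.2 j‖ := Finset.prod_nonneg fun j _ => norm_nonneg _
    have h2 := (iteratedFDeriv ℝ i ψ p.1).le_opNorm p.2
    rw [abs_mul, abs_of_nonneg (inv_nonneg.mpr h0), one_mul]
    -- If some direction is zero, the normalising factor is 0⁻¹ = 0.
    rcases h0.eq_or_lt with h0 | h0
    · rw [← h0, inv_zero, zero_mul]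
      exact hA
    · rw [inv_mul_le_iff₀ h0]
      refine h2.trans ?_
      rw [mul_comm]
      gcongr
  choose C hC using h
  refine ⟨∑ i ∈ Finset.range (r + 1), |C i|, Finset.sum_nonneg fun i _ => abs_nonneg _,
    fun ψ hψ i hi y _ => ?_⟩
  have h1 : ‖iteratedFDeriv ℝ i ψ y‖ ≤ |C i| := by
    refine ContinuousMultilinearMap.opNorm_le_bound (abs_nonneg _) fun v => ?_
    have h2 := (hC i ψ hψ (y, v)).trans (le_abs_self _)
    change |(∏ j, ‖v j‖)⁻¹ * iteratedFDeriv ℝ i ψ y v| ≤ _ at h2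
    have h0 : 0 ≤ ∏ j, ‖v j‖ := Finset.prod_nonneg fun j _ => norm_nonneg _
    rw [abs_mul, abs_of_nonneg (inv_nonneg.mpr h0)] at h2
    rcases h0.eq_or_lt with h0 | h0
    · obtain ⟨j, -, hj⟩ := Finset.prod_eq_zero_iff.mp h0.symm
      rw [ContinuousMultilinearMap.map_coord_zero _ j (norm_eq_zero.mp hj), norm_zero, ← h0,
        mul_zero]
    · rw [inv_mul_le_iff₀ h0, mul_comm] at h2
      exact h2
  refine h1.trans ?_
  rw [one_pow, div_one]
  exact Finset.single_le_sum (f := fun i => |C i|) (fun i _ => abs_nonneg _)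
    (Finset.mem_range.mpr (Nat.lt_succ_of_le hi))

theorem apply_eq_zero_of_tsupport_subset {ψ : TestFn d} {R : ℝ}
    (hψ : tsupport ψ ⊆ Metric.closedBall 0 R) {x : Sp d} (hx : R < ‖x‖) : ψ x = 0 := by
  by_contra h
  exact absurd (mem_closedBall_zero_iff.mp (hψ (subset_tsupport _ h))) (not_le.mpr hx)

/-- Weighted point evaluation. -/
def evalWeighted (c : ℝ) (x : Sp d) : TestFn d →ₗ[ℝ] ℝ where
  toFun ψ := c * ψ x
  map_add' φ ψ := mul_add c (φ x) (ψ x)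
  map_smul' a φ := mul_left_comm c a (φ x)

/-- Otherwise some ψ_m in S are nonzero at points x_m going to infinity. The functionals φ ↦ m
φ(x_m) / ψ_m(x_m) are uniformly bounded on tests supported in a given ball, hence on S, yet the m-th
takes the value m at ψ_m. -/
theorem exists_tsupport_subset_of_isCompact {S : Set (TestFn d)} (hS : IsCompact S) :
    ∃ R : ℝ, 1 ≤ R ∧ ∀ ψ ∈ S, tsupport ψ ⊆ Metric.closedBall 0 R := by
  by_contra hcon
  push Not at hcon
  have h : ∀ m : ℕ, ∃ ψ ∈ S, ∃ x : Sp d, (m : ℝ) < ‖x‖ ∧ ψ x ≠ 0 := by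
    intro m
    -- m + 1 rather than m, because the negated claim concerns only radii at least 1.
    obtain ⟨ψ, hψ, hne⟩ := hcon (m + 1) (by linarith [Nat.cast_nonneg (α := ℝ) m])
    by_contra hc
    push Not at hc
    refine hne (closure_minimal (fun x hx => ?_) Metric.isClosed_closedBall)
    rw [mem_closedBall_zero_iff]
    by_contra hx'
    exact hx (hc ψ hψ x (by linarith [not_le.mp hx']))
  choose ψ hψ x hx hne using h
  let c : ℕ → ℝ := fun m => m / ψ m (x m)
  have hbound : ∀ R : ℝ, 1 ≤ R → ∃ C : ℝ, 0 ≤ C ∧ ∀ A : ℝ, 0 ≤ A → ∀ φ : TestFn d,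
      tsupport φ ⊆ Metric.closedBall 0 R → ScaleBdOn 0 univ 1 A φ →
        ∀ m, |evalWeighted (c m) (x m) φ| ≤ C * A := by
    intro R _
    refine ⟨∑ j ∈ Finset.range ⌈R⌉₊, |c j|, Finset.sum_nonneg fun i _ => abs_nonneg _, ?_⟩
    intro A hA φ hφS hφ m
    change |c m * φ (x m)| ≤ _
    -- Only the points with m < ⌈R⌉ can meet the ball of radius R, so finitely many weights matter.
    by_cases hm : m < ⌈R⌉₊
    · rw [abs_mul]
      refine mul_le_mul ?_ ?_ (abs_nonneg _) (Finset.sum_nonneg fun i _ => abs_nonneg _)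
      · exact Finset.single_le_sum (f := fun i => |c i|) (fun i _ => abs_nonneg _)
          (Finset.mem_range.mpr hm)
      · simpa using hφ 0 le_rfl (x m) (mem_univ _)
    · have : R ≤ m := (Nat.le_ceil R).trans (by exact_mod_cast not_lt.mp hm)
      rw [apply_eq_zero_of_tsupport_subset hφS (this.trans_lt (hx m)), mul_zero, abs_zero]
      exact mul_nonneg (Finset.sum_nonneg fun i _ => abs_nonneg _) hA
  obtain ⟨C, hC⟩ := exists_bound_of_isCompact 0 (fun m => evalWeighted (c m) (x m)) hbound hS
  obtain ⟨m, hm⟩ := exists_nat_gt C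
  have h1 : |(m : ℝ) / ψ m (x m) * ψ m (x m)| ≤ C := hC (ψ m) (hψ m) m
  rw [div_mul_cancel₀ _ (hne m), abs_of_nonneg (Nat.cast_nonneg m)] at h1
  linarith

end Compact

/-! ### Bilinearity and continuity of the product -/

section Bilinear

variable {d r : ℕ} {α β : ℝ}

theorem taylorFn_apply (n : ℕ) (f : Sp d → ℝ) (x y : Sp d) : taylorFn n f x y =
    ∑ j ∈ Finset.range (n + 1), (j.factorial : ℝ)⁻¹ • iteratedFDeriv ℝ j f x fun _ => y - x :=
  eval_taylor f x (y - x)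

theorem taylorFn_add {n : ℕ} {f g : Sp d → ℝ} (hf : ContDiff ℝ n f) (hg : ContDiff ℝ n g)
    (x : Sp d) : taylorFn n (f + g) x = taylorFn n f x + taylorFn n g x := by
  funext y
  rw [Pi.add_apply, taylorFn_apply, taylorFn_apply, taylorFn_apply, ← Finset.sum_add_distrib]
  refine Finset.sum_congr rfl fun j hj => ?_
  have hj' : j ≤ n := Nat.lt_succ_iff.mp (Finset.mem_range.mp hj)
  rw [iteratedFDeriv_add_apply (hf.contDiffAt.of_le (by exact_mod_cast hj'))
    (hg.contDiffAt.of_le (by exact_mod_cast hj')), ← smul_add]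
  rfl

theorem taylorFn_smul {n : ℕ} {f : Sp d → ℝ} (c : ℝ) (hf : ContDiff ℝ n f) (x : Sp d) :
    taylorFn n (c • f) x = c • taylorFn n f x := by
  funext y
  rw [Pi.smul_apply, taylorFn_apply, taylorFn_apply, Finset.smul_sum]
  refine Finset.sum_congr rfl fun j hj => ?_
  have hj' : j ≤ n := Nat.lt_succ_iff.mp (Finset.mem_range.mp hj)
  rw [iteratedFDeriv_const_smul_apply (hf.contDiffAt.of_le (by exact_mod_cast hj')),
    smul_comm c]
  rfl

/-- A linear relation between local expansions is inherited by the products. -/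
theorem product_eq_of_expansion_eq (hd : 1 ≤ d) (hβ : 0 < β) (hαβ : α < β)
    {ξ ξ₁ ξ₂ : HolderNeg d α r} {f f₁ f₂ : HolderPos d β} {a b : ℝ}
    (h : ∀ x, xiPi α ξ.toDist x (xiLift α f x) = a • xiPi α ξ₁.toDist x (xiLift α f₁ x) +
      b • xiPi α ξ₂.toDist x (xiLift α f₂ x)) :
    product hd hβ hαβ ξ f = a • product hd hβ hαβ ξ₁ f₁ + b • product hd hβ hαβ ξ₂ f₂ := by
  refine ((isReconstruction_iff hd hβ hαβ ξ f _).mp fun K => ?_).symm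
  obtain ⟨C, hC⟩ := isReconstruction_product hd hβ hαβ ξ₁ f₁ K
  obtain ⟨D, hD⟩ := isReconstruction_product hd hβ hαβ ξ₂ f₂ K
  refine ⟨|a| * C + |b| * D, fun φ hφ x hx l hl hl1 => ?_⟩
  have h1 : (a • product hd hβ hαβ ξ₁ f₁ + b • product hd hβ hαβ ξ₂ f₂ -
      xiPi α ξ.toDist x (xiLift α f x)) (scaled φ x l hl) =
      a * (product hd hβ hαβ ξ₁ f₁ - xiPi α ξ₁.toDist x (xiLift α f₁ x)) (scaled φ x l hl) +
      b * (product hd hβ hαβ ξ₂ f₂ - xiPi α ξ₂.toDist x (xiLift α f₂ x)) (scaled φ x l hl) := by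
    rw [h]
    simp only [sub_apply, add_apply, smul_apply, smul_eq_mul]
    ring
  rw [h1]
  refine (abs_add_le _ _).trans ?_
  rw [abs_mul, abs_mul, add_mul, mul_assoc, mul_assoc]
  exact add_le_add (mul_le_mul_of_nonneg_left (hC φ hφ x hx l hl hl1) (abs_nonneg a))
    (mul_le_mul_of_nonneg_left (hD φ hφ x hx l hl hl1) (abs_nonneg b))

theorem xiPi_xiLift_ext (ξ : Dist d) {f : HolderPos d β} {x : Sp d} {η : Dist d}
    (h : ∀ ψ, ξ (mulTest (taylorFn (below β) f.toFun x) (contDiff_taylorFn _ _ x) ψ) = η ψ) :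
    xiPi α ξ x (xiLift α f x) = η :=
  DFunLike.ext _ _ fun ψ => (xiPi_xiLift_apply α ξ f x ψ).trans (h ψ)

theorem product_add_left (hd : 1 ≤ d) (hβ : 0 < β) (hαβ : α < β) (ξ ζ : HolderNeg d α r)
    (f : HolderPos d β) :
    product hd hβ hαβ (ξ + ζ) f = product hd hβ hαβ ξ f + product hd hβ hαβ ζ f := by
  have h := product_eq_of_expansion_eq (ξ := ξ + ζ) (ξ₁ := ξ) (ξ₂ := ζ) (f := f) (f₁ := f)
    (f₂ := f) (a := 1) (b := 1) hd hβ hαβ fun x => xiPi_xiLift_ext _ fun ψ => by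
    simp only [one_smul, add_apply, xiPi_xiLift_apply, map_add]
  simpa only [one_smul] using h

theorem product_smul_left (hd : 1 ≤ d) (hβ : 0 < β) (hαβ : α < β) (c : ℝ) (ξ : HolderNeg d α r)
    (f : HolderPos d β) :
    product hd hβ hαβ (c • ξ) f = c • product hd hβ hαβ ξ f := by
  -- The coefficient b = 0 switches off the second slot, whose entries are dummies.
  have h := product_eq_of_expansion_eq (ξ := c • ξ) (ξ₁ := ξ) (ξ₂ := ξ) (f := f) (f₁ := f)
    (f₂ := f) (a := c) (b := 0) hd hβ hαβ fun x => xiPi_xiLift_ext _ fun ψ => by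
    simp only [zero_smul, add_zero, smul_apply, xiPi_xiLift_apply, map_smul]
  simpa only [zero_smul, add_zero] using h

theorem product_add_right (hd : 1 ≤ d) (hβ : 0 < β) (hαβ : α < β) (ξ : HolderNeg d α r)
    (f g : HolderPos d β) :
    product hd hβ hαβ ξ (f + g) = product hd hβ hαβ ξ f + product hd hβ hαβ ξ g := by
  have h := product_eq_of_expansion_eq (ξ := ξ) (ξ₁ := ξ) (ξ₂ := ξ) (f := f + g) (f₁ := f)
    (f₂ := g) (a := 1) (b := 1) hd hβ hαβ fun x => xiPi_xiLift_ext _ fun ψ => by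
    simp only [one_smul, add_apply, xiPi_xiLift_apply]
    rw [← map_add]
    congr 1
    ext y
    change ψ y * taylorFn (below β) (f.toFun + g.toFun) x y = ψ y * _ + ψ y * _
    rw [taylorFn_add (f := f.toFun) (g := g.toFun) f.2.1 g.2.1, Pi.add_apply, mul_add]
  simpa only [one_smul] using h

theorem product_smul_right (hd : 1 ≤ d) (hβ : 0 < β) (hαβ : α < β) (c : ℝ) (ξ : HolderNeg d α r)
    (f : HolderPos d β) :
    product hd hβ hαβ ξ (c • f) = c • product hd hβ hαβ ξ f := by
  have h := product_eq_of_expansion_eq (ξ := ξ) (ξ₁ := ξ) (ξ₂ := ξ) (f := c • f) (f₁ := f)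
    (f₂ := f) (a := c) (b := 0) hd hβ hαβ fun x => xiPi_xiLift_ext _ fun ψ => by
    simp only [zero_smul, add_zero, smul_apply, xiPi_xiLift_apply]
    rw [← map_smul]
    congr 1
    ext y
    change ψ y * taylorFn (below β) (c • f.toFun) x y = c * (ψ y * _)
    rw [taylorFn_smul (f := f.toFun) c f.2.1, Pi.smul_apply, smul_eq_mul]
    ring
  simpa only [zero_smul, add_zero] using h

/-- The product as a bilinear map. -/
def productBilin (hd : 1 ≤ d) (hβ : 0 < β) (hαβ : α < β) :
    HolderNeg d α r →ₗ[ℝ] HolderPos d β →ₗ[ℝ] Dist d :=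
  LinearMap.mk₂ ℝ (product hd hβ hαβ) (product_add_left hd hβ hαβ) (product_smul_left hd hβ hαβ)
    (product_add_right hd hβ hαβ) (product_smul_right hd hβ hαβ)

/-- A compact set of tests enters the estimate only through a common radius R and a common
derivative bound A. -/
theorem exists_abs_product_le_of_isCompact (hd : 1 ≤ d) (hβ : 0 < β) (hαβ : α < β)
    {S : Set (TestFn d)} (hS : IsCompact S) : ∃ (K L : Compacts (Sp d)) (C : ℝ), 0 ≤ C ∧
    ∀ (ξ : HolderNeg d α r) (f : HolderPos d β) (P Q : ℝ), 0 ≤ P → 0 ≤ Q →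
    NegBound α r K P ξ.toDist → PosBound β L Q f.toFun →
    ∀ ψ ∈ S, |product hd hβ hαβ ξ f ψ| ≤ C * P * Q := by
  obtain ⟨R, hR, hRS⟩ := exists_tsupport_subset_of_isCompact hS
  obtain ⟨A, hA, hAS⟩ := exists_scaleBdOn_of_isCompact r hS
  obtain ⟨C, hC0, hC⟩ := exists_abs_limitPairing_le d r hd hβ hαβ
  refine ⟨ballK d (R + 1), ballK d (3 * (R + 2)), C * A * R ^ d, by positivity, ?_⟩
  intro ξ f P Q hP hQ hξ hf ψ hψ
  exact (hC ξ f P Q R hQ hP hR hξ hf A hA ψ (hRS ψ hψ) (hAS ψ hψ)).trans (le_of_eq (by ring))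

theorem withSeminorms_holderNeg : WithSeminorms (holderNegSeminorm d α r) := ⟨rfl⟩

theorem withSeminorms_holderPos : WithSeminorms (holderPosSeminorm d β) := ⟨rfl⟩

instance : IsTopologicalAddGroup (HolderNeg d α r) := withSeminorms_holderNeg.topologicalAddGroup

instance : IsTopologicalAddGroup (HolderPos d β) := withSeminorms_holderPos.topologicalAddGroup

/-- The seminorm is an infimum; being strictly below δ yields an admissible constant below δ, so the
bound holds with δ itself. -/
theorem eventually_negBound (K : Compacts (Sp d)) {δ : ℝ} (hδ : 0 < δ) :
    ∀ᶠ ξ : HolderNeg d α r in 𝓝 0, NegBound α r K δ ξ.toDist := by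
  have h := (withSeminorms_holderNeg (d := d) (α := α) (r := r)).continuous_seminorm K
  have h0 : holderNegSeminorm d α r K 0 < δ := by rwa [map_zero]
  filter_upwards [h.continuousAt.eventually (gt_mem_nhds h0)] with ξ hξ
  obtain ⟨C, ⟨-, hC⟩, hCδ⟩ := exists_lt_of_csInf_lt (ξ.2 K) hξ
  intro φ hφ x hx l hl hl1
  exact (hC φ hφ x hx l hl hl1).trans (by gcongr)

theorem eventually_posBound (K : Compacts (Sp d)) {δ : ℝ} (hδ : 0 < δ) :
    ∀ᶠ f : HolderPos d β in 𝓝 0, PosBound β K δ f.toFun := by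
  have h := (withSeminorms_holderPos (d := d) (β := β)).continuous_seminorm K
  have h0 : holderPosSeminorm d β K 0 < δ := by rwa [map_zero]
  filter_upwards [h.continuousAt.eventually (gt_mem_nhds h0)] with f hf
  obtain ⟨C, ⟨-, hC⟩, hCδ⟩ := exists_lt_of_csInf_lt (f.2.2 K) hf
  exact ⟨fun i hi x hx => (hC.1 i hi x hx).trans hCδ.le,
    fun x hx y hy => (hC.2 x hx y hy).trans (by gcongr)⟩

/-- Uniform smallness on compact sets of tests describes a basis of neighbourhoods of 0 for the
topology of distributions. -/
theorem tendsto_dist_zero {ι : Type*} {F : Filter ι} {η : ι → Dist d}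
    (h : ∀ S : Set (TestFn d), IsCompact S → ∀ ε : ℝ, 0 < ε →
      ∀ᶠ i in F, ∀ ψ ∈ S, |η i ψ| < ε) : Tendsto η F (𝓝 0) := by
  refine (CompactConvergenceCLM.hasBasis_nhds_zero_of_basis Metric.nhds_basis_ball
    ).tendsto_right_iff.mpr ?_
  rintro ⟨S, ε⟩ ⟨hS, hε⟩
  filter_upwards [h S hS ε hε] with i hi ψ hψ
  simpa using hi ψ hψ

/-- A biadditive map is continuous once it is continuous at (0, 0) and, with either variable fixed,
at 0. All three cases use the same estimate on a compact set S. -/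
theorem continuous_productBilin (hd : 1 ≤ d) (hβ : 0 < β) (hαβ : α < β) :
    Continuous fun p : HolderNeg d α r × HolderPos d β => productBilin hd hβ hαβ p.1 p.2 := by
  let F : HolderNeg d α r →+ HolderPos d β →+ Dist d :=
    AddMonoidHom.mk' (fun ξ => (productBilin hd hβ hαβ ξ).toAddMonoidHom) fun ξ ζ => by
      ext1 f
      exact product_add_left hd hβ hαβ ξ ζ f
  have hF : ∀ ξ f, F ξ f = product hd hβ hαβ ξ f := fun _ _ => rfl
  refine continuous_of_continuousAt_zero₂ F ?_ (fun ξ => ?_) fun f => ?_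
  · rw [ContinuousAt, map_zero]
    refine tendsto_dist_zero fun S hS ε hε => ?_
    obtain ⟨K, L, C, hC0, hC⟩ := exists_abs_product_le_of_isCompact (r := r) hd hβ hαβ hS
    -- f is kept in the neighbourhood with constant 1 and ξ carries the smallness; the added 1
    -- allows C = 0 and makes the final inequality strict.
    have hδ : 0 < ε / (C + 1) := by positivity
    rw [nhds_prod_eq]
    filter_upwards [(eventually_negBound K hδ).prod_mk (eventually_posBound L one_pos)]
      with p hp ψ hψ
    rw [hF]
    refine (hC p.1 p.2 _ _ hδ.le zero_le_one hp.1 hp.2 ψ hψ).trans_lt ?_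
    rw [mul_one, mul_div_assoc', div_lt_iff₀ (by positivity)]
    linarith
  · rw [ContinuousAt, map_zero]
    refine tendsto_dist_zero fun S hS ε hε => ?_
    obtain ⟨K, L, C, hC0, hC⟩ := exists_abs_product_le_of_isCompact (r := r) hd hβ hαβ hS
    obtain ⟨P, hP, hξ⟩ := ξ.2 K
    have hδ : 0 < ε / (C * P + 1) := by positivity
    filter_upwards [eventually_posBound L hδ] with f hf ψ hψ
    rw [hF]
    refine (hC ξ f _ _ hP hδ.le hξ hf ψ hψ).trans_lt ?_
    rw [mul_div_assoc', div_lt_iff₀ (by positivity)]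
    linarith
  · rw [ContinuousAt, map_zero]
    refine tendsto_dist_zero fun S hS ε hε => ?_
    obtain ⟨K, L, C, hC0, hC⟩ := exists_abs_product_le_of_isCompact (r := r) hd hβ hαβ hS
    obtain ⟨Q, hQ, hf⟩ := f.2.2 L
    have hδ : 0 < ε / (C * Q + 1) := by positivity
    filter_upwards [eventually_negBound K hδ] with ξ hξ ψ hψ
    rw [hF]
    refine (hC ξ f _ _ hδ.le hQ hξ hf ψ hψ).trans_lt ?_
    rw [mul_right_comm, mul_div_assoc', div_lt_iff₀ (by positivity)]
    linarith

end Bilinear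

/-! ### The model -/

section Model

variable {d r : ℕ} {α β : ℝ}

/-- The inclusion of `T_a` into `T`. -/
abbrev inclComp (a : homs α) : comp d α a →ₗ[ℝ] ⨁ a, comp d α a :=
  DirectSum.lof ℝ (homs α) (comp d α) a

theorem coeffAt_incl_of_ne {a : homs α} (τ : comp d α a) {i : Idx d} (hi : hom α i ≠ a) :
    coeffAt (toPoly d α (inclComp a τ)) i = 0 := by
  rw [coeffAt_toPoly]
  rw [DirectSum.lof_eq_of, DirectSum.of_eq_of_ne _ _ _ hi]
  rfl

theorem abs_coeffAt_incl_le {a : homs α} (τ : comp d α a) (i : Idx d) :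
    |coeffAt (toPoly d α (inclComp a τ)) i| ≤ ‖τ‖ := by
  by_cases hi : hom α i = a
  · subst hi
    rw [coeffAt_toPoly]
    rw [DirectSum.lof_eq_of, DirectSum.of_eq_same]
    exact norm_le_pi_norm τ ⟨i, rfl⟩
  · rw [coeffAt_incl_of_ne τ hi, abs_zero]
    exact norm_nonneg _

theorem coeff_fst_incl {a : homs α} (τ : comp d α a) (k : Fin d →₀ ℕ)
    (hk : (k.degree : ℝ) ≠ a) :
    (toPoly d α (inclComp a τ)).1.coeff k = 0 :=
  coeffAt_incl_of_ne τ (i := Sum.inl k) fun h => hk (congrArg Subtype.val h)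

theorem coeff_snd_incl {a : homs α} (τ : comp d α a) (k : Fin d →₀ ℕ)
    (hk : (k.degree : ℝ) ≠ a + α) :
    (toPoly d α (inclComp a τ)).2.coeff k = 0 :=
  coeffAt_incl_of_ne τ (i := Sum.inr k) fun h => hk (eq_add_of_sub_eq (congrArg Subtype.val h))

/-- Only monomials of the single degree s occur, so the bound scales exactly as L ^ s. -/
theorem abs_coeff_mul_pow_le {p : Poly d} {s t L : ℝ} (hL : 0 ≤ L) (ht : 0 ≤ t)
    (hp : ∀ k : Fin d →₀ ℕ, (k.degree : ℝ) ≠ s → p.coeff k = 0) (hpt : ∀ k, |p.coeff k| ≤ t)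
    (k : Fin d →₀ ℕ) : |p.coeff k| * L ^ k.degree ≤ t * L ^ s := by
  by_cases hk : (k.degree : ℝ) = s
  · rw [← hk, Real.rpow_natCast]
    exact mul_le_mul_of_nonneg_right (hpt k) (by positivity)
  · rw [hp k hk, abs_zero, zero_mul]
    positivity

/-- On the ball of radius ‖h‖ the translated polynomial takes values of p at points of norm at most
2‖h‖. Bounding these monomial by monomial controls its coefficients. -/
theorem exists_coeff_transl_bound (d n : ℕ) : ∃ C : ℝ, 0 ≤ C ∧ ∀ (p : Poly d) (h : Sp d) (M : ℝ),
    h ≠ 0 → (∀ k, n < k.degree → p.coeff k = 0) → (∀ k, |p.coeff k| * ‖h‖ ^ k.degree ≤ M) →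
    ∀ k, |(transl h p).coeff k| * ‖h‖ ^ k.degree ≤ C * M := by
  obtain ⟨C, hC0, hC⟩ := exists_coeff_bound d n
  refine ⟨C * ((indices d n).card * 2 ^ n), by positivity, fun p h M hh hp hM k => ?_⟩
  have h0 : 0 < ‖h‖ := norm_pos_iff.mpr hh
  rw [mul_assoc]
  refine hC _ (coeff_transl_eq_zero h hp) ‖h‖ _ h0 (fun u hu => ?_) k
  have hev : MvPolynomial.eval (fun i => u i) (transl h p) =
      MvPolynomial.eval (fun i => (u - h) i) p := by
    have := congrFun (evalAt_transl 0 h p) u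
    simpa [evalAt] using this
  rw [hev, sum_indices_eq_eval hp, mul_assoc]
  refine (Finset.abs_sum_le_sum_abs _ _).trans ?_
  rw [← nsmul_eq_mul]
  refine Finset.sum_le_card_nsmul _ _ _ fun k hk => ?_
  have huh : ‖u - h‖ ≤ 2 * ‖h‖ := (norm_sub_le u h).trans (by linarith)
  have hprod : |∏ i, (u - h) i ^ k i| ≤ (2 * ‖h‖) ^ k.degree := by
    rw [Finset.abs_prod, Finsupp.degree_eq_sum, ← Finset.prod_pow_eq_pow_sum]
    refine Finset.prod_le_prod (fun i _ => abs_nonneg _) fun i _ => ?_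
    rw [abs_pow]
    exact pow_le_pow_left₀ (abs_nonneg _) ((abs_coord_le _ i).trans huh) _
  calc |p.coeff k * ∏ i, (u - h) i ^ k i|
      ≤ |p.coeff k| * (2 * ‖h‖) ^ k.degree := by
        rw [abs_mul]
        exact mul_le_mul_of_nonneg_left hprod (abs_nonneg _)
    _ = 2 ^ k.degree * (|p.coeff k| * ‖h‖ ^ k.degree) := by rw [mul_pow]; ring
    _ ≤ 2 ^ n * M := mul_le_mul (pow_le_pow_right₀ one_le_two (mem_indices.mp hk)) (hM k)
        (by positivity) (by positivity)

/-- A rescaled test has height at most l^{-d} on a ball of volume proportional to l ^ d, so its mass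
is at most the volume of the unit ball. -/
theorem exists_abs_ofContinuous_scaled_le (d r : ℕ) : ∃ C : ℝ, 0 ≤ C ∧ ∀ (g : C(Sp d, ℝ))
    (x : Sp d) (l M : ℝ) (hl : 0 < l), (∀ y ∈ Metric.closedBall x l, |g y| ≤ M) →
    ∀ φ ∈ unitTests d r, |ofContinuous g (scaled φ x l hl)| ≤ C * M := by
  refine ⟨volume.real (Metric.closedBall (0 : Sp d) 1), measureReal_nonneg,
    fun g x l M hl hM φ hφ => ?_⟩
  have hzero : ∀ y, y ∉ Metric.closedBall x l → scaled φ x l hl y * g y = 0 := fun y hy => by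
    rw [image_eq_zero_of_notMem_tsupport fun h => hy (tsupport_scaled hφ x hl h), zero_mul]
  rw [ofContinuous_apply, ← setIntegral_eq_integral_of_forall_compl_eq_zero hzero]
  have hbd : ∀ y ∈ Metric.closedBall x l, ‖scaled φ x l hl y * g y‖ ≤ (l ^ d)⁻¹ * M := by
    intro y hy
    have h1 : |scaled φ x l hl y| ≤ (l ^ d)⁻¹ := by
      simpa using scaleBdOn_scaled hφ x hl 0 (Nat.zero_le r) y (mem_univ _)
    rw [norm_mul]
    exact mul_le_mul h1 (hM y hy) (abs_nonneg _) (by positivity)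
  refine (norm_setIntegral_le_of_norm_le_const measure_closedBall_lt_top hbd).trans
    (le_of_eq ?_)
  rw [measureReal_def, Measure.addHaar_closedBall _ _ hl.le, ENNReal.toReal_mul,
    ENNReal.toReal_ofReal (by positivity), finrank_euclideanSpace_fin]
  rw [measureReal_def, Measure.addHaar_closedBall _ _ zero_le_one]
  field_simp
  simp

theorem exists_abs_ofContinuous_evalAt_le (d r n : ℕ) : ∃ C : ℝ, 0 ≤ C ∧ ∀ (p : Poly d)
    (x : Sp d) (l M : ℝ) (hl : 0 < l), (∀ k, n < k.degree → p.coeff k = 0) →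
    (∀ k, |p.coeff k| * l ^ k.degree ≤ M) → ∀ φ ∈ unitTests d r,
    |ofContinuous ⟨evalAt x p, (contDiff_evalAt x p).continuous⟩ (scaled φ x l hl)| ≤ C * M := by
  obtain ⟨C, hC0, hC⟩ := exists_scaleBdOn_evalAt d n 0
  obtain ⟨D, hD0, hD⟩ := exists_abs_ofContinuous_scaled_le d r
  refine ⟨D * C, by positivity, fun p x l M hl hp hM φ hφ => ?_⟩
  rw [mul_assoc]
  refine hD _ x l _ hl (fun y hy => ?_) φ hφ
  simpa using hC p x l M hl hp hM 0 le_rfl y hy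

/-- The test multiplied by the polynomial is again localised at scale l around x, with its height
multiplied by a constant times M. -/
theorem exists_abs_smoothMul_evalAt_le (d r n : ℕ) : ∃ C : ℝ, 0 ≤ C ∧ ∀ (p : Poly d)
    (x : Sp d) (l M : ℝ) (hl : 0 < l), (∀ k, n < k.degree → p.coeff k = 0) →
    (∀ k, |p.coeff k| * l ^ k.degree ≤ M) → ∀ (ξ : Dist d) (N : ℝ),
    (∀ φ ∈ unitTests d r, |ξ (scaled φ x l hl)| ≤ N) → ∀ φ ∈ unitTests d r,
    |smoothMul (evalAt x p) (contDiff_evalAt x p) ξ (scaled φ x l hl)| ≤ C * M * N := by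
  obtain ⟨C, hC0, hC⟩ := exists_scaleBdOn_evalAt d n r
  refine ⟨2 ^ r * C, by positivity, fun p x l M hl hp hM ξ N hN φ hφ => ?_⟩
  have hM0 : 0 ≤ M := (by positivity : 0 ≤ |p.coeff 0| * l ^ _).trans (hM 0)
  have h1 := scaleBdOn_mulTest (contDiff_evalAt x p) hl (by positivity) (by positivity)
    (tsupport_scaled hφ x hl) (scaleBdOn_scaled hφ x hl) (hC p x l M hl hp hM)
  rw [smoothMul_apply]
  refine (abs_apply_le_of_localised hl hN (by positivity)
    (((tsupport_mulTest_subset _ _ _).trans inter_subset_left).trans (tsupport_scaled hφ x hl))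
    h1).trans (le_of_eq ?_)
  field_simp

/-! ### Analytic bounds and algebraic relations of the model -/

theorem sInf_homs (hα : 0 < α) : sInf (homs α) = -α := by
  refine IsLeast.csInf_eq ⟨⟨0, Or.inr (by simp)⟩, ?_⟩
  rintro a ⟨n, rfl | rfl⟩
  · linarith [Nat.cast_nonneg (α := ℝ) n]
  · linarith [Nat.cast_nonneg (α := ℝ) n]

theorem polyPi_apply (ξ : Dist d) (x : Sp d) (τ : Poly d × Poly d) (ψ : TestFn d) :
    polyPi ξ x τ ψ = ofContinuous ⟨evalAt x τ.1, (contDiff_evalAt x _).continuous⟩ ψ +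
      smoothMul (evalAt x τ.2) (contDiff_evalAt x _) ξ ψ := rfl

theorem degree_le_ceil {a γ : ℝ} {k : Fin d →₀ ℕ} (hk : (k.degree : ℝ) = a) (ha : a ≤ γ) :
    k.degree ≤ ⌈γ⌉₊ :=
  Nat.cast_le.mp ((hk.le.trans ha).trans (Nat.le_ceil γ))

/-- In homogeneity a the polynomial copy has degree a and the Ξ copy degree a + α. The latter gives
l ^ (a + α), and ξ gives back l ^ (-α). The cut-off ⌈γ + α⌉ covers both degrees. -/
theorem exists_abs_polyPi_incl_le (hα : 0 < α) (ξ : HolderNeg d α r) (K : Compacts (Sp d)) (γ : ℝ) :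
    ∃ C : ℝ, ∀ φ ∈ unitTests d r, ∀ x ∈ K, ∀ (l : ℝ) (hl : 0 < l), l ≤ 1 → ∀ a : homs α,
      (a : ℝ) ≤ γ → ∀ τ : comp d α a,
      |polyPi ξ.toDist x (toPoly d α (inclComp a τ)) (scaled φ x l hl)| ≤
        C * l ^ (a : ℝ) * ‖τ‖ := by
  obtain ⟨P, hP, hξ⟩ := ξ.2 K
  obtain ⟨C, hC0, hC⟩ := exists_abs_ofContinuous_evalAt_le d r ⌈γ + α⌉₊
  obtain ⟨D, hD0, hD⟩ := exists_abs_smoothMul_evalAt_le d r ⌈γ + α⌉₊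
  refine ⟨C + D * P, fun φ hφ x hx l hl hl1 a ha τ => ?_⟩
  have h1 := hC _ x l (‖τ‖ * l ^ (a : ℝ)) hl
    (fun k hk => coeff_fst_incl τ k fun h => absurd (degree_le_ceil h (by linarith)) hk.not_ge)
    (abs_coeff_mul_pow_le hl.le (norm_nonneg _) (coeff_fst_incl τ)
      fun k => abs_coeffAt_incl_le τ (Sum.inl k)) φ hφ
  have h2 := hD _ x l (‖τ‖ * l ^ ((a : ℝ) + α)) hl
    (fun k hk => coeff_snd_incl τ k fun h => absurd (degree_le_ceil h (by linarith)) hk.not_ge)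
    (abs_coeff_mul_pow_le hl.le (norm_nonneg _) (coeff_snd_incl τ)
      fun k => abs_coeffAt_incl_le τ (Sum.inr k)) ξ.toDist (P * l ^ (-α))
    (fun φ hφ => hξ φ hφ x hx l hl hl1) φ hφ
  rw [polyPi_apply]
  refine (abs_add_le _ _).trans ((add_le_add h1 h2).trans (le_of_eq ?_))
  have h3 : l ^ ((a : ℝ) + α) * l ^ (-α) = l ^ (a : ℝ) := by
    rw [← Real.rpow_add hl, add_neg_cancel_right]
  linear_combination D * ‖τ‖ * P * h3

theorem apply_eq_coeffAt (τ : ⨁ a, comp d α a) {b : homs α} (i : {i : Idx d // hom α i = b}) :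
    τ b i = coeffAt (toPoly d α τ) i := by
  obtain ⟨i, rfl⟩ := i
  exact (coeffAt_toPoly τ i).symm

theorem le_mul_rpow_sub {c M h s t : ℝ} {n : ℕ} (hh : 0 < h) (hn : (n : ℝ) = t)
    (hc : c * h ^ n ≤ M * h ^ s) : c ≤ M * h ^ (s - t) := by
  rw [Real.rpow_sub hh, mul_div_assoc', le_div_iff₀ (by positivity), ← hn, Real.rpow_natCast]
  exact hc

/-- The shift by α disappears from a - b, so both copies reduce to the same estimate for translated
polynomials, with degrees in place of homogeneities. -/
theorem exists_norm_shift_incl_le (d : ℕ) (hα : 0 < α) (γ : ℝ) : ∃ C : ℝ, ∀ (h : Sp d) (a : homs α),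
    (a : ℝ) ≤ γ → ∀ b : homs α, b < a → ∀ τ : comp d α a,
      ‖shift d α h (inclComp a τ) b‖ ≤ C * ‖h‖ ^ ((a : ℝ) - b) * ‖τ‖ := by
  obtain ⟨C, hC0, hC⟩ := exists_coeff_transl_bound d ⌈γ + α⌉₊
  refine ⟨C, fun h a ha b hb τ => ?_⟩
  refine (pi_norm_le_iff_of_nonneg (by positivity)).mpr fun i => ?_
  rw [apply_eq_coeffAt, toPoly_shift, Real.norm_eq_abs]
  obtain ⟨i, hi⟩ := i
  have hib : ((hom α i : homs α) : ℝ) = b := congrArg Subtype.val hi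
  have hba : (b : ℝ) < a := hb
  -- For h = 0 the operator is the identity, and the component of homogeneity b ≠ a vanishes.
  rcases eq_or_ne h 0 with rfl | hh
  · rw [transl_zero, transl_zero, Prod.mk.eta, coeffAt_incl_of_ne τ (fun h => hb.ne (hi ▸ h)),
      abs_zero]
    positivity
  have h0 : 0 < ‖h‖ := norm_pos_iff.mpr hh
  rw [mul_right_comm]
  rcases i with k | k
  · refine le_mul_rpow_sub h0 hib ?_
    have h1 := hC _ h (‖τ‖ * ‖h‖ ^ (a : ℝ)) hh
      (fun k hk => coeff_fst_incl τ k fun h => absurd (degree_le_ceil h (by linarith)) hk.not_ge)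
      (abs_coeff_mul_pow_le h0.le (norm_nonneg _) (coeff_fst_incl τ)
        fun k => abs_coeffAt_incl_le τ (Sum.inl k)) k
    rwa [← mul_assoc] at h1
  · have hk : (k.degree : ℝ) = b + α := eq_add_of_sub_eq hib
    rw [← add_sub_add_right_eq_sub _ _ α]
    refine le_mul_rpow_sub h0 hk ?_
    have h1 := hC _ h (‖τ‖ * ‖h‖ ^ ((a : ℝ) + α)) hh
      (fun k hk => coeff_snd_incl τ k fun h => absurd (degree_le_ceil h (by linarith)) hk.not_ge)
      (abs_coeff_mul_pow_le h0.le (norm_nonneg _) (coeff_snd_incl τ)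
        fun k => abs_coeffAt_incl_le τ (Sum.inr k)) k
    rwa [← mul_assoc] at h1

theorem continuous_polyPi_incl (ξ : Dist d) (x : Sp d) (a : homs α) :
    Continuous fun τ : comp d α a => polyPi ξ x (toPoly d α (inclComp a τ)) :=
  LinearMap.continuous_of_finiteDimensional
    ((polyPi ξ x ∘ₗ (toPoly d α).toLinearMap) ∘ₗ inclComp a)

theorem polyPi_shift (ξ : Dist d) (x y : Sp d) (τ : ⨁ a, comp d α a) :
    polyPi ξ x (toPoly d α (shift d α (y - x) τ)) = polyPi ξ y (toPoly d α τ) := by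
  refine DFunLike.ext _ _ fun ψ => ?_
  simp only [toPoly_shift, polyPi_apply, evalAt_transl]

theorem isModel_xi (hα : 0 < α) (hr : α < r) (ξ : HolderNeg d α r) :
    IsModel (xiStructure d α) r (xiPi α ξ.toDist) (xiGamma α) where
  order := by
    change |sInf (homs α)| < r
    rw [sInf_homs hα, abs_neg, abs_of_pos hα]
    exact hr
  continuous := continuous_polyPi_incl ξ.toDist
  mul x y z := by
    refine Subtype.ext ?_
    change shift d α (y - x) * shift d α (z - y) = shift d α (z - x)
    rw [← shift_add, add_comm, sub_add_sub_cancel]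
  compat := polyPi_shift ξ.toDist
  bound_P K γ _ := exists_abs_polyPi_incl_le hα ξ K γ
  bound_Γ K γ _ := by
    obtain ⟨C, hC⟩ := exists_norm_shift_incl_le d hα γ
    refine ⟨C, fun x _ y _ a ha b hb τ => ?_⟩
    rw [norm_sub_rev]
    exact hC (y - x) a ha b hb τ

/-! ### The modelled distribution Ξ F -/

/-- The expansion `Ξ F` with its values in the concrete direct sum. -/
def xiTaylor (α : ℝ) (f : HolderPos d β) (x : Sp d) : ⨁ a, comp d α a :=
  (toPoly d α).symm (0, taylor (below β) f.toFun x)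

theorem toPoly_xiTaylor (f : HolderPos d β) (x : Sp d) :
    toPoly d α (xiTaylor α f x) = (0, taylor (below β) f.toFun x) :=
  (toPoly d α).apply_symm_apply _

/-- Homogeneity a in the Ξ copy means degree a + α, so the bound of exponent β - |k| on Taylor
coefficients is exactly the required exponent (β - α) - a. The polynomial copy is zero. -/
theorem memD_xiLift (hβ : 0 < β) (f : HolderPos d β) :
    MemD (xiStructure d α) (xiGamma α) (β - α) (xiLift α f) := by
  refine ⟨fun x (a : homs α) ha => funext fun (i : {i : Idx d // hom α i = a}) => ?_,
    fun K (a : homs α) ha => ?_⟩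
  · change xiTaylor α f x a i = 0
    rw [apply_eq_coeffAt, toPoly_xiTaylor]
    obtain ⟨k | k, hi⟩ := i
    · exact MvPolynomial.coeff_zero k
    · refine coeff_taylor_eq_zero _ _ _ ?_
      have h1 : (k.degree : ℝ) - α = a := congrArg Subtype.val hi
      have h2 := below_lt hβ
      -- From a ≥ β - α one gets |k| ≥ β, which strictly exceeds the order of the Taylor polynomial.
      exact_mod_cast (by linarith : (below β : ℝ) < k.degree)
  · obtain ⟨R, -, hK⟩ := exists_subset_ballK K
    obtain ⟨Q, hQ, hf⟩ := f.2.2 (ballK d (3 * R))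
    obtain ⟨C, hC0, hC⟩ := exists_coeff_taylor_sub_bound d hβ
    refine ⟨C * Q, fun x hx y hy => ?_⟩
    change ‖(xiTaylor α f x - shift d α (y - x) (xiTaylor α f y)) a‖ ≤ _
    refine (pi_norm_le_iff_of_nonneg (by positivity)).mpr fun i => ?_
    rw [apply_eq_coeffAt, map_sub, toPoly_shift, toPoly_xiTaylor, toPoly_xiTaylor, map_zero]
    obtain ⟨k | k, hi⟩ := i
    · change |(0 - 0 : Poly d).coeff k| ≤ _
      rw [sub_zero, MvPolynomial.coeff_zero, abs_zero]
      positivity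
    · have h1 : (k.degree : ℝ) - α = a := congrArg Subtype.val hi
      change |(taylor (below β) f.toFun x -
        transl (y - x) (taylor (below β) f.toFun y)).coeff k| ≤ _
      rcases eq_or_ne x y with rfl | hxy
      · rw [sub_self x, transl_zero, sub_self, MvPolynomial.coeff_zero, abs_zero]
        positivity
      · have h2 : β - α - (a : ℝ) = β - k.degree := by linarith
        rw [h2]
        exact le_mul_rpow_sub (norm_pos_iff.mpr (sub_ne_zero.mpr hxy)) rfl
          (hC f.toFun Q R hQ f.2.1 hf x (hK x hx) y (hK y hy) k)

/-! ### Continuous functions and consistency with the pointwise product -/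

theorem exists_abs_le_of_mem_ballK (f : C(Sp d, ℝ)) (R : ℝ) :
    ∃ C : ℝ, 0 ≤ C ∧ ∀ y ∈ ballK d R, |f y| ≤ C := by
  obtain ⟨C, hC⟩ := (ballK d R).isCompact.exists_bound_of_continuousOn f.continuous.continuousOn
  exact ⟨|C|, abs_nonneg C, fun y hy => (hC y hy).trans (le_abs_self C)⟩

theorem one_le_rpow_neg (hα : 0 < α) {l : ℝ} (hl : 0 < l) (hl1 : l ≤ 1) : 1 ≤ l ^ (-α) :=
  Real.one_le_rpow_of_pos_of_le_one_of_nonpos hl hl1 (neg_nonpos.mpr hα.le)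

/-- A continuous function as an element of `𝒞^{-α}`. -/
def contToHolderNeg (hα : 0 < α) (r : ℕ) (f : C(Sp d, ℝ)) : HolderNeg d α r :=
  ⟨ofContinuous f, fun K => by
    obtain ⟨R, -, hK⟩ := exists_subset_ballK K
    obtain ⟨M, hM0, hM⟩ := exists_abs_le_of_mem_ballK f (R + 1)
    obtain ⟨C, hC0, hC⟩ := exists_abs_ofContinuous_scaled_le d r
    refine ⟨C * M, by positivity, fun φ hφ x hx l hl hl1 => ?_⟩
    refine (hC f x l M hl (fun y hy => hM y ?_) φ hφ).trans
      (le_mul_of_one_le_right (by positivity) (one_le_rpow_neg hα hl hl1))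
    exact mem_ballK_of_mem_closedBall (add_le_add (mem_ballK.mp (hK x hx)) hl1) hy⟩

theorem toDist_contToHolderNeg (hα : 0 < α) (r : ℕ) (f : C(Sp d, ℝ)) :
    (contToHolderNeg hα r f).toDist = ofContinuous f := rfl

/-- By uniqueness it suffices that f g reconstructs. The error is f (g - T_x g), with T_x g the
Taylor polynomial of g at x; it is pointwise O(l ^ β) on the ball of radius l, and l ^ β ≤ l ^ (β -
α) since l ≤ 1. -/
theorem product_contToHolderNeg (hd : 1 ≤ d) (hα : 0 < α) (hβ : 0 < β) (hαβ : α < β)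
    (f : C(Sp d, ℝ)) (g : HolderPos d β) :
    product hd hβ hαβ (contToHolderNeg hα r f) g = ofContinuous (f * g.toCont) := by
  refine ((isReconstruction_iff hd hβ hαβ _ g _).mp fun K => ?_).symm
  obtain ⟨R, -, hK⟩ := exists_subset_ballK K
  obtain ⟨M, hM0, hM⟩ := exists_abs_le_of_mem_ballK f (R + 1)
  obtain ⟨Q, hQ, hg⟩ := g.2.2 (ballK d (R + 1))
  obtain ⟨C, hC0, hC⟩ := exists_abs_ofContinuous_scaled_le d r
  refine ⟨C * (M * Q), fun φ hφ x hx l hl hl1 => ?_⟩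
  have hxR : ‖x‖ + l ≤ R + 1 := add_le_add (mem_ballK.mp (hK x hx)) hl1
  let t : C(Sp d, ℝ) := ⟨taylorFn (below β) g.toFun x, (contDiff_taylorFn _ _ x).continuous⟩
  have h1 : (ofContinuous (f * g.toCont) -
      xiPi α (contToHolderNeg hα r f).toDist x (xiLift α g x)) (scaled φ x l hl) =
      ofContinuous (f * (g.toCont - t)) (scaled φ x l hl) := by
    rw [sub_apply, xiPi_xiLift_apply, toDist_contToHolderNeg, mul_sub, sub_eq_add_neg (f * _),
      ← neg_one_smul ℝ (f * t), ofContinuous_add, ofContinuous_smul, add_apply, smul_apply,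
      neg_one_smul, ← sub_eq_add_neg]
    congr 1
    rw [ofContinuous_apply, ofContinuous_apply]
    refine integral_congr_ae (Eventually.of_forall fun y => ?_)
    change scaled φ x l hl y * t y * f y = scaled φ x l hl y * (f y * t y)
    ring
  rw [h1, mul_assoc]
  refine hC _ x l _ hl (fun y hy => ?_) φ hφ
  have hyR := mem_ballK_of_mem_closedBall hxR hy
  have h2 := hg.abs_sub_taylor_le hβ hQ g.2.1 (by linarith : ‖x‖ ≤ R + 1) (mem_ballK.mp hyR)
  have h3 : ‖y - x‖ ^ β ≤ l ^ (β - α) := by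
    calc ‖y - x‖ ^ β ≤ l ^ β :=
          Real.rpow_le_rpow (norm_nonneg _) (mem_closedBall_iff_norm.mp hy) hβ.le
      _ ≤ l ^ (β - α) := Real.rpow_le_rpow_of_exponent_ge hl hl1 (by linarith)
  change |f y * (g.toFun y - taylorFn (below β) g.toFun x y)| ≤ _
  rw [abs_mul, mul_assoc]
  exact mul_le_mul (hM y hyR) (h2.trans (mul_le_mul_of_nonneg_left h3 hQ)) (abs_nonneg _) hM0

end Model

end RegStr

end

theorem theorem3p1 (d : ℕ) (hd : 1 ≤ d) (α β : ℝ) (hα : 0 < α) (hβ : α < β)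
    (r : ℕ) (hr : α < r) :
    ∃ B : RegStr.HolderNeg d α r →ₗ[ℝ] RegStr.HolderPos d β →ₗ[ℝ] RegStr.Dist d,
      Continuous (fun p : RegStr.HolderNeg d α r × RegStr.HolderPos d β => B p.1 p.2) ∧
      (∀ f : C(RegStr.Sp d, ℝ), ∃ ξ : RegStr.HolderNeg d α r,
        ξ.toDist = RegStr.ofContinuous f ∧
        ∀ g : RegStr.HolderPos d β, B ξ g = RegStr.ofContinuous (f * g.toCont)) ∧
      ∀ ξ : RegStr.HolderNeg d α r,
        RegStr.IsModel (RegStr.xiStructure d α) r (RegStr.xiPi α ξ.toDist) (RegStr.xiGamma α) ∧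
        ∀ f : RegStr.HolderPos d β,
          RegStr.MemD (RegStr.xiStructure d α) (RegStr.xiGamma α) (β - α) (RegStr.xiLift α f) ∧
          ∀ η : RegStr.Dist d,
            RegStr.IsReconstruction (RegStr.xiStructure d α) r (RegStr.xiPi α ξ.toDist) (β - α)
              (RegStr.xiLift α f) η ↔ η = B ξ f := by
  have hβ0 : 0 < β := hα.trans hβ
  exact ⟨RegStr.productBilin hd hβ0 hβ, RegStr.continuous_productBilin hd hβ0 hβ,
    fun f => ⟨RegStr.contToHolderNeg hα r f, rfl,
      RegStr.product_contToHolderNeg hd hα hβ0 hβ f⟩,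
    fun ξ => ⟨RegStr.isModel_xi hα hr ξ, fun f => ⟨RegStr.memD_xiLift hβ0 f,
      RegStr.isReconstruction_iff hd hβ0 hβ ξ f⟩⟩⟩
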